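/- Let $F$ and $h$ be functions of one complex variable, holomorphic near $0$. Put $S(z,\hat z)=z\hat z-\hat z^3/3$ and $\mathcal C=\{(z,\xi)\in\mathbb C^2 : 9\xi^2=4z^3\}$. There is a unique germ of holomorphic function $\Psi(z,\hat z)$ at $(0,0)$ such that, near the origin, $\Psi=1$ and $-\frac1{2\hat z}\partial_{\hat z}\Psi=h(z)$ on $z=\hat z^2$ (the second for $\hat z\neq0$), and such that $\tilde\Psi=\Psi/(z-\hat z^2)$ satisfies, for $z\ne\hat z^2$, $$\partial_z^2\tilde\Psi-\frac{2\hat z}{z-\hat z^2}\,\partial_z\partial_{\hat z}\tilde\Psi-\frac1{z-\hat z^2}\,\partial_{\hat z}^2\tilde\Psi=F(z)\tilde\Psi .$$ Let $\check\Phi(z,\xi)$ be the multivalued function defined by $\check\Phi(z,S(z,\hat z))=\Psi(z,\hat z)/(z-\hat z^2)$. A determination of it on a set $W$ disjoint from $\mathcal C$ is $\Psi(z,\zeta)/(z-\zeta^2)$, where $\zeta$ is continuous on $W$ and $S(z,\zeta(z,\xi))=\xi$. Terminology. A sectorial neighbourhood of $(0,0)$ is a connected open $W\subset\mathbb C^2$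 with $\{\xi:(0,\xi)\in W\}=\{0<|\xi|<r,\ |\arg(-\xi)|<\theta\}$ for some $r>0$ and $\theta\in(\pi/2,\pi]$. A major is a holomorphic function on a sectorial neighbourhood; its microfunction is its class modulo functions holomorphic near $(0,0)$ (equality being required near $\{0\}$ times a sufficiently small sector as above). A microfunction is confluent with singular support in $\mathcal C$ if one of its majors extends analytically to the universal covering of $(\mathcal U\times\mathcal V)\setminus\mathcal C$ for some neighbourhood $\mathcal U\times\mathcal V$ of $(0,0)$. It is resurgent if one of its majors is endlessly continuable in $\xi$ for all $z$ near $0$ (for every $L>0$ there is a finite set such that the germ can be continued along all paths of length $<L$ which, after their starting point, avoid this set); it is confluent resurgent if it is resurgent and one of its majors extends to the universal covering of $\mathbb C^2\setminus\mathcal C$. (i) There are open neighbourhoods $U,V$ of $0$ in $\mathbb C$ such that, for every $\theta\in(\pi/2,\pi]$, all the determinations of $\check\Phi$ are defined on some sectorial neighbourhood of half-opening $\theta$ contained in $(U\times V)\setminus\mathcal C$. Every determination of $\check\Phi$ on a sectorial neighbourhood contained in $(U\times V)\setminus\mathcal C$ which is a major solves $$\partial_z^2\check\Phi-z\,\partial_\xi^2\check\Phi=F(z)\check\Phi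 ,$$ and is a major of a confluent microfunction at $(0,0)$ with singular support in $\mathcal C$. More precisely, it extends analytically to the universal covering of $(U\times V)\setminus\mathcal C$, the extension solves the same equation, and its singular support in $U\times V$ is $\mathcal C\cap(U\times V)$ (a point $c$ is outside the singular support if, over some neighbourhood $N$ of $c$, every branch extends holomorphically to all of $N$). (ii) If $F$ and $h$ are entire, then $\Psi$ extends to an entire function on $\mathbb C^2$, and, with this $\Psi$, the statements in (i) hold with $\mathbb C^2$ instead of $U\times V$; moreover each such determination is endlessly continuable in $\xi$ for all $z$ near $0$, and is a major of a confluent resurgent microfunction at $(0,0)$ with singular support in $\mathcal C$. -/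

import Mathlib

open Filter Topology Set

namespace AiryConfluent

noncomputable section

/-! ### The equations -/

/-- The generating function `S(z,ẑ) = z ẑ - ẑ³ / 3`. -/
def S (z w : ℂ) : ℂ := z * w - w ^ 3 / 3

/-- The curve `9 ξ² = 4 z³`. -/
def cuspCurve : Set (ℂ × ℂ) := {p | 9 * p.2 ^ 2 = 4 * p.1 ^ 3}

/-- The equation `∂_z² Φ - z ∂_ξ² Φ = F(z) Φ` at the point `p = (z, ξ)`. -/
def SolvesAt (F : ℂ → ℂ) (Φ : ℂ × ℂ → ℂ) (p : ℂ × ℂ) : Prop :=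
  iteratedDeriv 2 (fun z => Φ (z, p.2)) p.1 - p.1 * iteratedDeriv 2 (fun ξ => Φ (p.1, ξ)) p.2
    = F p.1 * Φ p

/-- The singular equation
`∂_z² Θ - (2ẑ/(z-ẑ²)) ∂_z ∂_ẑ Θ - (1/(z-ẑ²)) ∂_ẑ² Θ = F(z) Θ` at the point `p = (z, ẑ)`. -/
def SolvesSingularAt (F : ℂ → ℂ) (Θ : ℂ × ℂ → ℂ) (p : ℂ × ℂ) : Prop :=
  iteratedDeriv 2 (fun z => Θ (z, p.2)) p.1
    - 2 * p.2 / (p.1 - p.2 ^ 2) * deriv (fun z => deriv (fun w => Θ (z, w)) p.2) p.1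
    - 1 / (p.1 - p.2 ^ 2) * iteratedDeriv 2 (fun w => Θ (p.1, w)) p.2
    = F p.1 * Θ p

/-- `Ψ` is holomorphic near `(0,0)`, satisfies `Ψ = 1` and `-(1/(2ẑ)) ∂Ψ/∂ẑ = h(z)` on the
curve `z = ẑ²` near the origin, and `Ψ / (z - ẑ²)` solves the singular equation near the origin
(outside the curve `z = ẑ²`). -/
structure IsAmplitude (F h : ℂ → ℂ) (Ψ : ℂ × ℂ → ℂ) : Prop where
  analyticAt : AnalyticAt ℂ Ψ 0
  eq_one : ∀ᶠ w in 𝓝 (0 : ℂ), Ψ (w ^ 2, w) = 1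
  deriv_eq : ∀ᶠ w in 𝓝[≠] (0 : ℂ),
    -(1 / (2 * w)) * deriv (fun v => Ψ (w ^ 2, v)) w = h (w ^ 2)
  solves : ∀ᶠ p in 𝓝 (0 : ℂ × ℂ), p.1 ≠ p.2 ^ 2 →
    SolvesSingularAt F (fun q => Ψ q / (q.1 - q.2 ^ 2)) p

/-! ### Sectorial neighbourhoods, majors, microfunctions -/

/-- The sector `0 < |ξ| < r`, `|arg (-ξ)| < θ` around the negative real axis. For `θ = π` it is
the disc of radius `r` slit along the nonnegative real axis. -/
def sector (r θ : ℝ) : Set ℂ := {ξ | 0 < ‖ξ‖ ∧ ‖ξ‖ < r ∧ |(-ξ).arg| < θ}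

/-- A connected open set of `ℂ × ℂ` whose trace on `{0} × ℂ` is a sector of half-opening `θ`. -/
def IsSectorialNhdOfAngle (θ : ℝ) (W : Set (ℂ × ℂ)) : Prop :=
  IsOpen W ∧ IsConnected W ∧ ∃ r > 0, {ξ : ℂ | ((0 : ℂ), ξ) ∈ W} = sector r θ

/-- A sectorial neighbourhood of `(0,0)` (for the direction `0`): the trace on `{0} × ℂ` is a
sector, symmetric about the negative axis, which contains a closed left half-disc (without its
center), so that it meets both `Re ξ > 0, Im ξ > 0` and `Re ξ > 0, Im ξ < 0`. -/
def IsSectorialNhd (W : Set (ℂ × ℂ)) : Prop :=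
  ∃ θ : ℝ, Real.pi / 2 < θ ∧ θ ≤ Real.pi ∧ IsSectorialNhdOfAngle θ W

/-- A major at `(0,0)`: a holomorphic function on a sectorial neighbourhood of `(0,0)`. The values
of `fn` outside `dom` carry no information. -/
structure Major where
  dom : Set (ℂ × ℂ)
  sectorial : IsSectorialNhd dom
  fn : ℂ × ℂ → ℂ
  analytic : AnalyticOnNhd ℂ fn dom

theorem sector_mono {r r' θ θ' : ℝ} (hr : r ≤ r') (hθ : θ ≤ θ') : sector r θ ⊆ sector r' θ' :=
  fun _ h => ⟨h.1, h.2.1.trans_le hr, h.2.2.trans_le hθ⟩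

/-- Two majors are equivalent when their difference is, near `{0} ×` a small sector, a function
holomorphic in a neighbourhood of `(0,0)`. -/
instance majorSetoid : Setoid Major where
  r M M' := ∃ r θ : ℝ, 0 < r ∧ Real.pi / 2 < θ ∧ θ ≤ Real.pi ∧ ∃ k : ℂ × ℂ → ℂ, AnalyticAt ℂ k 0 ∧
    ∀ᶠ p in 𝓝ˢ (({0} : Set ℂ) ×ˢ sector r θ), M.fn p - M'.fn p = k p
  iseqv :=
    { refl := fun M => ⟨1, Real.pi, one_pos, by linarith [Real.pi_pos], le_rfl, fun _ => 0,
        analyticAt_const, Eventually.of_forall fun p => sub_self _⟩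
      symm := by
        rintro M M' ⟨r, θ, hr, hθ, hθ', k, hk, h⟩
        exact ⟨r, θ, hr, hθ, hθ', fun p => -k p, hk.neg, h.mono fun p hp => by
          simp only [← hp, neg_sub]⟩
      trans := by
        rintro M M' M'' ⟨r, θ, hr, hθ, hθ', k, hk, h⟩ ⟨s, η, hs, hη, _, l, hl, h'⟩
        refine ⟨min r s, min θ η, lt_min hr hs, lt_min hθ hη, (min_le_left _ _).trans hθ',
          fun p => k p + l p, hk.add hl, ?_⟩
        have e := nhdsSet_mono (prod_mono_right (s := ({0} : Set ℂ))
          (sector_mono (min_le_left r s) (min_le_left θ η))) h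
        have e' := nhdsSet_mono (prod_mono_right (s := ({0} : Set ℂ))
          (sector_mono (min_le_right r s) (min_le_right θ η))) h'
        filter_upwards [e, e'] with p hp hp'
        rw [← hp, ← hp']
        ring }

/-- Microfunctions at `(0,0)`. -/
def Microfunction : Type := Quotient majorSetoid

/-- The microfunction (singularity) of a major. -/
def Major.microfunction (M : Major) : Microfunction := Quotient.mk majorSetoid M

/-! ### Continuation to the universal covering -/

/-- The universal covering of (the path component of `x₀` in) an open set `D`, in its standard
model: points `y` of `D` with a homotopy class of paths in `D` from `x₀` to `y`. -/
def UniversalCover (D : Set (ℂ × ℂ)) (x₀ : D) : Type :=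
  Σ y : D, Path.Homotopic.Quotient x₀ y

variable {D : Set (ℂ × ℂ)} {x₀ : D}

/-- The function `k` on `ℂ × ℂ` is the germ at `x` of the function `G` on the universal covering,
that is, `k` is holomorphic at the base point of `x` and the two functions agree near `x`. -/
def HasGermAt (G : UniversalCover D x₀ → ℂ) (x : UniversalCover D x₀) (k : ℂ × ℂ → ℂ) : Prop :=
  AnalyticAt ℂ k (x.1 : ℂ × ℂ) ∧ ∃ N ∈ 𝓝 (x.1 : ℂ × ℂ), ∀ (y : D) (δ : Path x.1 y),
    (∀ t, (δ t : ℂ × ℂ) ∈ N) →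
      G ⟨y, x.2.trans (Path.Homotopic.Quotient.mk δ)⟩ = k y

/-- Holomorphic functions on the universal covering. -/
def IsHolomorphic (G : UniversalCover D x₀ → ℂ) : Prop := ∀ x, ∃ k, HasGermAt G x k

/-- A point `c` is regular for `G` if, over some neighbourhood `N` of `c`, every branch of `G`
extends holomorphically to the whole of `N`. -/
def IsRegularAt (G : UniversalCover D x₀ → ℂ) (c : ℂ × ℂ) : Prop :=
  ∃ N ∈ 𝓝 c, ∀ x : UniversalCover D x₀, (x.1 : ℂ × ℂ) ∈ N →
    ∃ k, AnalyticOnNhd ℂ k N ∧ HasGermAt G x k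

/-- The singular support, in the open set `Ω`, of a function on the universal covering of an open
subset of `Ω`. -/
def singularSupport (Ω : Set (ℂ × ℂ)) (G : UniversalCover D x₀ → ℂ) : Set (ℂ × ℂ) :=
  {c ∈ Ω | ¬ IsRegularAt G c}

/-- `G` is the analytic continuation of the major `M` to the universal covering of `D` with base
point `x₀` in the domain of `M`. -/
structure Major.IsContinuation (M : Major) (G : UniversalCover D x₀ → ℂ) : Prop where
  subset : M.dom ⊆ D
  base_mem : (x₀ : ℂ × ℂ) ∈ M.dom
  holomorphic : IsHolomorphic G
  eq_fn : ∀ (y : D) (δ : Path x₀ y), (∀ t, (δ t : ℂ × ℂ) ∈ M.dom) →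
    G ⟨y, Path.Homotopic.Quotient.mk δ⟩ = M.fn y

/-- `M` extends analytically to the universal covering of `D`. -/
def Major.ExtendsTo (M : Major) (D : Set (ℂ × ℂ)) : Prop :=
  ∃ (x₀ : D) (G : UniversalCover D x₀ → ℂ), M.IsContinuation G

/-- A microfunction at `(0,0)` is confluent with singular support in the curve `9 ξ² = 4 z³` if
one of its majors extends to the universal covering of `(U × V)` minus the curve, where `U × V` is
a neighbourhood of `(0,0)`. -/
def Microfunction.IsConfluent (m : Microfunction) : Prop :=
  ∃ M : Major, M.microfunction = m ∧ ∃ U V : Set ℂ, IsOpen U ∧ IsOpen V ∧ 0 ∈ U ∧ 0 ∈ V ∧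
    M.ExtendsTo ((U ×ˢ V) \ cuspCurve)

/-! ### Resurgence -/

/-- The germ of `f` at `γ 0` can be continued analytically along the path `γ`. -/
def ContinuableAlong (f : ℂ → ℂ) (γ : C(unitInterval, ℂ)) : Prop :=
  ∃ k : unitInterval → ℂ → ℂ, (∀ t, AnalyticAt ℂ (k t) (γ t)) ∧ k 0 =ᶠ[𝓝 (γ 0)] f ∧
    ∀ t, ∀ᶠ s in 𝓝 t, k s =ᶠ[𝓝 (γ s)] k t

/-- The germ of `f` at `ξ₀` is endlessly continuable: for every `L > 0` there is a finite set such
that the germ can be continued along every path from `ξ₀`, of length less than `L`, which avoids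
this finite set (except possibly at its starting point). -/
def EndlesslyContinuable (f : ℂ → ℂ) (ξ₀ : ℂ) : Prop :=
  ∀ L : ℝ, 0 < L → ∃ Z : Set ℂ, Z.Finite ∧ ∀ γ : C(unitInterval, ℂ), γ 0 = ξ₀ →
    eVariationOn γ univ < ENNReal.ofReal L → (∀ t, 0 < t → γ t ∉ Z) → ContinuableAlong f γ

/-- A major is resurgent when it is endlessly continuable with respect to `ξ`, for all `z` in a
neighbourhood of `0`. -/
def Major.IsResurgent (M : Major) : Prop :=
  ∀ᶠ z in 𝓝 (0 : ℂ), ∀ ξ₀, (z, ξ₀) ∈ M.dom → EndlesslyContinuable (fun ξ => M.fn (z, ξ)) ξ₀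

/-- A microfunction is resurgent if it has a resurgent major. -/
def Microfunction.IsResurgent (m : Microfunction) : Prop :=
  ∃ M : Major, M.microfunction = m ∧ M.IsResurgent

/-- Confluent resurgent microfunctions with singular support in the curve `9 ξ² = 4 z³`. -/
def Microfunction.IsConfluentResurgent (m : Microfunction) : Prop :=
  m.IsResurgent ∧ ∃ M : Major, M.microfunction = m ∧ M.ExtendsTo (univ \ cuspCurve)

/-! ### The function defined by `Φ(z, S(z,ẑ)) = Ψ(z,ẑ) / (z - ẑ²)` -/

/-- `M` is the determination, on its domain, of the multivalued function `Φ` defined by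
`Φ(z, S(z,ẑ)) = Ψ(z,ẑ) / (z - ẑ²)`, which corresponds to the continuous determination
`ẑ = ζ(z,ξ)` of the inverse of `ξ = S(z,ẑ)`. -/
structure Major.IsDetermination (M : Major) (Ψ : ℂ × ℂ → ℂ) (ζ : ℂ × ℂ → ℂ) : Prop where
  continuousOn : ContinuousOn ζ M.dom
  S_eq : ∀ p ∈ M.dom, S p.1 (ζ p) = p.2
  fn_eq : ∀ p ∈ M.dom, M.fn p = Ψ (p.1, ζ p) / (p.1 - ζ p ^ 2)

/-- Over `Ω`, the multivalued function defined by `Φ(z, S(z,ẑ)) = Ψ(z,ẑ) / (z - ẑ²)` is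
determined on sectorial neighbourhoods of every opening: on some such neighbourhood, outside the
curve, there are majors for all the determinations of `ẑ`. -/
def HasDeterminations (Ψ : ℂ × ℂ → ℂ) (Ω : Set (ℂ × ℂ)) : Prop :=
  ∀ θ : ℝ, Real.pi / 2 < θ → θ ≤ Real.pi →
    ∃ W, IsSectorialNhdOfAngle θ W ∧ W ⊆ Ω \ cuspCurve ∧
      ∀ z w : ℂ, (z, S z w) ∈ W →
        ∃ (M : Major) (ζ : ℂ × ℂ → ℂ), M.dom = W ∧ M.IsDetermination Ψ ζ ∧ ζ (z, S z w) = w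

/-- The major `M` has, from any base point in its domain, a continuation to the universal covering
of `Ω` minus the curve, all of whose germs solve `∂_z² Φ - z ∂_ξ² Φ = F(z) Φ`, and whose singular
support in `Ω` is the curve. -/
def Major.ContinuesAsSolution (M : Major) (F : ℂ → ℂ) (Ω : Set (ℂ × ℂ)) : Prop :=
  ∀ x₀ : (Ω \ cuspCurve : Set (ℂ × ℂ)), (x₀ : ℂ × ℂ) ∈ M.dom →
    ∃ G : UniversalCover (Ω \ cuspCurve) x₀ → ℂ, M.IsContinuation G ∧
      (∀ x k, HasGermAt G x k → SolvesAt F k x.1) ∧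
      singularSupport Ω G = cuspCurve ∩ Ω

end

end AiryConfluent

open AiryConfluent

namespace AiryConfluent

noncomputable section

/-! Write `q = z - ẑ²`. The substitution `ξ = S(z,ẑ)` turns `∂_z² - z ∂_ξ²` into the singular
operator off `q = 0` (`solvesAt_SMap_iff`), and clearing denominators gives an equation for `Ψ` that
is Fuchsian along `q = 0` (`solvesSingularAt_div_iff`).

Existence. Look for `Ψ = g(q, z)`. The equation becomes a recursion in the powers of `q` whose
leading factor `(n+1)(n+2+4m)` never vanishes, while `g(0,z) = 1` and `∂_q g(0,z) = h(z)` are free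
data. The factor is large enough to absorb the derivatives in `z`: weighting by a binomial
coefficient gives geometric bounds (`norm_ampCoeff_le`). The coefficients depend only on the Taylor
coefficients of `F` and `h`, and the radius obtained is proportional to theirs, so entire data give
an entire `Ψ`.

Uniqueness. A competitor need not be even in `ẑ`, so the difference of two amplitudes is expanded in
`(q, ẑ)` instead. There the leading factor is `(k+1)(k+2+2m)`, and the difference vanishes to second
order on `q = 0`, hence identically (`eventuallyEq_zero_of_transport`).

Continuation. `SMap (z,ẑ) = (z, S(z,ẑ))` is proper with finite fibres, and a local biholomorphism
off `q = 0`, so it is a covering over the complement of the cusp curve (`isCoveringMapOn_SMap`). A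
determination is `Ψ/q` composed with a section of this covering; lifting paths continues it to the
universal covering, and the equation is carried along. In the entire case, for fixed `z`, only the
at most two `ξ` with `9ξ² = 4z³` obstruct the lifting, whence endless continuability.

Singular support. The preimage of the complement of the curve is path connected
(`isPathConnected_preimage_SMap`), so every branch reaches the sheet adjacent to any point of `q =
0`. If it extended holomorphically there as `k`, then `k(SMap p) q = Ψ` would hold near that point,
and on `q = 0` this reads `0 = 1` (`IsAmplitudeOn.not_isRegularAt_branch`).

Determinations exist because the chosen sectorial neighbourhoods are images of convex sets, over
which the covering has lifts (`IsAmplitudeOn.hasDeterminations`). -/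

/-! ### Partial derivatives of holomorphic functions of two variables -/

/-- Partial derivative in the first variable. -/
def D1 (f : ℂ × ℂ → ℂ) (p : ℂ × ℂ) : ℂ := deriv (fun t => f (t, p.2)) p.1

/-- Partial derivative in the second variable. -/
def D2 (f : ℂ × ℂ → ℂ) (p : ℂ × ℂ) : ℂ := deriv (fun t => f (p.1, t)) p.2

/-- The chain rule along a curve. All changes of variables below apply it to coordinate lines, so
that only one-variable derivatives have to be computed. -/
theorem hasDerivAt_comp_pair {f : ℂ × ℂ → ℂ} {a b : ℂ → ℂ} {a' b' t : ℂ} {p : ℂ × ℂ}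
    (hf : DifferentiableAt ℂ f p) (hp : p = (a t, b t)) (ha : HasDerivAt a a' t)
    (hb : HasDerivAt b b' t) :
    HasDerivAt (fun t => f (a t, b t)) (a' * D1 f p + b' * D2 f p) t := by
  subst hp
  have h1 : D1 f (a t, b t) = fderiv ℂ f (a t, b t) (1, 0) := by
    have := hf.hasFDerivAt.comp_hasDerivAt_of_eq (a t)
      ((hasDerivAt_id (a t)).prodMk (hasDerivAt_const (a t) (b t))) rfl
    exact this.deriv
  have h2 : D2 f (a t, b t) = fderiv ℂ f (a t, b t) (0, 1) := by
    have := hf.hasFDerivAt.comp_hasDerivAt_of_eq (b t)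
      ((hasDerivAt_const (b t) (a t)).prodMk (hasDerivAt_id (b t))) rfl
    exact this.deriv
  have h := hf.hasFDerivAt.comp_hasDerivAt_of_eq t (ha.prodMk hb) rfl
  convert! h using 1
  have : ((a', b') : ℂ × ℂ) = a' • ((1 : ℂ), (0 : ℂ)) + b' • ((0 : ℂ), (1 : ℂ)) := by simp
  rw [this, map_add, map_smul, map_smul, h1, h2, smul_eq_mul, smul_eq_mul]

theorem hasDerivAt_fst {f : ℂ × ℂ → ℂ} {p : ℂ × ℂ} (hf : DifferentiableAt ℂ f p) :
    HasDerivAt (fun t => f (t, p.2)) (D1 f p) p.1 := by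
  simpa using hasDerivAt_comp_pair hf rfl (hasDerivAt_id' p.1) (hasDerivAt_const p.1 p.2)

theorem hasDerivAt_snd {f : ℂ × ℂ → ℂ} {p : ℂ × ℂ} (hf : DifferentiableAt ℂ f p) :
    HasDerivAt (fun t => f (p.1, t)) (D2 f p) p.2 := by
  simpa using hasDerivAt_comp_pair hf rfl (hasDerivAt_const p.2 p.1) (hasDerivAt_id' p.2)

theorem D1_eq_fderiv {f : ℂ × ℂ → ℂ} {p : ℂ × ℂ} (hf : DifferentiableAt ℂ f p) :
    D1 f p = fderiv ℂ f p (1, 0) :=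
  (hf.hasFDerivAt.comp_hasDerivAt_of_eq p.1
      ((hasDerivAt_id p.1).prodMk (hasDerivAt_const p.1 p.2)) rfl).deriv

theorem D2_eq_fderiv {f : ℂ × ℂ → ℂ} {p : ℂ × ℂ} (hf : DifferentiableAt ℂ f p) :
    D2 f p = fderiv ℂ f p (0, 1) :=
  (hf.hasFDerivAt.comp_hasDerivAt_of_eq p.2
      ((hasDerivAt_const p.2 p.1).prodMk (hasDerivAt_id p.2)) rfl).deriv

theorem D1_eventuallyEq_fderiv {f : ℂ × ℂ → ℂ} {p : ℂ × ℂ} (hf : AnalyticAt ℂ f p) :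
    D1 f =ᶠ[𝓝 p] fun x => fderiv ℂ f x (1, 0) :=
  hf.eventually_analyticAt.mono fun _ hx => D1_eq_fderiv hx.differentiableAt

theorem D2_eventuallyEq_fderiv {f : ℂ × ℂ → ℂ} {p : ℂ × ℂ} (hf : AnalyticAt ℂ f p) :
    D2 f =ᶠ[𝓝 p] fun x => fderiv ℂ f x (0, 1) :=
  hf.eventually_analyticAt.mono fun _ hx => D2_eq_fderiv hx.differentiableAt

theorem AnalyticAt.fderiv_apply {f : ℂ × ℂ → ℂ} {p : ℂ × ℂ} (hf : AnalyticAt ℂ f p) (v : ℂ × ℂ) :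
    AnalyticAt ℂ (fun x => fderiv ℂ f x v) p :=
  ((ContinuousLinearMap.apply ℂ ℂ v).analyticAt _).comp hf.fderiv

theorem analyticAt_D1 {f : ℂ × ℂ → ℂ} {p : ℂ × ℂ} (hf : AnalyticAt ℂ f p) :
    AnalyticAt ℂ (D1 f) p :=
  (AnalyticAt.fderiv_apply hf _).congr (D1_eventuallyEq_fderiv hf).symm

theorem analyticAt_D2 {f : ℂ × ℂ → ℂ} {p : ℂ × ℂ} (hf : AnalyticAt ℂ f p) :
    AnalyticAt ℂ (D2 f) p :=
  (AnalyticAt.fderiv_apply hf _).congr (D2_eventuallyEq_fderiv hf).symm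

theorem eventually_slice_fst {P : ℂ × ℂ → Prop} {p : ℂ × ℂ} (h : ∀ᶠ x in 𝓝 p, P x) :
    ∀ᶠ t in 𝓝 p.1, P (t, p.2) :=
  ((continuous_id.prodMk continuous_const).tendsto' p.1 p rfl).eventually h

theorem eventually_slice_snd {P : ℂ × ℂ → Prop} {p : ℂ × ℂ} (h : ∀ᶠ x in 𝓝 p, P x) :
    ∀ᶠ t in 𝓝 p.2, P (p.1, t) :=
  ((continuous_const.prodMk continuous_id).tendsto' p.2 p rfl).eventually h

theorem D1_congr {f g : ℂ × ℂ → ℂ} {p : ℂ × ℂ} (h : f =ᶠ[𝓝 p] g) : D1 f p = D1 g p :=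
  Filter.EventuallyEq.deriv_eq (eventually_slice_fst h)

theorem D2_congr {f g : ℂ × ℂ → ℂ} {p : ℂ × ℂ} (h : f =ᶠ[𝓝 p] g) : D2 f p = D2 g p :=
  Filter.EventuallyEq.deriv_eq (eventually_slice_snd h)

theorem eventuallyEq_D1 {f g : ℂ × ℂ → ℂ} {p : ℂ × ℂ} (h : f =ᶠ[𝓝 p] g) :
    D1 f =ᶠ[𝓝 p] D1 g :=
  h.eventuallyEq_nhds.mono fun _ => D1_congr

theorem eventuallyEq_D2 {f g : ℂ × ℂ → ℂ} {p : ℂ × ℂ} (h : f =ᶠ[𝓝 p] g) :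
    D2 f =ᶠ[𝓝 p] D2 g :=
  h.eventuallyEq_nhds.mono fun _ => D2_congr

theorem D2_D1_eq {f : ℂ × ℂ → ℂ} {p : ℂ × ℂ} (hf : AnalyticAt ℂ f p) :
    D2 (D1 f) p = D1 (D2 f) p := by
  have h2 : ∀ v, DifferentiableAt ℂ (fun x => fderiv ℂ f x v) p := fun v =>
    (AnalyticAt.fderiv_apply hf v).differentiableAt
  have hs : IsSymmSndFDerivAt ℂ f p := (hf.contDiffAt (n := ⊤)).isSymmSndFDerivAt (by simp)
  have hv : ∀ u v : ℂ × ℂ, fderiv ℂ (fun x => fderiv ℂ f x v) p u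
      = fderiv ℂ (fderiv ℂ f) p u v := fun u v => by
    rw [fderiv_clm_apply hf.fderiv.differentiableAt (differentiableAt_const v)]
    simp
  rw [D2_congr (D1_eventuallyEq_fderiv hf), D1_congr (D2_eventuallyEq_fderiv hf),
    D2_eq_fderiv (h2 _), D1_eq_fderiv (h2 _), hv, hv]
  exact hs _ _

theorem solvesAt_iff (F : ℂ → ℂ) (Φ : ℂ × ℂ → ℂ) (p : ℂ × ℂ) :
    SolvesAt F Φ p ↔ D1 (D1 Φ) p - p.1 * D2 (D2 Φ) p = F p.1 * Φ p := by
  simp only [SolvesAt, iteratedDeriv_succ, iteratedDeriv_zero]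
  rfl

theorem solvesSingularAt_iff (F : ℂ → ℂ) (Θ : ℂ × ℂ → ℂ) (p : ℂ × ℂ) :
    SolvesSingularAt F Θ p ↔ D1 (D1 Θ) p - 2 * p.2 / (p.1 - p.2 ^ 2) * D1 (D2 Θ) p
      - 1 / (p.1 - p.2 ^ 2) * D2 (D2 Θ) p = F p.1 * Θ p := by
  simp only [SolvesSingularAt, iteratedDeriv_succ, iteratedDeriv_zero]
  rfl

theorem SolvesAt.congr {F : ℂ → ℂ} {Φ Φ' : ℂ × ℂ → ℂ} {p : ℂ × ℂ} (h : SolvesAt F Φ p)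
    (e : Φ =ᶠ[𝓝 p] Φ') : SolvesAt F Φ' p := by
  rw [solvesAt_iff] at h ⊢
  rwa [← D1_congr (eventuallyEq_D1 e), ← D2_congr (eventuallyEq_D2 e), ← e.eq_of_nhds]

/-! ### The change of variables `ξ = S(z,ẑ)` and the equation for `Ψ` -/

/-- The map `(z, ẑ) ↦ (z, S(z, ẑ))`. -/
def SMap (p : ℂ × ℂ) : ℂ × ℂ := (p.1, S p.1 p.2)

theorem analyticAt_SMap (p : ℂ × ℂ) : AnalyticAt ℂ SMap p :=
  analyticAt_fst.prod ((analyticAt_fst.mul analyticAt_snd).sub ((analyticAt_snd.pow 3).div_const))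

theorem continuous_SMap : Continuous SMap := by
  unfold SMap S
  fun_prop

theorem hasDerivAt_S_fst (z w : ℂ) : HasDerivAt (fun t => S t w) w z := by
  simpa [S] using ((hasDerivAt_id z).mul_const w).sub_const (w ^ 3 / 3)

theorem hasDerivAt_S_snd (z w : ℂ) : HasDerivAt (fun t => S z t) (z - w ^ 2) w := by
  have := ((hasDerivAt_id w).const_mul z).sub (((hasDerivAt_id w).pow 3).div_const 3)
  convert! this using 1
  simp

theorem D1_comp_SMap {f : ℂ × ℂ → ℂ} {p : ℂ × ℂ} (hf : DifferentiableAt ℂ f (SMap p)) :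
    D1 (fun x => f (SMap x)) p = D1 f (SMap p) + p.2 * D2 f (SMap p) :=
  (hasDerivAt_comp_pair hf rfl (hasDerivAt_id' p.1)
    (hasDerivAt_S_fst p.1 p.2)).deriv.trans (by rw [one_mul])

theorem D2_comp_SMap {f : ℂ × ℂ → ℂ} {p : ℂ × ℂ} (hf : DifferentiableAt ℂ f (SMap p)) :
    D2 (fun x => f (SMap x)) p = (p.1 - p.2 ^ 2) * D2 f (SMap p) :=
  (hasDerivAt_comp_pair hf rfl (hasDerivAt_const p.2 p.1)
    (hasDerivAt_S_snd p.1 p.2)).deriv.trans (by rw [zero_mul, zero_add])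

theorem hasDerivAt_quad (z w : ℂ) : HasDerivAt (fun t => z - t ^ 2) (-(2 * w)) w := by
  simpa using ((hasDerivAt_id w).pow 2).const_sub z

/-- From `∂_z Θ = Φ_z + ẑ Φ_ξ` and `∂_ẑ Θ = (z - ẑ²) Φ_ξ`, the terms in `Φ_ξ` and `Φ_zξ` cancel in
the singular operator, and the coefficient of `Φ_ξξ` is `ẑ² - 2ẑ² - (z - ẑ²) = -z`. -/
theorem solvesAt_SMap_iff {F : ℂ → ℂ} {Φ Θ : ℂ × ℂ → ℂ} {p : ℂ × ℂ}
    (hΦ : AnalyticAt ℂ Φ (SMap p)) (hp : p.1 ≠ p.2 ^ 2) (e : Θ =ᶠ[𝓝 p] fun x => Φ (SMap x)) :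
    SolvesAt F Φ (SMap p) ↔ SolvesSingularAt F Θ p := by
  have hev : ∀ᶠ x in 𝓝 p, AnalyticAt ℂ Φ (SMap x) :=
    (continuous_SMap.tendsto p).eventually hΦ.eventually_analyticAt
  have hq : p.1 - p.2 ^ 2 ≠ 0 := sub_ne_zero.2 hp
  have e1 : D1 Θ =ᶠ[𝓝 p] fun x => D1 Φ (SMap x) + x.2 * D2 Φ (SMap x) :=
    (eventuallyEq_D1 e).trans (hev.mono fun x hx => D1_comp_SMap hx.differentiableAt)
  have e2 : D2 Θ =ᶠ[𝓝 p] fun x => (x.1 - x.2 ^ 2) * D2 Φ (SMap x) :=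
    (eventuallyEq_D2 e).trans (hev.mono fun x hx => D2_comp_SMap hx.differentiableAt)
  have dA := (analyticAt_D1 hΦ).differentiableAt
  have dB := (analyticAt_D2 hΦ).differentiableAt
  have dA1 := hasDerivAt_comp_pair dA rfl (hasDerivAt_id' p.1) (hasDerivAt_S_fst p.1 p.2)
  have dB1 := hasDerivAt_comp_pair dB rfl (hasDerivAt_id' p.1) (hasDerivAt_S_fst p.1 p.2)
  have dB2 := hasDerivAt_comp_pair dB rfl (hasDerivAt_const p.2 p.1) (hasDerivAt_S_snd p.1 p.2)
  have e11 : D1 (D1 Θ) p = (D1 (D1 Φ) (SMap p) + p.2 * D2 (D1 Φ) (SMap p))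
      + p.2 * (D1 (D2 Φ) (SMap p) + p.2 * D2 (D2 Φ) (SMap p)) := by
    rw [D1_congr e1]
    have := (dA1.add (dB1.const_mul p.2)).deriv
    simp only [one_mul] at this
    exact this
  have e12 : D1 (D2 Θ) p = D2 Φ (SMap p) + (p.1 - p.2 ^ 2)
      * (D1 (D2 Φ) (SMap p) + p.2 * D2 (D2 Φ) (SMap p)) := by
    rw [D1_congr e2]
    have := (((hasDerivAt_id' p.1).sub_const (p.2 ^ 2)).mul dB1).deriv
    simp only [one_mul] at this
    exact this
  have e22 : D2 (D2 Θ) p = -(2 * p.2) * D2 Φ (SMap p) + (p.1 - p.2 ^ 2)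
      * ((p.1 - p.2 ^ 2) * D2 (D2 Φ) (SMap p)) := by
    rw [D2_congr e2]
    have := ((hasDerivAt_quad p.1 p.2).mul dB2).deriv
    simp only [zero_mul, zero_add] at this
    exact this
  rw [solvesAt_iff, solvesSingularAt_iff, e11, e12, e22, e.eq_of_nhds, D2_D1_eq hΦ]
  have h1 : (SMap p).1 = p.1 := rfl
  rw [h1]
  refine Eq.congr ?_ rfl
  field_simp
  ring

/-- The equation satisfied by `Ψ` when `Ψ / (z - ẑ²)` solves the singular equation. -/
def SolvesRegularAt (F : ℂ → ℂ) (Ψ : ℂ × ℂ → ℂ) (p : ℂ × ℂ) : Prop :=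
  (p.1 - p.2 ^ 2) ^ 2 * D1 (D1 Ψ) p - 2 * p.2 * (p.1 - p.2 ^ 2) * D1 (D2 Ψ) p
    - (p.1 - p.2 ^ 2) * D2 (D2 Ψ) p - 2 * (p.1 + p.2 ^ 2) * D1 Ψ p - 2 * p.2 * D2 Ψ p
    = (p.1 - p.2 ^ 2) ^ 2 * F p.1 * Ψ p

/-- Substitute `Ψ = (z - ẑ²) Θ`. The singular equation multiplied by `(z - ẑ²)³` is the regular one,
in which `Ψ` enters undifferentiated only through `F`. -/
theorem solvesSingularAt_div_iff {F : ℂ → ℂ} {Ψ : ℂ × ℂ → ℂ} {p : ℂ × ℂ}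
    (hΨ : AnalyticAt ℂ Ψ p) (hp : p.1 ≠ p.2 ^ 2) :
    SolvesSingularAt F (fun x => Ψ x / (x.1 - x.2 ^ 2)) p ↔ SolvesRegularAt F Ψ p := by
  have hq : p.1 - p.2 ^ 2 ≠ 0 := sub_ne_zero.2 hp
  set Θ : ℂ × ℂ → ℂ := fun x => Ψ x / (x.1 - x.2 ^ 2) with hΘdef
  have hΘ : AnalyticAt ℂ Θ p := hΨ.div (analyticAt_fst.sub (analyticAt_snd.pow 2)) hq
  have hne : ∀ᶠ x : ℂ × ℂ in 𝓝 p, x.1 - x.2 ^ 2 ≠ 0 :=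
    ContinuousAt.eventually_ne (by fun_prop) hq
  have e : Ψ =ᶠ[𝓝 p] fun x => (x.1 - x.2 ^ 2) * Θ x :=
    hne.mono fun x hx => (mul_div_cancel₀ _ hx).symm
  have hev := hΘ.eventually_analyticAt
  have k1 : ∀ z w : ℂ, HasDerivAt (fun t => t - w ^ 2) 1 z := fun z w =>
    (hasDerivAt_id' z).sub_const _
  have e1 : D1 Ψ =ᶠ[𝓝 p] fun x => Θ x + (x.1 - x.2 ^ 2) * D1 Θ x := by
    refine (eventuallyEq_D1 e).trans (hev.mono fun x hx => ?_)
    exact ((k1 x.1 x.2).mul (hasDerivAt_fst hx.differentiableAt)).deriv.trans (by rw [one_mul])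
  have e2 : D2 Ψ =ᶠ[𝓝 p] fun x => -(2 * x.2) * Θ x + (x.1 - x.2 ^ 2) * D2 Θ x := by
    refine (eventuallyEq_D2 e).trans (hev.mono fun x hx => ?_)
    exact ((hasDerivAt_quad x.1 x.2).mul (hasDerivAt_snd hx.differentiableAt)).deriv
  have d1 := hasDerivAt_fst hΘ.differentiableAt
  have d2 := hasDerivAt_snd hΘ.differentiableAt
  have d11 := hasDerivAt_fst (analyticAt_D1 hΘ).differentiableAt
  have d12 := hasDerivAt_fst (analyticAt_D2 hΘ).differentiableAt
  have d22 := hasDerivAt_snd (analyticAt_D2 hΘ).differentiableAt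
  have e11 : D1 (D1 Ψ) p = 2 * D1 Θ p + (p.1 - p.2 ^ 2) * D1 (D1 Θ) p := by
    rw [D1_congr e1]
    refine (d1.add ((k1 p.1 p.2).mul d11)).deriv.trans ?_
    ring
  have e12 : D1 (D2 Ψ) p = -(2 * p.2) * D1 Θ p + (D2 Θ p + (p.1 - p.2 ^ 2) * D1 (D2 Θ) p) := by
    rw [D1_congr e2]
    refine ((d1.const_mul (-(2 * p.2))).add ((k1 p.1 p.2).mul d12)).deriv.trans ?_
    ring
  have e22 : D2 (D2 Ψ) p = -2 * Θ p - 4 * p.2 * D2 Θ p + (p.1 - p.2 ^ 2) * D2 (D2 Θ) p := by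
    rw [D2_congr e2]
    refine (((((hasDerivAt_id' p.2).const_mul 2).neg).mul d2).add
      ((hasDerivAt_quad p.1 p.2).mul d22)).deriv.trans ?_
    simp only [Pi.neg_apply]
    ring
  rw [solvesSingularAt_iff, SolvesRegularAt, e11, e12, e22, e1.eq_of_nhds, e2.eq_of_nhds,
    e.eq_of_nhds]
  rw [← mul_right_inj' (pow_ne_zero 3 hq)]
  refine Eq.congr ?_ ?_
  · field_simp
    ring
  · ring

/-! ### `SMap` as a covering off the cusp curve -/

theorem SMap_mem_cuspCurve_iff {p : ℂ × ℂ} :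
    SMap p ∈ cuspCurve ↔ p.1 = p.2 ^ 2 ∨ 4 * p.1 = p.2 ^ 2 := by
  -- Over a point of the curve, the double root of `S(z,·) = ξ` lies on `z = ẑ²` and the remaining
  -- root on `4z = ẑ²`.
  have key : 9 * (S p.1 p.2) ^ 2 - 4 * p.1 ^ 3
      = (p.1 - p.2 ^ 2) ^ 2 * -(4 * p.1 - p.2 ^ 2) := by
    unfold S
    ring
  change 9 * (S p.1 p.2) ^ 2 = 4 * p.1 ^ 3 ↔ _
  rw [← sub_eq_zero, key, mul_eq_zero, pow_eq_zero_iff two_ne_zero, neg_eq_zero, sub_eq_zero,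
    sub_eq_zero]

theorem ne_sq_of_SMap_notMem {p : ℂ × ℂ} (h : SMap p ∉ cuspCurve) : p.1 ≠ p.2 ^ 2 :=
  fun e => h (SMap_mem_cuspCurve_iff.2 (Or.inl e))

theorem isClosed_cuspCurve : IsClosed cuspCurve :=
  isClosed_eq (by fun_prop) (by fun_prop)

/-- The derivative of `SMap`, as an equivalence. -/
def SMapDeriv (p : ℂ × ℂ) (hp : p.1 ≠ p.2 ^ 2) : (ℂ × ℂ) ≃L[ℂ] ℂ × ℂ :=
  ContinuousLinearEquiv.equivOfInverse
    ((ContinuousLinearMap.fst ℂ ℂ ℂ).prod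
      (p.2 • ContinuousLinearMap.fst ℂ ℂ ℂ + (p.1 - p.2 ^ 2) • ContinuousLinearMap.snd ℂ ℂ ℂ))
    ((ContinuousLinearMap.fst ℂ ℂ ℂ).prod
      ((p.1 - p.2 ^ 2)⁻¹ • (ContinuousLinearMap.snd ℂ ℂ ℂ - p.2 • ContinuousLinearMap.fst ℂ ℂ ℂ)))
    (fun x => by
      have hq : p.1 - p.2 ^ 2 ≠ 0 := sub_ne_zero.2 hp
      ext <;> simp [hq])
    (fun x => by
      have hq : p.1 - p.2 ^ 2 ≠ 0 := sub_ne_zero.2 hp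
      ext <;> simp [hq])

theorem hasFDerivAt_SMap (p : ℂ × ℂ) (hp : p.1 ≠ p.2 ^ 2) :
    HasFDerivAt SMap (SMapDeriv p hp : (ℂ × ℂ) →L[ℂ] ℂ × ℂ) p := by
  have h1 : HasFDerivAt (fun x : ℂ × ℂ => x.1) (ContinuousLinearMap.fst ℂ ℂ ℂ) p := hasFDerivAt_fst
  have h2 : HasFDerivAt (fun x : ℂ × ℂ => x.2) (ContinuousLinearMap.snd ℂ ℂ ℂ) p := hasFDerivAt_snd
  refine (h1.prodMk ((h1.mul h2).sub ((h2.pow 3).mul_const (3⁻¹ : ℂ)))).congr_fderiv ?_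
  refine ContinuousLinearMap.ext fun x => Prod.ext ?_ ?_
  · simp [SMapDeriv]
  · simp [SMapDeriv]
    ring

theorem exists_openPartialHomeomorph_SMap (p : ℂ × ℂ) (hp : p.1 ≠ p.2 ^ 2) :
    ∃ φ : OpenPartialHomeomorph (ℂ × ℂ) (ℂ × ℂ), p ∈ φ.source ∧ ⇑φ = SMap ∧
      AnalyticAt ℂ φ.symm (SMap p) := by
  have hs : HasStrictFDerivAt SMap (SMapDeriv p hp : (ℂ × ℂ) →L[ℂ] ℂ × ℂ) p := by
    have := (analyticAt_SMap p).hasStrictFDerivAt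
    rwa [(hasFDerivAt_SMap p hp).fderiv] at this
  refine ⟨hs.toOpenPartialHomeomorph SMap, hs.mem_toOpenPartialHomeomorph_source, rfl, ?_⟩
  exact OpenPartialHomeomorph.analyticAt_symm' _ hs.mem_toOpenPartialHomeomorph_source
    (analyticAt_SMap p) (hasFDerivAt_SMap p hp).fderiv

/-- Two sections of `SMap` which are continuous at `y` and agree at `y` agree near `y`. -/
theorem eventuallyEq_of_section {X : Type*} [TopologicalSpace X] {y : X} {g g' : X → ℂ × ℂ}
    (hg : ContinuousAt g y) (hg' : ContinuousAt g' y) (hp : (g y).1 ≠ (g y).2 ^ 2)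
    (h : ∀ᶠ x in 𝓝 y, SMap (g x) = SMap (g' x)) (e : g y = g' y) : g =ᶠ[𝓝 y] g' := by
  obtain ⟨φ, hφ, hφS, -⟩ := exists_openPartialHomeomorph_SMap _ hp
  filter_upwards [h, hg.eventually (φ.open_source.mem_nhds hφ),
    hg'.eventually (φ.open_source.mem_nhds (e ▸ hφ))] with x h1 h2 h3
  exact φ.injOn h2 h3 (by rwa [hφS])

/-- Continuous sections of `SMap` are holomorphic. -/
theorem analyticAt_of_section {y : ℂ × ℂ} {g : ℂ × ℂ → ℂ × ℂ} (hg : ContinuousAt g y)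
    (hp : (g y).1 ≠ (g y).2 ^ 2) (h : ∀ᶠ x in 𝓝 y, SMap (g x) = x) : AnalyticAt ℂ g y := by
  obtain ⟨φ, hφ, hφS, ha⟩ := exists_openPartialHomeomorph_SMap _ hp
  rw [h.self_of_nhds] at ha
  refine ha.congr ?_
  filter_upwards [h, hg.eventually (φ.open_source.mem_nhds hφ)] with x h1 h2
  rw [← h1, ← hφS, φ.left_inv h2, hφS, h1]

/-- `ẑ` is a root of the monic cubic `ẑ³ - 3zẑ + 3ξ`, hence bounded in terms of its coefficients.
This is what makes `SMap` proper. -/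
theorem norm_le_of_SMap {z w : ℂ} {R : ℝ} (hR : 0 ≤ R) (hz : ‖z‖ ≤ R) (hξ : ‖S z w‖ ≤ R) :
    ‖w‖ ≤ 6 * R + 1 := by
  by_contra! hw
  have h1 : w ^ 3 = 3 * z * w - 3 * S z w := by
    unfold S
    ring
  have h2 : ‖w‖ ^ 3 ≤ 3 * R * ‖w‖ + 3 * R := by
    rw [← norm_pow, h1]
    refine (norm_sub_le _ _).trans ?_
    simp only [norm_mul, Complex.norm_ofNat]
    gcongr
  have h3 : 1 < ‖w‖ := by linarith
  nlinarith [mul_pos (sub_pos.2 h3) (sub_pos.2 h3), mul_nonneg hR (sub_pos.2 h3).le,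
    mul_pos (by linarith : (0 : ℝ) < ‖w‖) (by linarith : (0 : ℝ) < ‖w‖),
    mul_nonneg (mul_nonneg hR (by linarith : (0 : ℝ) ≤ ‖w‖)) (sub_pos.2 h3).le,
    mul_pos (mul_pos (by linarith : (0 : ℝ) < ‖w‖) (by linarith : (0 : ℝ) < ‖w‖)) (sub_pos.2 hw)]

theorem isClosedMap_SMap : IsClosedMap SMap := by
  refine IsProperMap.isClosedMap (isProperMap_iff_isCompact_preimage.2
    ⟨continuous_SMap, fun K hK => ?_⟩)
  refine Metric.isCompact_of_isClosed_isBounded (hK.isClosed.preimage continuous_SMap) ?_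
  obtain ⟨R, hR⟩ := hK.isBounded.subset_closedBall 0
  refine (Metric.isBounded_closedBall (x := (0 : ℂ × ℂ)) (r := 6 * max R 0 + 1)).subset
    fun p hp => ?_
  have h := hR hp
  rw [mem_closedBall_zero_iff, Prod.norm_def, max_le_iff] at h ⊢
  have hm : (0 : ℝ) ≤ max R 0 := le_max_right _ _
  have h1 : ‖p.1‖ ≤ max R 0 := h.1.trans (le_max_left _ _)
  exact ⟨by linarith, norm_le_of_SMap hm h1 (h.2.trans (le_max_left _ _))⟩

theorem finite_fiber_SMap (y : ℂ × ℂ) : (SMap ⁻¹' {y}).Finite := by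
  let P : Polynomial ℂ := Polynomial.X ^ 3 + (Polynomial.C (-3 * y.1) * Polynomial.X
    + Polynomial.C (3 * y.2))
  have hP : P.Monic := by
    refine Polynomial.monic_X_pow_add ?_
    refine (Polynomial.degree_linear_le).trans_lt ?_
    norm_num
  refine ((P.rootSet_finite ℂ).image fun w => (y.1, w)).subset fun p hp => ?_
  have hp' : SMap p = y := hp
  have h1 : p.1 = y.1 := (congr_arg Prod.fst hp' : (SMap p).1 = y.1)
  have h2 : S p.1 p.2 = y.2 := (congr_arg Prod.snd hp' : (SMap p).2 = y.2)
  refine ⟨p.2, ?_, Prod.ext h1.symm rfl⟩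
  rw [Polynomial.mem_rootSet]
  refine ⟨hP.ne_zero, ?_⟩
  simp only [P, ← h1, ← h2, S, map_add, map_mul, map_pow, Polynomial.aeval_X, Polynomial.aeval_C]
  simp only [Algebra.algebraMap_self, RingHom.id_apply]
  ring

/-- A closed map with finite fibres which is a local homeomorphism over an open set is a covering
there. The ramification locus `z = ẑ²` lies over the cusp curve. -/
theorem isCoveringMapOn_SMap : IsCoveringMapOn SMap cuspCurveᶜ := by
  refine isClosedMap_SMap.isCoveringMapOn_of_isLocalHomeomorphOn
    (fun x _ => finite_fiber_SMap x) fun p hp => ?_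
  obtain ⟨φ, hφ, hφS, -⟩ := exists_openPartialHomeomorph_SMap p (ne_sq_of_SMap_notMem hp)
  exact ⟨φ, hφ, hφS.symm⟩

/-! ### Calculus of double power series -/

/-- The double power series with coefficients `a`. -/
def DS (a : ℕ → ℕ → ℂ) (p : ℂ × ℂ) : ℂ := ∑' n : ℕ × ℕ, a n.1 n.2 * p.1 ^ n.1 * p.2 ^ n.2

/-- The coefficients `a` are `O(r ^ -(n + m))`. -/
def GeomBound (a : ℕ → ℕ → ℂ) (r : ℝ) : Prop := ∃ C, ∀ n m, ‖a n m‖ * r ^ (n + m) ≤ C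

/-- Differentiation and convolution cost a factor linear in the index. Shrinking the radius from `r`
to `s < r` absorbs it, with `t = s / r`. -/
theorem exists_bound_mul_pow {t : ℝ} (h0 : 0 ≤ t) (h1 : t < 1) :
    ∃ C, ∀ n : ℕ, ((n : ℝ) + 1) * t ^ n ≤ C := by
  obtain ⟨C, hC⟩ := (tendsto_self_mul_const_pow_of_lt_one h0 h1).bddAbove_range
  refine ⟨C + 1, fun n => ?_⟩
  have := hC (mem_range_self n)
  have h2 : t ^ n ≤ 1 := pow_le_one₀ h0 h1.le
  linarith

theorem GeomBound.exists_nonneg {a : ℕ → ℕ → ℂ} {r : ℝ} (h : GeomBound a r) (hr : 0 < r) :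
    ∃ C, 0 ≤ C ∧ ∀ n m, ‖a n m‖ ≤ C * (r⁻¹) ^ (n + m) := by
  obtain ⟨C, hC⟩ := h
  refine ⟨C, (by positivity : 0 ≤ ‖a 0 0‖ * r ^ (0 + 0)).trans (hC 0 0), fun n m => ?_⟩
  rw [inv_pow, ← div_eq_mul_inv, le_div_iff₀ (by positivity)]
  exact hC n m

theorem GeomBound.of_le {a : ℕ → ℕ → ℂ} {r C : ℝ} (hr : 0 < r)
    (h : ∀ n m, ‖a n m‖ ≤ C * (r⁻¹) ^ (n + m)) : GeomBound a r :=
  ⟨C, fun n m => by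
    have := h n m
    rwa [inv_pow, ← div_eq_mul_inv, le_div_iff₀ (by positivity)] at this⟩

theorem GeomBound.mono {a : ℕ → ℕ → ℂ} {r s : ℝ} (h : GeomBound a r) (hs : 0 ≤ s) (hsr : s ≤ r) :
    GeomBound a s := by
  obtain ⟨C, hC⟩ := h
  exact ⟨C, fun n m => le_trans (by gcongr) (hC n m)⟩

theorem GeomBound.add {a b : ℕ → ℕ → ℂ} {r : ℝ} (hr : 0 ≤ r) (ha : GeomBound a r)
    (hb : GeomBound b r) : GeomBound (a + b) r := by
  obtain ⟨C, hC⟩ := ha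
  obtain ⟨C', hC'⟩ := hb
  refine ⟨C + C', fun n m => ?_⟩
  have := mul_le_mul_of_nonneg_right (norm_add_le (a n m) (b n m)) (pow_nonneg hr (n + m))
  rw [add_mul] at this
  exact this.trans (add_le_add (hC n m) (hC' n m))

theorem GeomBound.smul {a : ℕ → ℕ → ℂ} {r : ℝ} (c : ℂ) (ha : GeomBound a r) :
    GeomBound (c • a) r := by
  obtain ⟨C, hC⟩ := ha
  refine ⟨‖c‖ * C, fun n m => ?_⟩
  simp only [Pi.smul_apply, smul_eq_mul, norm_mul, mul_assoc]
  exact mul_le_mul_of_nonneg_left (hC n m) (norm_nonneg _)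

/-- Coefficients of the derivative in the first variable. -/
def E1 (a : ℕ → ℕ → ℂ) (n m : ℕ) : ℂ := (n + 1) * a (n + 1) m

/-- Coefficients of the derivative in the second variable. -/
def E2 (a : ℕ → ℕ → ℂ) (n m : ℕ) : ℂ := (m + 1) * a n (m + 1)

/-- Coefficients of the product with the first variable. -/
def X1 (a : ℕ → ℕ → ℂ) : ℕ → ℕ → ℂ
  | 0, _ => 0
  | n + 1, m => a n m

/-- Coefficients of the product with the second variable. -/
def X2 (a : ℕ → ℕ → ℂ) : ℕ → ℕ → ℂ
  | _, 0 => 0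
  | n, m + 1 => a n m

/-- Coefficients of the product with a power series in the second variable. -/
def conv (f : ℕ → ℂ) (a : ℕ → ℕ → ℂ) (n m : ℕ) : ℂ :=
  ∑ ij ∈ Finset.HasAntidiagonal.antidiagonal m, f ij.1 * a n ij.2

theorem GeomBound.swap {a : ℕ → ℕ → ℂ} {r : ℝ} (h : GeomBound a r) :
    GeomBound (fun n m => a m n) r := by
  obtain ⟨C, hC⟩ := h
  exact ⟨C, fun n m => by rw [add_comm]; exact hC m n⟩

theorem GeomBound.E1 {a : ℕ → ℕ → ℂ} {r s : ℝ} (h : GeomBound a r) (hs : 0 ≤ s) (hsr : s < r) :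
    GeomBound (E1 a) s := by
  have hr : 0 < r := hs.trans_lt hsr
  obtain ⟨C, hC0, hC⟩ := h.exists_nonneg hr
  have ht0 : 0 ≤ s / r := by positivity
  have ht1 : s / r < 1 := (div_lt_one hr).2 hsr
  obtain ⟨B, hB⟩ := exists_bound_mul_pow ht0 ht1
  have hn1 : ∀ n : ℕ, ‖((n : ℂ) + 1)‖ = n + 1 := fun n => by
    rw [← Nat.cast_succ, Complex.norm_natCast, Nat.cast_succ]
  refine ⟨C * r⁻¹ * B, fun n m => ?_⟩
  calc ‖AiryConfluent.E1 a n m‖ * s ^ (n + m)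
      ≤ ((n + 1) * (C * r⁻¹ ^ (n + 1 + m))) * s ^ (n + m) := by
        unfold AiryConfluent.E1
        rw [norm_mul, hn1]
        gcongr
        exact hC _ _
    _ = C * r⁻¹ * ((n + 1) * (s / r) ^ n) * (s / r) ^ m := by
        rw [div_eq_mul_inv]
        ring
    _ ≤ C * r⁻¹ * B * 1 := by
        have hB0 : 0 ≤ B := le_trans (by positivity) (hB 0)
        gcongr
        · exact hB n
        · exact pow_le_one₀ ht0 ht1.le
    _ = C * r⁻¹ * B := mul_one _

theorem GeomBound.E2 {a : ℕ → ℕ → ℂ} {r s : ℝ} (h : GeomBound a r) (hs : 0 ≤ s) (hsr : s < r) :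
    GeomBound (E2 a) s :=
  (h.swap.E1 hs hsr).swap

theorem GeomBound.X1 {a : ℕ → ℕ → ℂ} {r : ℝ} (h : GeomBound a r) (hr : 0 < r) :
    GeomBound (X1 a) r := by
  obtain ⟨C, hC0, hC⟩ := h.exists_nonneg hr
  refine ⟨C * r, fun n m => ?_⟩
  obtain ⟨C', hC'⟩ := h
  cases n with
  | zero => simp only [AiryConfluent.X1, norm_zero, zero_mul]; positivity
  | succ n =>
    simp only [AiryConfluent.X1]
    calc ‖a n m‖ * r ^ (n + 1 + m) ≤ (C * r⁻¹ ^ (n + m)) * r ^ (n + 1 + m) := by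
          gcongr
          exact hC n m
      _ = C * r * (r⁻¹ * r) ^ (n + m) := by ring
      _ = C * r := by rw [inv_mul_cancel₀ hr.ne', one_pow, mul_one]

theorem X2_eq_swap (a : ℕ → ℕ → ℂ) : X2 a = fun n m => X1 (fun n m => a m n) m n := by
  funext n m
  cases m <;> rfl

theorem GeomBound.X2 {a : ℕ → ℕ → ℂ} {r : ℝ} (h : GeomBound a r) (hr : 0 < r) :
    GeomBound (X2 a) r := by
  rw [X2_eq_swap]
  exact (h.swap.X1 hr).swap

theorem GeomBound.conv {f : ℕ → ℂ} {a : ℕ → ℕ → ℂ} {r s C : ℝ} (h : GeomBound a r)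
    (hf : ∀ i, ‖f i‖ * r ^ i ≤ C) (hs : 0 ≤ s) (hsr : s < r) : GeomBound (conv f a) s := by
  have hr : 0 < r := hs.trans_lt hsr
  obtain ⟨A, hA⟩ := h
  have ht0 : 0 ≤ s / r := by positivity
  have ht1 : s / r < 1 := (div_lt_one hr).2 hsr
  have hA0 : 0 ≤ A := le_trans (by positivity) (hA 0 0)
  have hC0 : 0 ≤ C := le_trans (by positivity) (hf 0)
  obtain ⟨B, hB⟩ := exists_bound_mul_pow ht0 ht1
  have key : ∀ n m, ‖AiryConfluent.conv f a n m‖ * r ^ (n + m) ≤ (m + 1) * (C * A) := by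
    intro n m
    calc ‖AiryConfluent.conv f a n m‖ * r ^ (n + m)
        ≤ (∑ ij ∈ Finset.HasAntidiagonal.antidiagonal m, ‖f ij.1 * a n ij.2‖) * r ^ (n + m) := by
          gcongr
          exact norm_sum_le _ _
      _ = ∑ ij ∈ Finset.HasAntidiagonal.antidiagonal m, (‖f ij.1‖ * r ^ ij.1) * (‖a n ij.2‖ * r ^ (n + ij.2)) := by
          rw [Finset.sum_mul]
          refine Finset.sum_congr rfl fun ij hij => ?_
          rw [← Finset.HasAntidiagonal.mem_antidiagonal.1 hij, norm_mul]
          ring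
      _ ≤ ∑ ij ∈ Finset.HasAntidiagonal.antidiagonal m, C * A := by
          refine Finset.sum_le_sum fun ij _ => ?_
          exact mul_le_mul (hf _) (hA _ _) (by positivity) hC0
      _ = (m + 1) * (C * A) := by simp
  refine ⟨B * (C * A), fun n m => ?_⟩
  calc ‖AiryConfluent.conv f a n m‖ * s ^ (n + m)
      = (‖AiryConfluent.conv f a n m‖ * r ^ (n + m)) * ((s / r) ^ m * (s / r) ^ n) := by
        rw [← pow_add, div_pow, add_comm m n]
        field_simp
    _ ≤ ((m + 1) * (C * A)) * ((s / r) ^ m * 1) := by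
        refine mul_le_mul (key n m) ?_ (by positivity) (by positivity)
        gcongr
        exact pow_le_one₀ ht0 ht1.le
    _ = ((m + 1) * (s / r) ^ m) * (C * A) := by ring
    _ ≤ B * (C * A) := by
        gcongr
        exact hB m

theorem norm_lt_iff_pair {p : ℂ × ℂ} {r : ℝ} : ‖p‖ < r ↔ ‖p.1‖ < r ∧ ‖p.2‖ < r := by
  rw [Prod.norm_def, max_lt_iff]

theorem summable_geom_prod {t : ℝ} (h0 : 0 ≤ t) (h1 : t < 1) :
    Summable fun n : ℕ × ℕ => t ^ n.1 * t ^ n.2 :=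
  (summable_geometric_of_lt_one h0 h1).mul_of_nonneg (summable_geometric_of_lt_one h0 h1)
    (fun n => pow_nonneg h0 n) fun n => pow_nonneg h0 n

theorem GeomBound.exists_summable {a : ℕ → ℕ → ℂ} {r s : ℝ} (h : GeomBound a r) (hs : 0 ≤ s)
    (hsr : s < r) : ∃ u : ℕ × ℕ → ℝ, Summable u ∧
      ∀ (n : ℕ × ℕ) (x y : ℂ), ‖x‖ ≤ s → ‖y‖ ≤ s → ‖a n.1 n.2 * x ^ n.1 * y ^ n.2‖ ≤ u n := by
  have hr : 0 < r := hs.trans_lt hsr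
  obtain ⟨C, hC0, hC⟩ := h.exists_nonneg hr
  have ht0 : 0 ≤ s / r := by positivity
  have ht1 : s / r < 1 := (div_lt_one hr).2 hsr
  refine ⟨fun n => C * ((s / r) ^ n.1 * (s / r) ^ n.2),
    (summable_geom_prod ht0 ht1).mul_left C, fun n x y hx hy => ?_⟩
  rw [norm_mul, norm_mul, norm_pow, norm_pow]
  calc ‖a n.1 n.2‖ * ‖x‖ ^ n.1 * ‖y‖ ^ n.2
      ≤ (C * r⁻¹ ^ (n.1 + n.2)) * s ^ n.1 * s ^ n.2 := by
        gcongr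
        exact hC _ _
    _ = C * ((s / r) ^ n.1 * (s / r) ^ n.2) := by
        rw [div_eq_mul_inv]
        ring

theorem GeomBound.summable {a : ℕ → ℕ → ℂ} {r : ℝ} (h : GeomBound a r) {p : ℂ × ℂ}
    (hp : ‖p‖ < r) : Summable fun n : ℕ × ℕ => a n.1 n.2 * p.1 ^ n.1 * p.2 ^ n.2 := by
  obtain ⟨u, hu, hb⟩ := h.exists_summable (norm_nonneg p) hp
  exact .of_norm_bounded hu fun n => hb n _ _ (norm_fst_le p) (norm_snd_le p)

theorem DS_add {a b : ℕ → ℕ → ℂ} {r : ℝ} (ha : GeomBound a r) (hb : GeomBound b r) {p : ℂ × ℂ}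
    (hp : ‖p‖ < r) : DS (a + b) p = DS a p + DS b p := by
  unfold DS
  rw [← (ha.summable hp).tsum_add (hb.summable hp)]
  exact tsum_congr fun n => by simp only [Pi.add_apply]; ring

theorem DS_smul (c : ℂ) (a : ℕ → ℕ → ℂ) (p : ℂ × ℂ) : DS (c • a) p = c * DS a p := by
  unfold DS
  rw [← tsum_mul_left]
  exact tsum_congr fun n => by simp only [Pi.smul_apply, smul_eq_mul]; ring

theorem DS_swap (a : ℕ → ℕ → ℂ) (p : ℂ × ℂ) : DS (fun n m => a m n) p = DS a p.swap := by
  unfold DS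
  rw [← (Equiv.prodComm ℕ ℕ).tsum_eq]
  exact tsum_congr fun n => by
    simp only [Equiv.prodComm_apply, Prod.fst_swap, Prod.snd_swap]; ring

theorem tsum_succ_fst {f : ℕ × ℕ → ℂ} (h : ∀ m, f (0, m) = 0) :
    ∑' n : ℕ × ℕ, f (n.1 + 1, n.2) = ∑' n, f n := by
  have hi : Function.Injective fun n : ℕ × ℕ => (n.1 + 1, n.2) := fun x y hxy => by
    simp only [Prod.mk.injEq, add_left_inj] at hxy
    exact Prod.ext hxy.1 hxy.2
  refine hi.tsum_eq (f := f) fun n hn => ?_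
  rcases n with ⟨_ | n, m⟩
  · exact absurd (h m) hn
  · exact ⟨(n, m), rfl⟩

theorem DS_X1 (a : ℕ → ℕ → ℂ) (p : ℂ × ℂ) : DS (X1 a) p = p.1 * DS a p := by
  unfold DS
  rw [← tsum_succ_fst (f := fun n : ℕ × ℕ => X1 a n.1 n.2 * p.1 ^ n.1 * p.2 ^ n.2)
    (fun m => by simp [X1]), ← tsum_mul_left]
  exact tsum_congr fun n => by simp only [X1]; ring

theorem DS_X2 (a : ℕ → ℕ → ℂ) (p : ℂ × ℂ) : DS (X2 a) p = p.2 * DS a p := by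
  rw [X2_eq_swap, DS_swap (X1 fun n m => a m n), DS_X1, DS_swap]
  rfl

/-- Termwise differentiation: on a disc of radius `s' < s < r` the differentiated terms have a
summable bound, because `E1 a` keeps a geometric bound at radius `s`. -/
theorem hasDerivAt_DS_fst {a : ℕ → ℕ → ℂ} {r : ℝ} (h : GeomBound a r) {x y : ℂ}
    (hx : ‖x‖ < r) (hy : ‖y‖ < r) : HasDerivAt (fun t => DS a (t, y)) (DS (E1 a) (x, y)) x := by
  obtain ⟨s, hs, hsr⟩ := exists_between (max_lt hx hy)
  rw [max_lt_iff] at hs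
  have hs0 : 0 < s := (norm_nonneg x).trans_lt hs.1
  obtain ⟨s', hs', hs's⟩ := exists_between (max_lt hs.1 hs.2)
  rw [max_lt_iff] at hs'
  have hs'0 : 0 < s' := (norm_nonneg x).trans_lt hs'.1
  obtain ⟨u, hu, hb⟩ := (h.E1 hs0.le hsr).exists_summable hs'0.le hs's
  let g' : ℕ × ℕ → ℂ → ℂ := fun n t => a n.1 n.2 * (n.1 * t ^ (n.1 - 1)) * y ^ n.2
  have hg' : ∀ (n : ℕ × ℕ) (t : ℂ), g' (n.1 + 1, n.2) t = E1 a n.1 n.2 * t ^ n.1 * y ^ n.2 := by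
    intro n t
    simp only [g', E1, Nat.add_sub_cancel, Nat.cast_add, Nat.cast_one]
    ring
  -- The bound `u` for the terms of `E1 a`, shifted by one in the first index; the terms constant in
  -- `t` have derivative `0`.
  let v : ℕ × ℕ → ℝ := fun n => Nat.casesOn n.1 0 fun k => u (k, n.2)
  have hi : Function.Injective fun n : ℕ × ℕ => (n.1 + 1, n.2) := fun x y hxy => by
    simp only [Prod.mk.injEq, add_left_inj] at hxy
    exact Prod.ext hxy.1 hxy.2
  have hv : Summable v := by
    refine (hi.summable_iff fun n hn => ?_).1 hu
    rcases n with ⟨_ | n, m⟩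
    · rfl
    · exact absurd ⟨(n, m), rfl⟩ hn
  have hmain := hasDerivAt_tsum_of_isPreconnected (𝕜 := ℂ)
    (g := fun (n : ℕ × ℕ) (t : ℂ) => a n.1 n.2 * t ^ n.1 * y ^ n.2) (g' := g') (y₀ := x) (y := x)
    hv Metric.isOpen_ball (convex_ball (0 : ℂ) s').isPreconnected (fun n t _ => ?_)
    (fun n t ht => ?_) (mem_ball_zero_iff.2 hs'.1) ?_ (mem_ball_zero_iff.2 hs'.1)
  · convert! hmain using 1
    unfold DS
    rw [← tsum_succ_fst (f := fun n => g' n x) fun m => by simp [g']]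
    exact tsum_congr fun n => (hg' n x).symm
  · exact ((hasDerivAt_pow n.1 t).const_mul _).mul_const _
  · rcases n with ⟨_ | n, m⟩
    · simp [g', v]
    · have := hg' (n, m) t
      simp only at this
      rw [this]
      exact hb (n, m) t y (mem_ball_zero_iff.1 ht).le hs'.2.le
  · exact h.summable (p := (x, y)) (norm_lt_iff_pair.2 ⟨hx, hy⟩)

theorem D1_DS {a : ℕ → ℕ → ℂ} {r : ℝ} (h : GeomBound a r) {p : ℂ × ℂ} (hp : ‖p‖ < r) :
    D1 (DS a) p = DS (E1 a) p :=
  (hasDerivAt_DS_fst h (norm_lt_iff_pair.1 hp).1 (norm_lt_iff_pair.1 hp).2).deriv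

theorem D2_DS {a : ℕ → ℕ → ℂ} {r : ℝ} (h : GeomBound a r) {p : ℂ × ℂ} (hp : ‖p‖ < r) :
    D2 (DS a) p = DS (E2 a) p := by
  have := (hasDerivAt_DS_fst h.swap (norm_lt_iff_pair.1 hp).2 (norm_lt_iff_pair.1 hp).1).deriv
  have e : (fun t => DS a (p.1, t)) = fun t => DS (fun n m => a m n) (t, p.1) :=
    funext fun t => (DS_swap a (t, p.1)).symm
  rw [D2, e, this]
  exact (DS_swap (E2 a) (p.2, p.1))

/-- The formal multilinear series of a double power series. -/
def dsSeries (a : ℕ → ℕ → ℂ) : FormalMultilinearSeries ℂ (ℂ × ℂ) ℂ := fun k =>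
  ∑ ij ∈ Finset.HasAntidiagonal.antidiagonal k, a ij.1 ij.2 •
    (ContinuousMultilinearMap.mkPiAlgebra ℂ (Fin k) ℂ).compContinuousLinearMap
      fun l => if (l : ℕ) < ij.1 then ContinuousLinearMap.fst ℂ ℂ ℂ
        else ContinuousLinearMap.snd ℂ ℂ ℂ

theorem dsSeries_apply (a : ℕ → ℕ → ℂ) (k : ℕ) (p : ℂ × ℂ) :
    dsSeries a k (fun _ => p)
      = ∑ ij ∈ Finset.HasAntidiagonal.antidiagonal k, a ij.1 ij.2 * p.1 ^ ij.1 * p.2 ^ ij.2 := by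
  unfold dsSeries
  rw [sum_apply]
  refine Finset.sum_congr rfl fun ij hij => ?_
  rw [smul_apply, ContinuousMultilinearMap.compContinuousLinearMap_apply,
    ContinuousMultilinearMap.mkPiAlgebra_apply, smul_eq_mul, mul_assoc]
  congr 1
  obtain ⟨i, j⟩ := ij
  obtain rfl : i + j = k := Finset.HasAntidiagonal.mem_antidiagonal.1 hij
  rw [Fin.prod_univ_add]
  simp

theorem norm_dsSeries_le {a : ℕ → ℕ → ℂ} {r C : ℝ} (hC : ∀ n m, ‖a n m‖ ≤ C * (r⁻¹) ^ (n + m))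
    (k : ℕ) : ‖dsSeries a k‖ ≤ (k + 1) * (C * (r⁻¹) ^ k) := by
  unfold dsSeries
  refine (norm_sum_le _ _).trans ?_
  have : ∀ ij ∈ Finset.HasAntidiagonal.antidiagonal k, ‖a ij.1 ij.2 •
    (ContinuousMultilinearMap.mkPiAlgebra ℂ (Fin k) ℂ).compContinuousLinearMap
      fun l => if (l : ℕ) < ij.1 then ContinuousLinearMap.fst ℂ ℂ ℂ
        else ContinuousLinearMap.snd ℂ ℂ ℂ‖ ≤ C * (r⁻¹) ^ k := by
    intro ij hij
    rw [norm_smul, ← Finset.HasAntidiagonal.mem_antidiagonal.1 hij]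
    refine (mul_le_of_le_one_right (norm_nonneg _) ?_).trans (hC _ _)
    refine (ContinuousMultilinearMap.norm_compContinuousLinearMap_le _ _).trans ?_
    rw [ContinuousMultilinearMap.norm_mkPiAlgebra, one_mul]
    refine Finset.prod_le_one (fun _ _ => norm_nonneg _) fun l _ => ?_
    split_ifs
    · exact ContinuousLinearMap.norm_fst_le ℂ ℂ ℂ
    · exact ContinuousLinearMap.norm_snd_le ℂ ℂ ℂ
  refine (Finset.sum_le_sum this).trans ?_
  simp

/-- The homogeneous part of degree `k` has `k + 1` monomials, so its norm is at most `(k + 1) C r⁻ᵏ`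
and the radius of convergence is at least every `s < r`. -/
theorem analyticAt_DS {a : ℕ → ℕ → ℂ} {r : ℝ} (h : GeomBound a r) {p : ℂ × ℂ} (hp : ‖p‖ < r) :
    AnalyticAt ℂ (DS a) p := by
  obtain ⟨s, hps, hsr⟩ := exists_between hp
  have hs0 : 0 < s := (norm_nonneg p).trans_lt hps
  have hr : 0 < r := hs0.trans hsr
  lift s to NNReal using hs0.le
  obtain ⟨C, hC0, hC⟩ := h.exists_nonneg hr
  obtain ⟨B, hB⟩ := exists_bound_mul_pow (t := s / r) (by positivity) ((div_lt_one hr).2 hsr)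
  have hser : HasFPowerSeriesOnBall (DS a) (dsSeries a) 0 s := by
    refine ⟨FormalMultilinearSeries.le_radius_of_bound _ (B * C) fun k => ?_, by simpa using hs0,
      fun {y} hy => ?_⟩
    · calc ‖dsSeries a k‖ * (s : ℝ) ^ k ≤ ((k + 1) * (C * (r⁻¹) ^ k)) * (s : ℝ) ^ k := by
            gcongr
            exact norm_dsSeries_le hC k
        _ = ((k + 1) * (s / r) ^ k) * C := by
            rw [div_eq_mul_inv]
            ring
        _ ≤ B * C := by
            gcongr
            exact hB k
    · rw [zero_add]
      have hy' : ‖y‖ < r := by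
        rw [Metric.mem_eball, edist_zero_right] at hy
        have : ‖y‖₊ < s := by exact_mod_cast hy
        exact lt_trans (by exact_mod_cast this) hsr
      have hsum := (h.summable hy').hasSum
      rw [← Finset.HasAntidiagonal.sigmaAntidiagonalEquivProd.hasSum_iff] at hsum
      have := hsum.sigma fun k => hasSum_fintype _
      convert! this using 1
      funext k
      rw [dsSeries_apply, ← Finset.sum_coe_sort]
      rfl
  exact hser.analyticAt_of_mem (by
    rw [Metric.mem_eball, edist_zero_right]
    have : ‖p‖₊ < s := by exact_mod_cast hps
    exact_mod_cast this)

theorem DS_zero (a : ℕ → ℕ → ℂ) (y : ℂ) : DS a (0, y) = ∑' m, a 0 m * y ^ m := by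
  unfold DS
  have hi : Function.Injective fun m : ℕ => (0, m) := fun x y hxy => by simpa using hxy
  rw [← hi.tsum_eq (f := fun n : ℕ × ℕ => a n.1 n.2 * (0 : ℂ) ^ n.1 * y ^ n.2)]
  · exact tsum_congr fun m => by simp
  · rintro ⟨_ | n, m⟩ hn
    · exact ⟨m, rfl⟩
    · simp at hn

theorem DS_zero_zero (a : ℕ → ℕ → ℂ) : DS a 0 = a 0 0 := by
  rw [← Prod.mk_zero_zero, DS_zero, tsum_eq_single 0 fun m hm => by simp [hm]]
  simp

/-- A double power series which vanishes near the origin has zero coefficients. -/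
theorem DS_coeff_eq_zero (n m : ℕ) : ∀ {a : ℕ → ℕ → ℂ} {r : ℝ}, 0 < r → GeomBound a r →
    DS a =ᶠ[𝓝 0] (fun _ => 0) → a n m = 0 := by
  have hball : ∀ {r : ℝ}, 0 < r → ∀ᶠ p : ℂ × ℂ in 𝓝 0, ‖p‖ < r := fun {r} hr =>
    Filter.mem_of_superset (Metric.ball_mem_nhds (0 : ℂ × ℂ) hr) fun p hp => mem_ball_zero_iff.1 hp
  have z1 : ∀ p, D1 (fun _ => 0) p = 0 := fun p => deriv_const _ _
  have z2 : ∀ p, D2 (fun _ => 0) p = 0 := fun p => deriv_const _ _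
  induction n with
  | zero =>
    induction m with
    | zero =>
      intro a r _ _ h
      rw [← DS_zero_zero a]
      exact h.eq_of_nhds
    | succ m ih =>
      intro a r hr ha h
      have := ih (half_pos hr) (ha.E2 (half_pos hr).le (half_lt_self hr)) (by
        filter_upwards [eventuallyEq_D2 h, hball hr] with p hp hpr
        rw [← D2_DS ha hpr, hp, z2])
      exact (mul_eq_zero.1 this).resolve_left (by exact_mod_cast Nat.succ_ne_zero m)
  | succ n ih =>
    intro a r hr ha h
    have := ih (half_pos hr) (ha.E1 (half_pos hr).le (half_lt_self hr)) (by
      filter_upwards [eventuallyEq_D1 h, hball hr] with p hp hpr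
      rw [← D1_DS ha hpr, hp, z1])
    exact (mul_eq_zero.1 this).resolve_left (by exact_mod_cast Nat.succ_ne_zero n)

theorem DS_coeff_unique {a b : ℕ → ℕ → ℂ} {r : ℝ} (hr : 0 < r) (ha : GeomBound a r)
    (hb : GeomBound b r) (h : DS a =ᶠ[𝓝 0] DS b) : a = b := by
  funext n m
  have := DS_coeff_eq_zero n m hr (ha.add hr.le (hb.smul (-1))) (by
    filter_upwards [h, Metric.ball_mem_nhds (0 : ℂ × ℂ) hr] with p hp hpr
    rw [DS_add ha (hb.smul (-1)) (mem_ball_zero_iff.1 hpr), DS_smul, hp]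
    ring)
  simpa [sub_eq_zero, ← sub_eq_add_neg] using this

theorem DS_conv {f : ℕ → ℂ} {a : ℕ → ℕ → ℂ} {r C : ℝ} (h : GeomBound a r)
    (hf : ∀ i, ‖f i‖ * r ^ i ≤ C) {p : ℂ × ℂ} (hp : ‖p‖ < r) :
    DS (conv f a) p = (∑' i, f i * p.2 ^ i) * DS a p := by
  obtain ⟨s, hps, hsr⟩ := exists_between hp
  have hs0 : 0 < s := (norm_nonneg p).trans_lt hps
  have hr : 0 < r := hs0.trans hsr
  have hc := h.conv hf hs0.le hsr
  have hsum := h.summable hp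
  have hfs : Summable fun i => ‖f i * p.2 ^ i‖ := by
    refine .of_nonneg_of_le (fun _ => norm_nonneg _) (fun i => ?_)
      ((summable_geometric_of_lt_one (r := ‖p‖ / r) (by positivity)
        ((div_lt_one hr).2 hp)).mul_left C)
    rw [norm_mul, norm_pow, div_pow, ← mul_div_assoc, le_div_iff₀ (by positivity)]
    calc ‖f i‖ * ‖p.2‖ ^ i * r ^ i = (‖f i‖ * r ^ i) * ‖p.2‖ ^ i := by ring
      _ ≤ C * ‖p‖ ^ i := by
        have : 0 ≤ C := le_trans (by positivity) (hf 0)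
        gcongr
        · exact hf i
        · exact norm_snd_le p
  unfold DS
  rw [(hc.summable hps).tsum_prod, hsum.tsum_prod, ← tsum_mul_left]
  refine tsum_congr fun n => ?_
  have ha := hsum.norm.prod_factor n
  simp only at ha ⊢
  rw [tsum_mul_tsum_eq_tsum_sum_antidiagonal_of_summable_norm hfs ha]
  refine tsum_congr fun m => ?_
  rw [conv, Finset.sum_mul, Finset.sum_mul]
  refine Finset.sum_congr rfl fun ij hij => ?_
  rw [← Finset.HasAntidiagonal.mem_antidiagonal.1 hij]
  ring

theorem eventually_norm_lt {r : ℝ} (hr : 0 < r) : ∀ᶠ p : ℂ × ℂ in 𝓝 0, ‖p‖ < r :=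
  Filter.mem_of_superset (Metric.ball_mem_nhds (0 : ℂ × ℂ) hr) fun _ => mem_ball_zero_iff.1

theorem prod_piecewise_const {k : ℕ} (s : Finset (Fin k)) (x y : ℂ) :
    ∏ i, s.piecewise (fun _ => x) (fun _ => y) i = x ^ s.card * y ^ (k - s.card) := by
  rw [Finset.prod_piecewise]
  simp [Finset.card_sdiff, Finset.inter_univ]

/-- The coefficient of `x ^ i * y ^ (k - i)` in the homogeneous part `p k` of degree `k`. -/
def seriesCoeff (p : FormalMultilinearSeries ℂ (ℂ × ℂ) ℂ) (k i : ℕ) : ℂ :=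
  ∑ s ∈ Finset.powersetCard i (Finset.univ : Finset (Fin k)),
    p k (s.piecewise (fun _ => (1, 0)) fun _ => (0, 1))

/-- Expand `p k` multilinearly at `y = y.1 • (1,0) + y.2 • (0,1)` and group the subsets of slots
that receive the first summand by their cardinality. -/
theorem series_apply_eq_sum (p : FormalMultilinearSeries ℂ (ℂ × ℂ) ℂ) (k : ℕ) (y : ℂ × ℂ) :
    p k (fun _ => y) = ∑ ij ∈ Finset.HasAntidiagonal.antidiagonal k,
      seriesCoeff p (ij.1 + ij.2) ij.1 * y.1 ^ ij.1 * y.2 ^ ij.2 := by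
  have h1 : (fun _ : Fin k => y)
      = (fun _ => y.1 • ((1 : ℂ), (0 : ℂ))) + fun _ => y.2 • ((0 : ℂ), (1 : ℂ)) := by
    funext i
    ext <;> simp
  have h2 : p k (fun _ => y) = ∑ s : Finset (Fin k), y.1 ^ s.card * y.2 ^ (k - s.card) *
      p k (s.piecewise (fun _ => (1, 0)) fun _ => (0, 1)) := by
    rw [h1, ContinuousMultilinearMap.map_add_univ]
    refine Finset.sum_congr rfl fun s _ => ?_
    rw [← prod_piecewise_const, ← smul_eq_mul, ← ContinuousMultilinearMap.map_smul_univ]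
    congr 1
    funext i
    by_cases hi : i ∈ s <;> simp [hi]
  rw [h2, ← Finset.powerset_univ, Finset.sum_powerset, Finset.card_univ, Fintype.card_fin,
    Finset.Nat.sum_antidiagonal_eq_sum_range_succ_mk]
  refine Finset.sum_congr rfl fun i hi => ?_
  have hik : i + (k - i) = k := by
    have := Finset.mem_range.1 hi
    omega
  simp only [hik]
  rw [seriesCoeff, Finset.sum_mul, Finset.sum_mul]
  refine Finset.sum_congr rfl fun s hs => ?_
  rw [(Finset.mem_powersetCard.1 hs).2]
  ring

theorem norm_seriesCoeff_le (p : FormalMultilinearSeries ℂ (ℂ × ℂ) ℂ) (k i : ℕ) :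
    ‖seriesCoeff p k i‖ ≤ 2 ^ k * ‖p k‖ := by
  have h : ∀ s ∈ Finset.powersetCard i (Finset.univ : Finset (Fin k)),
      ‖p k (s.piecewise (fun _ => (1, 0)) fun _ => (0, 1))‖ ≤ ‖p k‖ := fun s _ => by
    refine ((p k).le_opNorm _).trans (mul_le_of_le_one_right (norm_nonneg _) ?_)
    refine Finset.prod_le_one (fun _ _ => norm_nonneg _) fun j _ => ?_
    by_cases hj : j ∈ s <;> simp [hj, Prod.norm_def]
  refine (norm_sum_le _ _).trans ((Finset.sum_le_sum h).trans ?_)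
  rw [Finset.sum_const, Finset.card_powersetCard, nsmul_eq_mul, Finset.card_univ, Fintype.card_fin]
  gcongr
  exact_mod_cast Nat.choose_le_two_pow k i

/-- A germ of holomorphic function of two variables is the sum of a double power series. -/
theorem exists_DS_of_analyticAt {f : ℂ × ℂ → ℂ} (hf : AnalyticAt ℂ f 0) :
    ∃ a r, 0 < r ∧ GeomBound a r ∧ f =ᶠ[𝓝 0] DS a := by
  obtain ⟨p, R, hp⟩ := hf
  obtain ⟨ρ, hρ0, hρ⟩ := ENNReal.lt_iff_exists_nnreal_btwn.1 hp.r_pos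
  have hρ0' : (0 : ℝ) < ρ := by exact_mod_cast hρ0
  obtain ⟨C, hC0, hC⟩ := p.norm_mul_pow_le_of_lt_radius (hρ.trans_le hp.r_le)
  -- The radius is halved because a coefficient is a sum over up to `2 ^ k` subsets of slots.
  have hb : GeomBound (fun i j => seriesCoeff p (i + j) i) (ρ / 2) := by
    refine ⟨C, fun i j => ?_⟩
    calc ‖seriesCoeff p (i + j) i‖ * ((ρ : ℝ) / 2) ^ (i + j)
        ≤ (2 ^ (i + j) * ‖p (i + j)‖) * ((ρ : ℝ) / 2) ^ (i + j) := by
          gcongr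
          exact norm_seriesCoeff_le _ _ _
      _ = ‖p (i + j)‖ * (ρ : ℝ) ^ (i + j) := by
          rw [div_pow]
          field_simp
      _ ≤ C := hC _
  refine ⟨_, ρ / 2, by positivity, hb, ?_⟩
  filter_upwards [eventually_norm_lt (half_pos hρ0')] with y hy
  have h1 := hp.hasSum (y := y) (by
    rw [Metric.mem_eball, edist_zero_right]
    refine lt_trans ?_ hρ
    have : ‖y‖₊ < ρ := by
      have : ‖y‖ < ρ := hy.trans (half_lt_self hρ0')
      exact_mod_cast this
    exact_mod_cast this)
  rw [zero_add] at h1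
  have hsum := (hb.summable hy).hasSum
  rw [← Finset.HasAntidiagonal.sigmaAntidiagonalEquivProd.hasSum_iff] at hsum
  refine h1.unique ?_
  convert! hsum.sigma fun k => hasSum_fintype _ using 1
  funext k
  rw [series_apply_eq_sum, ← Finset.sum_coe_sort]
  rfl

theorem coeff_zero_eq_zero (m : ℕ) : ∀ {a : ℕ → ℕ → ℂ} {r : ℝ}, 0 < r → GeomBound a r →
    (∀ᶠ y in 𝓝 (0 : ℂ), DS a (0, y) = 0) → a 0 m = 0 := by
  induction m with
  | zero =>
    intro a r _ _ h
    rw [← DS_zero_zero a]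
    exact h.self_of_nhds
  | succ m ih =>
    intro a r hr ha h
    have := ih (half_pos hr) (ha.E2 (half_pos hr).le (half_lt_self hr)) (by
      filter_upwards [h.eventually_nhds, Metric.ball_mem_nhds (0 : ℂ) hr] with y hy hyr
      rw [← D2_DS ha (norm_lt_iff_pair.2 ⟨by simpa using hr, mem_ball_zero_iff.1 hyr⟩)]
      exact (Filter.EventuallyEq.deriv_eq hy).trans (deriv_const _ _))
    exact (mul_eq_zero.1 this).resolve_left (by exact_mod_cast Nat.succ_ne_zero m)

theorem iterate_X1_apply_of_lt (a : ℕ → ℕ → ℂ) (k : ℕ) :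
    ∀ {n m : ℕ}, n < k → (X1^[k] a) n m = 0 := by
  induction k with
  | zero => intro n m h; omega
  | succ k ih =>
    intro n m h
    rw [Function.iterate_succ_apply']
    cases n with
    | zero => rfl
    | succ n => exact ih (by omega)

theorem iterate_X1_apply_add (a : ℕ → ℕ → ℂ) (k n m : ℕ) : (X1^[k] a) (n + k) m = a n m := by
  induction k with
  | zero => rfl
  | succ k ih =>
    rw [Function.iterate_succ_apply']
    exact ih

theorem DS_iterate_X1 (a : ℕ → ℕ → ℂ) (k : ℕ) (p : ℂ × ℂ) :
    DS (X1^[k] a) p = p.1 ^ k * DS a p := by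
  induction k with
  | zero => simp
  | succ k ih => rw [Function.iterate_succ_apply', DS_X1, ih]; ring

theorem GeomBound.iterate_X1 {a : ℕ → ℕ → ℂ} {r : ℝ} (h : GeomBound a r) (hr : 0 < r) (k : ℕ) :
    GeomBound (AiryConfluent.X1^[k] a) r := by
  induction k with
  | zero => exact h
  | succ k ih => rw [Function.iterate_succ_apply']; exact ih.X1 hr

/-! ### Uniqueness of the amplitude -/

/-- The coefficients of
`q² ∂_q² D + 2 w q ∂_q ∂_w D - q ∂_w² D - 2 w ∂_w D`, where `D` has the coefficients `d`. -/
def transportCoeff (d : ℕ → ℕ → ℂ) : ℕ → ℕ → ℂ :=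
  X1 (X1 (E1 (E1 d))) + ((2 : ℂ) • X2 (X1 (E1 (E2 d))) +
    ((-1 : ℂ) • X1 (E2 (E2 d)) + (-2 : ℂ) • X2 (E2 d)))

/-- The terms preserving the power of `q` contribute `(k+2)(k+1) + 2m(k+2) - 2m = (k+1)(k+2+2m)`;
the term `q ∂_w²` raises it by one and therefore sees only column `k + 1`. -/
theorem transportCoeff_apply {d : ℕ → ℕ → ℂ} {k : ℕ} (hd : ∀ m, d (k + 1) m = 0) (m : ℕ) :
    transportCoeff d (k + 2) m = (k + 1) * (k + 2 + 2 * m) * d (k + 2) m := by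
  cases m with
  | zero =>
    simp only [transportCoeff, Pi.add_apply, Pi.smul_apply, X1, X2, E1, E2, hd, smul_eq_mul]
    push_cast
    ring
  | succ m =>
    simp only [transportCoeff, Pi.add_apply, Pi.smul_apply, X1, X2, E1, E2, hd, smul_eq_mul]
    push_cast
    ring

theorem transport_DS {d : ℕ → ℕ → ℂ} {r : ℝ} (hr : 0 < r) (hd : GeomBound d r) :
    GeomBound (transportCoeff d) (r / 4) ∧ ∀ p : ℂ × ℂ, ‖p‖ < r / 4 →
      p.1 ^ 2 * D1 (D1 (DS d)) p + 2 * p.2 * p.1 * D1 (D2 (DS d)) p - p.1 * D2 (D2 (DS d)) p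
        - 2 * p.2 * D2 (DS d) p = DS (transportCoeff d) p := by
  have h2 : 0 < r / 2 := by positivity
  have h4 : 0 < r / 4 := by positivity
  have h42 : r / 4 < r / 2 := by linarith
  have h21 : r / 2 < r := by linarith
  have b1 := hd.E1 h2.le h21
  have b2 := hd.E2 h2.le h21
  have b11 := b1.E1 h4.le h42
  have b12 := b2.E1 h4.le h42
  have b22 := b2.E2 h4.le h42
  have c1 := (b11.X1 h4).X1 h4
  have c2 := ((b12.X1 h4).X2 h4).smul 2
  have c3 := (b22.X1 h4).smul (-1)
  have c4 := ((b2.mono h4.le h42.le).X2 h4).smul (-2)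
  have c34 := c3.add h4.le c4
  have c234 := c2.add h4.le c34
  refine ⟨c1.add h4.le c234, fun p hp => ?_⟩
  have hp2 : ‖p‖ < r / 2 := hp.trans h42
  have hp1 : ‖p‖ < r := hp2.trans h21
  have hev : ∀ᶠ x : ℂ × ℂ in 𝓝 p, ‖x‖ < r := continuous_norm.continuousAt.eventually_lt
    continuousAt_const hp1
  have e1 : D1 (DS d) =ᶠ[𝓝 p] DS (E1 d) := hev.mono fun x hx => D1_DS hd hx
  have e2 : D2 (DS d) =ᶠ[𝓝 p] DS (E2 d) := hev.mono fun x hx => D2_DS hd hx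
  rw [D1_congr e1, D1_congr e2, D2_congr e2, e2.eq_of_nhds, D1_DS b1 hp2, D1_DS b2 hp2,
    D2_DS b2 hp2, transportCoeff, DS_add c1 c234 hp, DS_add c2 c34 hp, DS_add c3 c4 hp]
  simp only [DS_smul, DS_X1, DS_X2]
  ring

/-- A holomorphic solution of the transport equation which vanishes on `q = 0` together with its
normal derivative vanishes. -/
theorem eventuallyEq_zero_of_transport {D G : ℂ × ℂ → ℂ} (hD : AnalyticAt ℂ D 0)
    (hG : AnalyticAt ℂ G 0) (h0 : ∀ᶠ w in 𝓝 (0 : ℂ), D (0, w) = 0)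
    (h1 : ∀ᶠ w in 𝓝 (0 : ℂ), D1 D (0, w) = 0)
    (h : ∀ᶠ p : ℂ × ℂ in 𝓝 0, p.1 ^ 2 * D1 (D1 D) p + 2 * p.2 * p.1 * D1 (D2 D) p
      - p.1 * D2 (D2 D) p - 2 * p.2 * D2 D p = p.1 ^ 2 * (G p * D p)) :
    D =ᶠ[𝓝 0] fun _ => 0 := by
  obtain ⟨d, r, hr, hd, hDd⟩ := exists_DS_of_analyticAt hD
  have hslice : ∀ {P : ℂ × ℂ → Prop}, (∀ᶠ p in 𝓝 0, P p) → ∀ᶠ w in 𝓝 (0 : ℂ), P (0, w) :=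
    fun {P} hP => eventually_slice_snd (p := (0 : ℂ × ℂ)) hP
  have d0 : ∀ m, d 0 m = 0 := fun m => coeff_zero_eq_zero m hr hd (by
    filter_upwards [h0, hslice hDd] with w hw hw'
    rw [← hw', hw])
  have d1 : ∀ m, d 1 m = 0 := fun m => by
    have := coeff_zero_eq_zero m (half_pos hr) (hd.E1 (half_pos hr).le (half_lt_self hr)) (by
      filter_upwards [h1, hslice (eventuallyEq_D1 hDd), hslice (eventually_norm_lt hr)]
        with w hw hw' hwr
      rw [← D1_DS hd hwr, ← hw', hw])
    simpa [E1] using this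
  obtain ⟨hb, ht⟩ := transport_DS hr hd
  have hall : ∀ n m, d n m = 0 := by
    intro n
    induction n using Nat.strong_induction_on with
    | _ n ih =>
      match n, ih with
      | 0, _ => exact d0
      | 1, _ => exact d1
      | k + 2, ih =>
        intro m
        -- Under the induction hypothesis `D` is divisible by `q ^ (k + 2)`; the shifted array is
        -- the quotient.
        have hd' : GeomBound (fun n m => d (n + (k + 2)) m) r := by
          obtain ⟨C, hC0, hC⟩ := hd.exists_nonneg hr
          refine GeomBound.of_le (C := C * r⁻¹ ^ (k + 2)) hr fun n m => (hC _ _).trans_eq ?_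
          ring
        have hdX : d = X1^[k + 2] fun n m => d (n + (k + 2)) m := by
          funext n m
          rcases lt_or_ge n (k + 2) with hn | hn
          · rw [ih n hn, iterate_X1_apply_of_lt _ _ hn]
          · obtain ⟨j, rfl⟩ := Nat.exists_eq_add_of_le' hn
            rw [iterate_X1_apply_add]
        obtain ⟨e, s, hs, he, hes⟩ := exists_DS_of_analyticAt
          (hG.mul (analyticAt_DS hd' (p := 0) (by simpa using hr)))
        have hr4 : 0 < min (r / 4) s := lt_min (by positivity) hs
        -- The right side `q² G D` is divisible by `q ^ (k + 4)`, so it contributes nothing to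
        -- column `k + 2`.
        have key : transportCoeff d = X1^[k + 4] e := by
          refine DS_coeff_unique hr4 (hb.mono hr4.le (min_le_left _ _))
            ((he.mono hr4.le (min_le_right _ _)).iterate_X1 hr4 _) ?_
          filter_upwards [h, hes, hDd, eventuallyEq_D2 hDd, eventuallyEq_D1 (eventuallyEq_D1 hDd),
            eventuallyEq_D1 (eventuallyEq_D2 hDd), eventuallyEq_D2 (eventuallyEq_D2 hDd),
            eventually_norm_lt (r := r / 4) (by positivity)] with p p1 p2 p3 p4 p5 p6 p7 p8
          rw [← ht p p8, ← p4, ← p5, ← p6, ← p7, p1, p3, DS_iterate_X1, ← p2]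
          conv_lhs => rw [hdX]
          rw [DS_iterate_X1]
          simp only [Pi.mul_apply]
          ring
        have h3 := transportCoeff_apply (d := d) (k := k) (ih (k + 1) (by omega)) m
        rw [key, iterate_X1_apply_of_lt _ _ (by omega)] at h3
        refine (mul_eq_zero.1 h3.symm).resolve_left (mul_ne_zero ?_ ?_)
        · exact_mod_cast Nat.succ_ne_zero k
        · exact_mod_cast (by omega : k + 2 + 2 * m ≠ 0)
  refine hDd.trans (.of_forall fun p => ?_)
  simp [DS, hall]

/-- The coordinates `q = z - ẑ²`, `ẑ`. -/
def unfoldCoord (x : ℂ × ℂ) : ℂ × ℂ := (x.1 + x.2 ^ 2, x.2)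

theorem continuous_unfoldCoord : Continuous unfoldCoord := by
  unfold unfoldCoord
  fun_prop

theorem analyticAt_unfoldCoord (x : ℂ × ℂ) : AnalyticAt ℂ unfoldCoord x :=
  (analyticAt_fst.add (analyticAt_snd.pow 2)).prod analyticAt_snd

/-- The regular equation in the coordinates `(q, ẑ)`. These are genuine coordinates at the origin,
unlike `(q, z)`, so no parity in `ẑ` is presupposed. -/
theorem transport_of_solvesRegularAt {F : ℂ → ℂ} {Δ : ℂ × ℂ → ℂ} {p : ℂ × ℂ}
    (hΔ : AnalyticAt ℂ Δ (unfoldCoord p)) :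
    D1 (Δ ∘ unfoldCoord) p = D1 Δ (unfoldCoord p) ∧
    D2 (Δ ∘ unfoldCoord) p = 2 * p.2 * D1 Δ (unfoldCoord p) + D2 Δ (unfoldCoord p) ∧
    (SolvesRegularAt F Δ (unfoldCoord p) →
      p.1 ^ 2 * D1 (D1 (Δ ∘ unfoldCoord)) p + 2 * p.2 * p.1 * D1 (D2 (Δ ∘ unfoldCoord)) p
      - p.1 * D2 (D2 (Δ ∘ unfoldCoord)) p - 2 * p.2 * D2 (Δ ∘ unfoldCoord) p
      = p.1 ^ 2 * (F (p.1 + p.2 ^ 2) * (Δ ∘ unfoldCoord) p)) := by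
  have k1 : ∀ x : ℂ × ℂ, HasDerivAt (fun t => t + x.2 ^ 2) 1 x.1 := fun x =>
    (hasDerivAt_id' _).add_const _
  have k2 : ∀ x : ℂ × ℂ, HasDerivAt (fun t => x.1 + t ^ 2) (2 * x.2) x.2 := fun x => by
    simpa using ((hasDerivAt_id' x.2).pow 2).const_add x.1
  have c1 : ∀ {f : ℂ × ℂ → ℂ} {x : ℂ × ℂ}, DifferentiableAt ℂ f (unfoldCoord x) →
      HasDerivAt (fun t => f (unfoldCoord (t, x.2))) (D1 f (unfoldCoord x)) x.1 :=
    fun {f x} hf => by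
      have := hasDerivAt_comp_pair hf rfl (k1 x) (hasDerivAt_const x.1 x.2)
      rw [one_mul, zero_mul, add_zero] at this
      exact this
  have c2 : ∀ {f : ℂ × ℂ → ℂ} {x : ℂ × ℂ}, DifferentiableAt ℂ f (unfoldCoord x) →
      HasDerivAt (fun t => f (unfoldCoord (x.1, t)))
        (2 * x.2 * D1 f (unfoldCoord x) + D2 f (unfoldCoord x)) x.2 :=
    fun {f x} hf => by
      have := hasDerivAt_comp_pair hf rfl (k2 x) (hasDerivAt_id' x.2)
      rw [one_mul] at this
      exact this
  have hev : ∀ᶠ x in 𝓝 p, AnalyticAt ℂ Δ (unfoldCoord x) :=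
    (continuous_unfoldCoord.tendsto p).eventually hΔ.eventually_analyticAt
  have e1 : D1 (Δ ∘ unfoldCoord) =ᶠ[𝓝 p] fun x => D1 Δ (unfoldCoord x) :=
    hev.mono fun x hx => (c1 hx.differentiableAt).deriv
  have e2 : D2 (Δ ∘ unfoldCoord) =ᶠ[𝓝 p]
      fun x => 2 * x.2 * D1 Δ (unfoldCoord x) + D2 Δ (unfoldCoord x) :=
    hev.mono fun x hx => (c2 hx.differentiableAt).deriv
  refine ⟨e1.eq_of_nhds, e2.eq_of_nhds, fun h => ?_⟩
  have dA := (analyticAt_D1 hΔ).differentiableAt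
  have dB := (analyticAt_D2 hΔ).differentiableAt
  have e11 : D1 (D1 (Δ ∘ unfoldCoord)) p = D1 (D1 Δ) (unfoldCoord p) := by
    rw [D1_congr e1]
    exact (c1 dA).deriv
  have e12 : D1 (D2 (Δ ∘ unfoldCoord)) p
      = 2 * p.2 * D1 (D1 Δ) (unfoldCoord p) + D1 (D2 Δ) (unfoldCoord p) := by
    rw [D1_congr e2]
    exact (((c1 dA).const_mul (2 * p.2)).add (c1 dB)).deriv
  have e22 : D2 (D2 (Δ ∘ unfoldCoord)) p = 2 * D1 Δ (unfoldCoord p)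
      + 2 * p.2 * (2 * p.2 * D1 (D1 Δ) (unfoldCoord p) + D2 (D1 Δ) (unfoldCoord p))
      + (2 * p.2 * D1 (D2 Δ) (unfoldCoord p) + D2 (D2 Δ) (unfoldCoord p)) := by
    rw [D2_congr e2]
    refine (((((hasDerivAt_id' p.2).const_mul 2)).mul (c2 dA)).add (c2 dB)).deriv.trans ?_
    simp
  rw [e11, e12, e22, e2.eq_of_nhds, D2_D1_eq hΔ]
  unfold SolvesRegularAt at h
  have hq : (unfoldCoord p).1 - (unfoldCoord p).2 ^ 2 = p.1 := by simp [unfoldCoord]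
  have hz : (unfoldCoord p).1 = p.1 + p.2 ^ 2 := rfl
  have hw : (unfoldCoord p).2 = p.2 := rfl
  rw [hq, hz, hw] at h
  simp only [Function.comp_apply]
  linear_combination h

theorem SolvesRegularAt.sub {F : ℂ → ℂ} {Ψ Ψ' : ℂ × ℂ → ℂ} {p : ℂ × ℂ}
    (hΨ : AnalyticAt ℂ Ψ p) (hΨ' : AnalyticAt ℂ Ψ' p) (h : SolvesRegularAt F Ψ p)
    (h' : SolvesRegularAt F Ψ' p) : SolvesRegularAt F (Ψ - Ψ') p := by
  have s1 : ∀ {f g : ℂ × ℂ → ℂ} {x}, AnalyticAt ℂ f x → AnalyticAt ℂ g x →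
      D1 (f - g) x = (D1 f - D1 g) x := fun hf hg =>
    ((hasDerivAt_fst hf.differentiableAt).sub (hasDerivAt_fst hg.differentiableAt)).deriv
  have s2 : ∀ {f g : ℂ × ℂ → ℂ} {x}, AnalyticAt ℂ f x → AnalyticAt ℂ g x →
      D2 (f - g) x = (D2 f - D2 g) x := fun hf hg =>
    ((hasDerivAt_snd hf.differentiableAt).sub (hasDerivAt_snd hg.differentiableAt)).deriv
  have e1 : D1 (Ψ - Ψ') =ᶠ[𝓝 p] D1 Ψ - D1 Ψ' := by
    filter_upwards [hΨ.eventually_analyticAt, hΨ'.eventually_analyticAt] with x hx hx'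
    exact s1 hx hx'
  have e2 : D2 (Ψ - Ψ') =ᶠ[𝓝 p] D2 Ψ - D2 Ψ' := by
    filter_upwards [hΨ.eventually_analyticAt, hΨ'.eventually_analyticAt] with x hx hx'
    exact s2 hx hx'
  unfold SolvesRegularAt at *
  rw [D1_congr e1, D1_congr e2, D2_congr e2, e1.eq_of_nhds, e2.eq_of_nhds,
    s1 (analyticAt_D1 hΨ) (analyticAt_D1 hΨ'), s1 (analyticAt_D2 hΨ) (analyticAt_D2 hΨ'),
    s2 (analyticAt_D2 hΨ) (analyticAt_D2 hΨ')]
  simp only [Pi.sub_apply]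
  linear_combination h - h'

theorem IsAmplitude.eventually_solvesRegularAt {F h : ℂ → ℂ} {Ψ : ℂ × ℂ → ℂ}
    (H : IsAmplitude F h Ψ) : ∀ᶠ p in 𝓝 (0 : ℂ × ℂ), p.1 ≠ p.2 ^ 2 → SolvesRegularAt F Ψ p := by
  filter_upwards [H.solves, H.analyticAt.eventually_analyticAt] with p hp ha hne
  exact (solvesSingularAt_div_iff ha hne).1 (hp hne)

/-- The difference solves the linear transport equation; the two conditions on `z = ẑ²` say that it
vanishes there together with its `q`-derivative. -/
theorem IsAmplitude.eventuallyEq {F h : ℂ → ℂ} {Ψ Ψ' : ℂ × ℂ → ℂ} (hF : AnalyticAt ℂ F 0)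
    (H : IsAmplitude F h Ψ) (H' : IsAmplitude F h Ψ') : Ψ' =ᶠ[𝓝 0] Ψ := by
  have hu0 : unfoldCoord 0 = 0 := by simp [unfoldCoord]
  have htend : Tendsto unfoldCoord (𝓝 0) (𝓝 0) := continuous_unfoldCoord.tendsto' 0 0 hu0
  have hslice : ∀ {P : ℂ × ℂ → Prop}, (∀ᶠ p in 𝓝 0, P p) → ∀ᶠ w in 𝓝 (0 : ℂ), P (w ^ 2, w) :=
    fun {P} hP => by
      have := eventually_slice_snd (p := (0 : ℂ × ℂ)) (htend.eventually hP)
      simpa [unfoldCoord] using this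
  have hΔ : AnalyticAt ℂ (Ψ' - Ψ) 0 := H'.analyticAt.sub H.analyticAt
  set Δ := Ψ' - Ψ with hΔdef
  have hD : AnalyticAt ℂ (Δ ∘ unfoldCoord) 0 :=
    AnalyticAt.comp (by rwa [hu0]) (analyticAt_unfoldCoord 0)
  have hΔev := hΔ.eventually_analyticAt
  have hzero : ∀ᶠ w in 𝓝 (0 : ℂ), Δ (w ^ 2, w) = 0 := by
    filter_upwards [H.eq_one, H'.eq_one] with w hw hw'
    simp [hΔdef, hw, hw']
  have hD0 : ∀ᶠ w in 𝓝 (0 : ℂ), (Δ ∘ unfoldCoord) (0, w) = 0 := by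
    simpa [unfoldCoord] using hzero
  have hD2 : ∀ᶠ w in 𝓝 (0 : ℂ), D2 (Δ ∘ unfoldCoord) (0, w) = 0 := by
    filter_upwards [hD0.eventually_nhds] with w hw
    exact (Filter.EventuallyEq.deriv_eq hw).trans (deriv_const _ _)
  -- Along `q = 0` the derivative of the difference is `0 = 2w ∂_z Δ + ∂_ẑ Δ`, and the derivative
  -- condition gives `∂_ẑ Δ = 0`; then divide by `2w`.
  have hD1 : ∀ᶠ w in 𝓝[≠] (0 : ℂ), D1 (Δ ∘ unfoldCoord) (0, w) = 0 := by
    filter_upwards [H.deriv_eq, H'.deriv_eq, nhdsWithin_le_nhds (hslice hΔev),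
      nhdsWithin_le_nhds (hslice H.analyticAt.eventually_analyticAt),
      nhdsWithin_le_nhds (hslice H'.analyticAt.eventually_analyticAt),
      nhdsWithin_le_nhds hD2, self_mem_nhdsWithin] with w h1 h2 ha hb hc h3 hw
    have hw0 : w ≠ 0 := hw
    have e : unfoldCoord (0, w) = (w ^ 2, w) := by simp [unfoldCoord]
    obtain ⟨t1, t2, -⟩ := transport_of_solvesRegularAt (F := F) (Δ := Δ) (p := (0, w))
      (by rwa [e])
    have hsub : D2 Δ (w ^ 2, w) = 0 := by
      have : D2 Δ (w ^ 2, w) = D2 Ψ' (w ^ 2, w) - D2 Ψ (w ^ 2, w) :=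
        ((hasDerivAt_snd hc.differentiableAt).sub (hasDerivAt_snd hb.differentiableAt)).deriv
      rw [this, sub_eq_zero]
      have hne : -(1 / (2 * w)) ≠ 0 := by simp [hw0]
      exact mul_left_cancel₀ hne (h2.trans h1.symm)
    rw [t2, e, hsub, add_zero] at h3
    rw [t1, e]
    exact (mul_eq_zero.1 h3).resolve_left (mul_ne_zero two_ne_zero hw0)
  -- The condition is silent at `w = 0`; that value follows by continuity.
  have hD1' : ∀ᶠ w in 𝓝 (0 : ℂ), D1 (Δ ∘ unfoldCoord) (0, w) = 0 := by
    have hc : ContinuousAt (fun w : ℂ => D1 (Δ ∘ unfoldCoord) (0, w)) 0 :=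
      ContinuousAt.comp (f := fun w : ℂ => ((0 : ℂ), w)) (analyticAt_D1 hD).continuousAt
        (by fun_prop)
    have h00 : D1 (Δ ∘ unfoldCoord) (0, 0) = 0 :=
      tendsto_nhds_unique (hc.tendsto.mono_left nhdsWithin_le_nhds)
        ((tendsto_const_nhds (x := (0 : ℂ))).congr' (hD1.mono fun _ h => h.symm))
    rw [eventually_nhdsWithin_iff] at hD1
    filter_upwards [hD1] with w hw
    by_cases h : w = 0
    · rw [h, h00]
    · exact hw h
  have hGa : AnalyticAt ℂ (fun p : ℂ × ℂ => F (p.1 + p.2 ^ 2)) 0 :=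
    AnalyticAt.comp (f := fun p : ℂ × ℂ => p.1 + p.2 ^ 2) (by simpa using hF)
      (analyticAt_fst.add (analyticAt_snd.pow 2))
  have hzero' := eventuallyEq_zero_of_transport hD hGa hD0 hD1' (by
    filter_upwards [htend.eventually hΔev, htend.eventually H.eventually_solvesRegularAt,
      htend.eventually H'.eventually_solvesRegularAt,
      htend.eventually H.analyticAt.eventually_analyticAt,
      htend.eventually H'.analyticAt.eventually_analyticAt,
      continuous_snd.tendsto' (0 : ℂ × ℂ) 0 rfl |>.eventually hD2]
      with p ha h1 h2 hb hc h3
    obtain ⟨q, w⟩ := p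
    -- The singular equation is only given off `q = 0`. On `q = 0` the transport equation reduces to
    -- `-2w ∂_w D = 0`, which is `hD2`.
    by_cases hq : q = 0
    · subst hq
      simp only at h3 ⊢
      rw [h3]
      ring
    · refine (transport_of_solvesRegularAt ha).2.2 ((h2 ?_).sub hc hb (h1 ?_)) <;>
        simpa [unfoldCoord] using hq)
  have hinv : Tendsto (fun x : ℂ × ℂ => (x.1 - x.2 ^ 2, x.2)) (𝓝 0) (𝓝 0) :=
    Continuous.tendsto' (by fun_prop) _ _ (by simp)
  filter_upwards [hinv.eventually hzero'] with x hx
  simpa [unfoldCoord, hΔdef, sub_eq_zero] using hx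

/-! ### Construction of the amplitude -/

/-- `F` is the sum of the power series with coefficients `f` on the disc of radius `r`, and the
coefficients are `O(r ^ -i)`. -/
def TaylorOn (F : ℂ → ℂ) (f : ℕ → ℂ) (r : ℝ) : Prop :=
  (∃ C, ∀ i, ‖f i‖ * r ^ i ≤ C) ∧ ∀ z, ‖z‖ < r → ∑' i, f i * z ^ i = F z

theorem taylorOn_of_differentiableOn {F : ℂ → ℂ} {r R : ℝ} (hr : 0 < r) (hrR : r < R)
    (hF : DifferentiableOn ℂ F (Metric.ball 0 R)) :
    TaylorOn F (fun i => (i.factorial : ℂ)⁻¹ * iteratedDeriv i F 0) r := by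
  have hsum : ∀ z : ℂ, ‖z‖ < R →
      HasSum (fun i : ℕ => (i.factorial : ℂ)⁻¹ * iteratedDeriv i F 0 * z ^ i) (F z) :=
    fun z hz => by
      convert! Complex.hasSum_taylorSeries_on_ball hF (mem_ball_zero_iff.2 hz) using 2 with i
      simp only [sub_zero, smul_eq_mul]
      ring
  refine ⟨?_, fun z hz => (hsum z (hz.trans hrR)).tsum_eq⟩
  -- As `r < R`, the series converges at the point `r` itself, so its terms there are bounded.
  have h := (hsum r (by rwa [Complex.norm_real, Real.norm_of_nonneg hr.le])).summable
  obtain ⟨C, hC⟩ := h.tendsto_atTop_zero.norm.bddAbove_range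
  refine ⟨C, fun i => ?_⟩
  have := hC (mem_range_self i)
  simpa only [norm_mul, norm_pow, Complex.norm_real, Real.norm_of_nonneg hr.le] using this

theorem exists_taylorOn_of_analyticAt {F : ℂ → ℂ} (hF : AnalyticAt ℂ F 0) :
    ∃ R > 0, ∀ r, 0 < r → r < R →
      TaylorOn F (fun i => (i.factorial : ℂ)⁻¹ * iteratedDeriv i F 0) r := by
  obtain ⟨R, hR, hb⟩ := Metric.eventually_nhds_iff_ball.1 hF.eventually_analyticAt
  exact ⟨R, hR, fun r hr hrR => taylorOn_of_differentiableOn hr hrR fun x hx =>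
    (hb x hx).differentiableAt.differentiableWithinAt⟩

/-- The coefficients of `Ψ` in the coordinates `q = z - ẑ²` and `z`. -/
def ampCoeff (f h : ℕ → ℂ) : ℕ → ℕ → ℂ
  | 0 => fun m => if m = 0 then 1 else 0
  | 1 => h
  | n + 2 => fun m => (2 * n * (m + 1) * ampCoeff f h (n + 1) (m + 1)
      - (m + 2) * (m + 1) * ampCoeff f h n (m + 2)
      + ∑ ij ∈ Finset.HasAntidiagonal.antidiagonal m, f ij.1 * ampCoeff f h n ij.2)
        / ((n + 1) * (n + 2 + 4 * m))

/-- The coefficient of `qⁿ⁺² zᵐ` in the equation for `g`. Here `q² ∂_q²`, `4qz ∂_q ∂_z` and `-4z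
∂_z` give `(n+2)(n+1) + 4m(n+2) - 4m = (n+1)(n+2+4m)`, never zero, and `-2q² ∂_q ∂_z + 2q ∂_z` gives
`-2n(m+1)` in column `n + 1`. -/
theorem ampCoeff_add_two (f h : ℕ → ℂ) (n m : ℕ) :
    ((n : ℂ) + 1) * (n + 2 + 4 * m) * ampCoeff f h (n + 2) m
      = 2 * n * (m + 1) * ampCoeff f h (n + 1) (m + 1)
      - (m + 2) * (m + 1) * ampCoeff f h n (m + 2) + conv f (ampCoeff f h) n m := by
  have h1 : ((n : ℂ) + 1) ≠ 0 := by exact_mod_cast Nat.succ_ne_zero n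
  have h2 : ((n : ℂ) + 2 + 4 * m) ≠ 0 := by exact_mod_cast (by omega : n + 2 + 4 * m ≠ 0)
  rw [ampCoeff, mul_div_cancel₀ _ (mul_ne_zero h1 h2)]
  rfl

/-- A majorant of `ampCoeff` in the first variable. -/
def majorant (B H : ℝ) : ℕ → ℝ
  | 0 => 1
  | 1 => H
  | n + 2 => 2 * majorant B H (n + 1) + (1 + B / (n + 1)) * majorant B H n

theorem majorant_nonneg {B H : ℝ} (hB : 0 ≤ B) (hH : 0 ≤ H) : ∀ n, 0 ≤ majorant B H n
  | 0 => zero_le_one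
  | 1 => hH
  | n + 2 => by
    have h1 := majorant_nonneg hB hH n
    have h2 := majorant_nonneg hB hH (n + 1)
    rw [majorant]
    positivity

/-- Once `n ≥ B` the recursion is dominated by `2 K (n+1) + 2 K n`, and `2 * 4 + 2 ≤ 4 ^ 2`. The
constant is the sum of the finitely many earlier values. -/
theorem exists_majorant_le {B H : ℝ} (hB : 0 ≤ B) (hH : 0 ≤ H) :
    ∃ C, 0 ≤ C ∧ ∀ n, majorant B H n ≤ C * 4 ^ n := by
  have h0 := majorant_nonneg hB hH
  set N := ⌈B⌉₊
  refine ⟨∑ i ∈ Finset.range (N + 2), majorant B H i, Finset.sum_nonneg fun i _ => h0 i,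
    fun n => ?_⟩
  set C := ∑ i ∈ Finset.range (N + 2), majorant B H i with hC
  have hC0 : 0 ≤ C := Finset.sum_nonneg fun i _ => h0 i
  induction n using Nat.strong_induction_on with
  | _ n ih =>
    rcases lt_or_ge n (N + 2) with hn | hn
    · calc majorant B H n ≤ C :=
            Finset.single_le_sum (fun i _ => h0 i) (Finset.mem_range.2 hn)
        _ ≤ C * 4 ^ n := le_mul_of_one_le_right hC0 (one_le_pow₀ (by norm_num))
    · obtain ⟨k, rfl⟩ := Nat.exists_eq_add_of_le' (le_trans (Nat.le_add_left 2 N) hn)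
      have hk : B / (k + 1) ≤ 1 := by
        rw [div_le_one (by positivity)]
        have h1 : B ≤ N := Nat.le_ceil B
        have h2 : (N : ℝ) ≤ k := by exact_mod_cast (by omega : N ≤ k)
        linarith
      have i1 := ih (k + 1) (by omega)
      have i2 := ih k (by omega)
      have i3 := mul_le_mul_of_nonneg_right hk (h0 k)
      rw [majorant]
      rw [pow_succ] at i1 ⊢
      rw [pow_succ]
      nlinarith [pow_nonneg (show (0 : ℝ) ≤ 4 by norm_num) k,
        mul_nonneg hC0 (pow_nonneg (show (0 : ℝ) ≤ 4 by norm_num) k)]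

/-- The weight `(n + m).choose n` is adapted to the `z`-derivatives: passing to the weight of `(n+2,
m)` turns `m+1` into `n+2` and `(m+2)(m+1)` into `(n+1)(n+2)`, both absorbed by `(n+1)(n+2+4m)`. The
convolution with `f` has `m + 1 ≤ n+2+4m` terms and keeps a factor `1/(n+1)`. -/
theorem norm_ampCoeff_le {f h : ℕ → ℂ} {r M H : ℝ} (hr : 0 < r)
    (hf : ∀ i, ‖f i‖ * r ^ i ≤ M) (hh : ∀ i, ‖h i‖ * r ^ i ≤ H) : ∀ n m,
    ‖ampCoeff f h n m‖ * r ^ (n + m) ≤ majorant (M * r ^ 2) (H * r) n * (n + m).choose n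
  | 0, m => by
    by_cases hm : m = 0
    · simp [ampCoeff, majorant, hm]
    · simp [ampCoeff, majorant, hm]
  | 1, m => by
    have hH : 0 ≤ H := le_trans (by positivity) (hh 0)
    have h1 := mul_le_mul_of_nonneg_right (hh m) hr.le
    rw [ampCoeff, majorant, Nat.choose_one_right]
    calc ‖h m‖ * r ^ (1 + m) = ‖h m‖ * r ^ m * r := by ring
      _ ≤ H * r := h1
      _ ≤ H * r * ((1 + m : ℕ) : ℝ) := le_mul_of_one_le_right (by positivity) (by simp)
  | n + 2, m => by
    have hM : 0 ≤ M := le_trans (by positivity) (hf 0)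
    have hH : 0 ≤ H := le_trans (by positivity) (hh 0)
    have hK := majorant_nonneg (B := M * r ^ 2) (H := H * r) (by positivity) (by positivity)
    set K := majorant (M * r ^ 2) (H * r) with hKdef
    have a1 := norm_ampCoeff_le hr hf hh (n + 1) (m + 1)
    have a2 := norm_ampCoeff_le hr hf hh n (m + 2)
    have a3 : ∀ j, _ := fun j => norm_ampCoeff_le hr hf hh n j
    rw [← hKdef] at a1 a2
    simp only [← hKdef] at a3
    set P : ℝ := ((n + 2 + m).choose (n + 2) : ℝ) with hP
    have hP0 : 0 ≤ P := Nat.cast_nonneg _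
    have c1 : ((m : ℝ) + 1) * ((n + 2 + m).choose (n + 1) : ℝ) = (n + 2) * P := by
      have := Nat.choose_succ_right_eq (n + 2 + m) (n + 1)
      rw [show n + 2 + m - (n + 1) = m + 1 by omega] at this
      rw [hP]
      have h2 : ((n + 2 + m).choose (n + 2) : ℝ) * ((n : ℝ) + 2)
          = ((n + 2 + m).choose (n + 1) : ℝ) * ((m : ℝ) + 1) := by exact_mod_cast this
      linarith
    have c2 : ((m : ℝ) + 2) * (m + 1) * ((n + 2 + m).choose n : ℝ) = (n + 1) * (n + 2) * P := by
      have := Nat.choose_succ_right_eq (n + 2 + m) n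
      rw [show n + 2 + m - n = m + 2 by omega] at this
      have h2 : ((n + 2 + m).choose (n + 1) : ℝ) * ((n : ℝ) + 1)
          = ((n + 2 + m).choose n : ℝ) * ((m : ℝ) + 2) := by exact_mod_cast this
      linear_combination (-(m : ℝ) - 1) * h2 + ((n : ℝ) + 1) * c1
    have e1 : ‖ampCoeff f h (n + 1) (m + 1)‖ * r ^ (n + 2 + m)
        ≤ K (n + 1) * ((n + 2 + m).choose (n + 1) : ℝ) := by
      rw [show n + 2 + m = n + 1 + (m + 1) by ring]
      exact a1
    have e2 : ‖ampCoeff f h n (m + 2)‖ * r ^ (n + 2 + m)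
        ≤ K n * ((n + 2 + m).choose n : ℝ) := by
      rw [show n + 2 + m = n + (m + 2) by ring]
      exact a2
    have e3 : ‖conv f (ampCoeff f h) n m‖ * r ^ (n + 2 + m)
        ≤ (m + 1) * (M * r ^ 2 * K n * P) := by
      calc ‖conv f (ampCoeff f h) n m‖ * r ^ (n + 2 + m)
          ≤ (∑ ij ∈ Finset.HasAntidiagonal.antidiagonal m, ‖f ij.1 * ampCoeff f h n ij.2‖)
              * r ^ (n + 2 + m) := by
            gcongr
            exact norm_sum_le _ _
        _ = ∑ ij ∈ Finset.HasAntidiagonal.antidiagonal m,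
              (‖f ij.1‖ * r ^ ij.1) * (‖ampCoeff f h n ij.2‖ * r ^ (n + ij.2)) * r ^ 2 := by
            rw [Finset.sum_mul]
            refine Finset.sum_congr rfl fun ij hij => ?_
            rw [← Finset.HasAntidiagonal.mem_antidiagonal.1 hij, norm_mul]
            ring
        _ ≤ ∑ ij ∈ Finset.HasAntidiagonal.antidiagonal m, M * (K n * P) * r ^ 2 := by
            refine Finset.sum_le_sum fun ij hij => ?_
            refine mul_le_mul_of_nonneg_right (mul_le_mul (hf _) ?_ (by positivity) hM)
              (by positivity)
            · refine (a3 _).trans (mul_le_mul_of_nonneg_left ?_ (hK n))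
              have hj : ij.2 ≤ m := by
                have := Finset.HasAntidiagonal.mem_antidiagonal.1 hij
                omega
              have h1 : (n + ij.2).choose n ≤ (n + m).choose n :=
                Nat.choose_le_choose n (by omega)
              have h2 : (n + m).choose n = (n + m).choose m := Nat.choose_symm_add
              have h3 : (n + m).choose m ≤ (n + 2 + m).choose m :=
                Nat.choose_le_choose m (by omega)
              have h4 : (n + 2 + m).choose (n + 2) = (n + 2 + m).choose m := Nat.choose_symm_add
              rw [hP, Nat.cast_le, h4]
              omega
        _ = (m + 1) * (M * r ^ 2 * K n * P) := by
            rw [Finset.sum_const, Finset.Nat.card_antidiagonal, nsmul_eq_mul]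
            push_cast
            ring
    have hd : (0 : ℝ) < (n + 1) * (n + 2 + 4 * m) := by positivity
    have hnorm : ((n : ℝ) + 1) * (n + 2 + 4 * m) * ‖ampCoeff f h (n + 2) m‖
        ≤ 2 * n * (m + 1) * ‖ampCoeff f h (n + 1) (m + 1)‖
          + (m + 2) * (m + 1) * ‖ampCoeff f h n (m + 2)‖ + ‖conv f (ampCoeff f h) n m‖ := by
      have hc : ∀ k : ℕ, ‖(k : ℂ)‖ = k := Complex.norm_natCast
      have l1 : ‖((n : ℂ) + 1) * (n + 2 + 4 * m)‖ = ((n : ℝ) + 1) * (n + 2 + 4 * m) := by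
        exact_mod_cast hc ((n + 1) * (n + 2 + 4 * m))
      have l2 : ‖(2 : ℂ) * n * (m + 1)‖ = (2 : ℝ) * n * (m + 1) := by
        exact_mod_cast hc (2 * n * (m + 1))
      have l3 : ‖((m : ℂ) + 2) * (m + 1)‖ = ((m : ℝ) + 2) * (m + 1) := by
        exact_mod_cast hc ((m + 2) * (m + 1))
      rw [← l1, ← l2, ← l3, ← norm_mul, ← norm_mul, ← norm_mul, ampCoeff_add_two]
      exact (norm_add_le _ _).trans (add_le_add_left (norm_sub_le _ _) _)
    rw [← mul_le_mul_iff_right₀ hd]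
    have hbig : ((n : ℝ) + 1) * (n + 2 + 4 * m) * (‖ampCoeff f h (n + 2) m‖ * r ^ (n + 2 + m))
        ≤ 2 * n * (m + 1) * (K (n + 1) * ((n + 2 + m).choose (n + 1) : ℝ))
          + (m + 2) * (m + 1) * (K n * ((n + 2 + m).choose n : ℝ))
          + (m + 1) * (M * r ^ 2 * K n * P) := by
      have t1 := mul_le_mul_of_nonneg_left e1 (show (0 : ℝ) ≤ 2 * n * (m + 1) by positivity)
      have t2 := mul_le_mul_of_nonneg_left e2 (show (0 : ℝ) ≤ ((m : ℝ) + 2) * (m + 1) by positivity)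
      have t3 := mul_le_mul_of_nonneg_right hnorm (pow_nonneg hr.le (n + 2 + m))
      linarith
    refine hbig.trans ?_
    have hKn := hK n
    have hKn1 := hK (n + 1)
    have hnm : (n : ℝ) + 2 ≤ n + 2 + 4 * m := le_add_of_nonneg_right (by positivity)
    have s1 : 2 * (n : ℝ) * (m + 1) * (K (n + 1) * ((n + 2 + m).choose (n + 1) : ℝ))
        ≤ ((n : ℝ) + 1) * (n + 2 + 4 * m) * (2 * K (n + 1) * P) := by
      calc 2 * (n : ℝ) * (m + 1) * (K (n + 1) * ((n + 2 + m).choose (n + 1) : ℝ))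
          = (n * (n + 2)) * (2 * K (n + 1) * P) := by linear_combination 2 * n * K (n + 1) * c1
        _ ≤ _ := mul_le_mul_of_nonneg_right (mul_le_mul (by linarith) hnm (by positivity)
          (by positivity)) (by positivity)
    have s2 : ((m : ℝ) + 2) * (m + 1) * (K n * ((n + 2 + m).choose n : ℝ))
        ≤ ((n : ℝ) + 1) * (n + 2 + 4 * m) * (K n * P) := by
      calc ((m : ℝ) + 2) * (m + 1) * (K n * ((n + 2 + m).choose n : ℝ))
          = ((n + 1) * (n + 2)) * (K n * P) := by linear_combination K n * c2
        _ ≤ _ := mul_le_mul_of_nonneg_right (mul_le_mul_of_nonneg_left hnm (by positivity))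
          (by positivity)
    have s3 : ((m : ℝ) + 1) * (M * r ^ 2 * K n * P)
        ≤ ((n : ℝ) + 1) * (n + 2 + 4 * m) * (M * r ^ 2 / (n + 1) * K n * P) := by
      calc ((m : ℝ) + 1) * (M * r ^ 2 * K n * P) ≤ (n + 2 + 4 * m) * (M * r ^ 2 * K n * P) := by
            have h1 : (0 : ℝ) ≤ m := by positivity
            have h2 : (0 : ℝ) ≤ n := by positivity
            exact mul_le_mul_of_nonneg_right (by linarith) (by positivity)
        _ = _ := by field_simp
    have hKeq : K (n + 2) = 2 * K (n + 1) + (1 + M * r ^ 2 / (n + 1)) * K n := rfl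
    rw [hKeq]
    linarith

/-- The loss `8 = 4 * 2` comes from `4 ^ n` for the majorant and `2 ^ (n + m)` for the binomial
weight. It does not depend on `f` and `h`, which is what yields entire amplitudes. -/
theorem geomBound_ampCoeff {f h : ℕ → ℂ} {r M H : ℝ} (hr : 0 < r)
    (hf : ∀ i, ‖f i‖ * r ^ i ≤ M) (hh : ∀ i, ‖h i‖ * r ^ i ≤ H) :
    GeomBound (ampCoeff f h) (r / 8) := by
  have hM : 0 ≤ M := le_trans (by positivity) (hf 0)
  have hH : 0 ≤ H := le_trans (by positivity) (hh 0)
  obtain ⟨C, hC0, hC⟩ := exists_majorant_le (B := M * r ^ 2) (H := H * r) (by positivity)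
    (by positivity)
  refine ⟨C, fun n m => ?_⟩
  calc ‖ampCoeff f h n m‖ * (r / 8) ^ (n + m)
      = (‖ampCoeff f h n m‖ * r ^ (n + m)) * (1 / 8) ^ (n + m) := by
        rw [div_pow, div_pow, one_pow]
        ring
    _ ≤ (C * 4 ^ n * 2 ^ (n + m)) * (1 / 8) ^ (n + m) := by
        refine mul_le_mul_of_nonneg_right ((norm_ampCoeff_le hr hf hh n m).trans ?_)
          (by positivity)
        gcongr
        · exact hC n
        · exact_mod_cast Nat.choose_le_two_pow (n + m) n
    _ ≤ (C * 4 ^ (n + m) * 2 ^ (n + m)) * (1 / 8) ^ (n + m) := by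
        gcongr
        · norm_num
        · omega
    _ = C * (4 * 2 * (1 / 8)) ^ (n + m) := by
        rw [mul_pow, mul_pow]
        ring
    _ = C := by norm_num

/-- Columns `n + 2` are the recursion. Column `0` holds because `g(0,z)` is constant; in column `1`
the terms `4qz ∂_q ∂_z` and `-4z ∂_z` cancel, which is why `h` is arbitrary. -/
theorem airyCoeff_eq (f h : ℕ → ℂ) :
    X1 (X1 (E1 (E1 (ampCoeff f h)))) + ((4 : ℂ) • X1 (X2 (E1 (E2 (ampCoeff f h))))
      + ((-2 : ℂ) • X1 (X1 (E1 (E2 (ampCoeff f h)))) + (X1 (X1 (E2 (E2 (ampCoeff f h))))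
      + ((2 : ℂ) • X1 (E2 (ampCoeff f h)) + (-4 : ℂ) • X2 (E2 (ampCoeff f h))))))
    = X1 (X1 (conv f (ampCoeff f h))) := by
  funext n m
  match n, m with
  | 0, 0 => simp [X1, X2]
  | 0, m + 1 => simp [X1, X2, E2, ampCoeff]
  | 1, 0 => simp [X1, X2, E2, ampCoeff]
  | 1, m + 1 => simp [X1, X2, E1, E2, ampCoeff]
  | n + 2, 0 =>
    have := ampCoeff_add_two f h n 0
    simp only [Pi.add_apply, Pi.smul_apply, X1, X2, E1, E2, smul_eq_mul]
    push_cast at this ⊢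
    linear_combination this
  | n + 2, m + 1 =>
    have := ampCoeff_add_two f h n (m + 1)
    simp only [Pi.add_apply, Pi.smul_apply, X1, X2, E1, E2, smul_eq_mul]
    push_cast at this ⊢
    linear_combination this

theorem airy_DS {f h : ℕ → ℂ} {r C : ℝ} (hr : 0 < r) (ha : GeomBound (ampCoeff f h) r)
    (hf : ∀ i, ‖f i‖ * r ^ i ≤ C) {p : ℂ × ℂ} (hp : ‖p‖ < r / 4) :
    let g := DS (ampCoeff f h)
    p.1 ^ 2 * D1 (D1 g) p + (4 * p.1 * p.2 - 2 * p.1 ^ 2) * D1 (D2 g) p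
      + p.1 ^ 2 * D2 (D2 g) p + (2 * p.1 - 4 * p.2) * D2 g p
      = p.1 ^ 2 * ((∑' i, f i * p.2 ^ i) * g p) := by
  have h2 : 0 < r / 2 := by positivity
  have h4 : 0 < r / 4 := by positivity
  have h42 : r / 4 < r / 2 := by linarith
  have h21 : r / 2 < r := by linarith
  have b1 := ha.E1 h2.le h21
  have b2 := ha.E2 h2.le h21
  have b11 := b1.E1 h4.le h42
  have b12 := b2.E1 h4.le h42
  have b22 := b2.E2 h4.le h42
  have b2' := b2.mono h4.le h42.le
  have c1 := (b11.X1 h4).X1 h4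
  have c2 := ((b12.X2 h4).X1 h4).smul 4
  have c3 := ((b12.X1 h4).X1 h4).smul (-2)
  have c4 := (b22.X1 h4).X1 h4
  have c5 := (b2'.X1 h4).smul 2
  have c6 := (b2'.X2 h4).smul (-4)
  have d5 := c5.add h4.le c6
  have d4 := c4.add h4.le d5
  have d3 := c3.add h4.le d4
  have d2 := c2.add h4.le d3
  have hp2 : ‖p‖ < r / 2 := hp.trans h42
  have hp1 : ‖p‖ < r := hp2.trans h21
  have hev : ∀ᶠ x : ℂ × ℂ in 𝓝 p, ‖x‖ < r := continuous_norm.continuousAt.eventually_lt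
    continuousAt_const hp1
  have e1 : D1 (DS (ampCoeff f h)) =ᶠ[𝓝 p] DS (E1 (ampCoeff f h)) :=
    hev.mono fun x hx => D1_DS ha hx
  have e2 : D2 (DS (ampCoeff f h)) =ᶠ[𝓝 p] DS (E2 (ampCoeff f h)) :=
    hev.mono fun x hx => D2_DS ha hx
  have key := congr_arg (fun a => DS a p) (airyCoeff_eq f h)
  rw [DS_add c1 d2 hp, DS_add c2 d3 hp, DS_add c3 d4 hp, DS_add c4 d5 hp, DS_add c5 c6 hp] at key
  simp only [DS_smul, DS_X1, DS_X2] at key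
  rw [DS_conv ha hf hp1] at key
  intro g
  rw [D1_congr e1, D1_congr e2, D2_congr e2, e2.eq_of_nhds, D1_DS b1 hp2, D1_DS b2 hp2,
    D2_DS b2 hp2]
  linear_combination key

/-- The coordinates `(z - ẑ², z)`. -/
def foldCoord (x : ℂ × ℂ) : ℂ × ℂ := (x.1 - x.2 ^ 2, x.1)

theorem continuous_foldCoord : Continuous foldCoord := by
  unfold foldCoord
  fun_prop

theorem analyticAt_foldCoord (x : ℂ × ℂ) : AnalyticAt ℂ foldCoord x :=
  (analyticAt_fst.sub (analyticAt_snd.pow 2)).prod analyticAt_fst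

theorem D2_comp_foldCoord {g : ℂ × ℂ → ℂ} {x : ℂ × ℂ}
    (hg : DifferentiableAt ℂ g (foldCoord x)) :
    HasDerivAt (fun t => g (foldCoord (x.1, t))) (-(2 * x.2) * D1 g (foldCoord x)) x.2 := by
  have := hasDerivAt_comp_pair hg rfl (hasDerivAt_quad x.1 x.2) (hasDerivAt_const x.2 x.1)
  rw [zero_mul, add_zero] at this
  exact this

/-- For a function of `q` and `z`, the variable `ẑ` enters the equation only through `ẑ² = z - q`,
so its coefficients become polynomials in `q` and `z`. -/
theorem solvesRegularAt_comp_foldCoord {F : ℂ → ℂ} {g : ℂ × ℂ → ℂ} {p : ℂ × ℂ}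
    (hg : AnalyticAt ℂ g (foldCoord p))
    (h : (foldCoord p).1 ^ 2 * D1 (D1 g) (foldCoord p)
      + (4 * (foldCoord p).1 * (foldCoord p).2 - 2 * (foldCoord p).1 ^ 2)
        * D1 (D2 g) (foldCoord p)
      + (foldCoord p).1 ^ 2 * D2 (D2 g) (foldCoord p)
      + (2 * (foldCoord p).1 - 4 * (foldCoord p).2) * D2 g (foldCoord p)
      = (foldCoord p).1 ^ 2 * (F (foldCoord p).2 * g (foldCoord p))) :
    SolvesRegularAt F (g ∘ foldCoord) p := by
  have k1 : ∀ x : ℂ × ℂ, HasDerivAt (fun t => t - x.2 ^ 2) 1 x.1 := fun x =>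
    (hasDerivAt_id' _).sub_const _
  have c1 : ∀ {f : ℂ × ℂ → ℂ} {x : ℂ × ℂ}, DifferentiableAt ℂ f (foldCoord x) →
      HasDerivAt (fun t => f (foldCoord (t, x.2))) (D1 f (foldCoord x) + D2 f (foldCoord x)) x.1 :=
    fun {f x} hf => by
      have := hasDerivAt_comp_pair hf rfl (k1 x) (hasDerivAt_id' x.1)
      rw [one_mul, one_mul] at this
      exact this
  have hev : ∀ᶠ x in 𝓝 p, AnalyticAt ℂ g (foldCoord x) :=
    (continuous_foldCoord.tendsto p).eventually hg.eventually_analyticAt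
  have e1 : D1 (g ∘ foldCoord) =ᶠ[𝓝 p] fun x => D1 g (foldCoord x) + D2 g (foldCoord x) :=
    hev.mono fun x hx => (c1 hx.differentiableAt).deriv
  have e2 : D2 (g ∘ foldCoord) =ᶠ[𝓝 p] fun x => -(2 * x.2) * D1 g (foldCoord x) :=
    hev.mono fun x hx => (D2_comp_foldCoord hx.differentiableAt).deriv
  have dA := (analyticAt_D1 hg).differentiableAt
  have dB := (analyticAt_D2 hg).differentiableAt
  have e11 : D1 (D1 (g ∘ foldCoord)) p = (D1 (D1 g) (foldCoord p) + D2 (D1 g) (foldCoord p))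
      + (D1 (D2 g) (foldCoord p) + D2 (D2 g) (foldCoord p)) := by
    rw [D1_congr e1]
    exact ((c1 dA).add (c1 dB)).deriv
  have e12 : D1 (D2 (g ∘ foldCoord)) p
      = -(2 * p.2) * (D1 (D1 g) (foldCoord p) + D2 (D1 g) (foldCoord p)) := by
    rw [D1_congr e2]
    exact ((c1 dA).const_mul (-(2 * p.2))).deriv
  have e22 : D2 (D2 (g ∘ foldCoord)) p = -2 * D1 g (foldCoord p)
      + -(2 * p.2) * (-(2 * p.2) * D1 (D1 g) (foldCoord p)) := by
    rw [D2_congr e2]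
    refine ((((hasDerivAt_id' p.2).const_mul 2).neg).mul (D2_comp_foldCoord dA)).deriv.trans ?_
    simp
  unfold SolvesRegularAt
  rw [e11, e12, e22, e1.eq_of_nhds, e2.eq_of_nhds, D2_D1_eq hg]
  have hq : (foldCoord p).1 = p.1 - p.2 ^ 2 := rfl
  have hz : (foldCoord p).2 = p.1 := rfl
  rw [hq, hz] at h
  simp only [Function.comp_apply]
  linear_combination h

/-- The properties of an amplitude on the set `P`. -/
structure IsAmplitudeOn (F h : ℂ → ℂ) (Ψ : ℂ × ℂ → ℂ) (P : Set (ℂ × ℂ)) : Prop where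
  analyticAt : ∀ p ∈ P, AnalyticAt ℂ Ψ p
  eq_one : ∀ w, (w ^ 2, w) ∈ P → Ψ (w ^ 2, w) = 1
  deriv_eq : ∀ w, w ≠ 0 → (w ^ 2, w) ∈ P →
    -(1 / (2 * w)) * deriv (fun v => Ψ (w ^ 2, v)) w = h (w ^ 2)
  solves : ∀ p ∈ P, p.1 ≠ p.2 ^ 2 → SolvesSingularAt F (fun q => Ψ q / (q.1 - q.2 ^ 2)) p

/-- The series converges on radius `r / 8`; the two differentiations in the equation each halve the
radius, whence `r / 32`. -/
theorem isAmplitudeOn_of_taylorOn {F h : ℂ → ℂ} {f k : ℕ → ℂ} {r : ℝ} (hr : 0 < r)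
    (hF : TaylorOn F f r) (hh : TaylorOn h k r) :
    IsAmplitudeOn F h (DS (ampCoeff f k) ∘ foldCoord) {p | ‖foldCoord p‖ < r / 32} := by
  obtain ⟨⟨M, hM⟩, hFs⟩ := hF
  obtain ⟨⟨H, hH⟩, hhs⟩ := hh
  have hr8 : 0 < r / 8 := by positivity
  have ha := geomBound_ampCoeff hr hM hH
  have hlt : r / 32 < r / 8 := by linarith
  have hltr : r / 32 < r := by linarith
  have hana : ∀ p : ℂ × ℂ, ‖foldCoord p‖ < r / 32 →
      AnalyticAt ℂ (DS (ampCoeff f k)) (foldCoord p) := fun p hp => analyticAt_DS ha (hp.trans hlt)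
  have han : ∀ p : ℂ × ℂ, ‖foldCoord p‖ < r / 32 →
      AnalyticAt ℂ (DS (ampCoeff f k) ∘ foldCoord) p := fun p hp =>
    (hana p hp).comp (analyticAt_foldCoord p)
  have hsq : ∀ w : ℂ, foldCoord (w ^ 2, w) = (0, w ^ 2) := fun w => by simp [foldCoord]
  refine ⟨han, fun w hw => ?_, fun w hw0 hw => ?_, fun p hp hne => ?_⟩
  · rw [Function.comp_apply, hsq, DS_zero, tsum_eq_single 0 fun m hm => by simp [ampCoeff, hm]]
    simp [ampCoeff]
  · have hd := D2_comp_foldCoord (x := (w ^ 2, w)) (hana _ hw).differentiableAt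
    have hw' : ‖w ^ 2‖ < r / 32 := by
      have : ‖foldCoord (w ^ 2, w)‖ < r / 32 := hw
      rw [hsq] at this
      exact (norm_lt_iff_pair.1 this).2
    have h1 : D1 (DS (ampCoeff f k)) (foldCoord (w ^ 2, w)) = h (w ^ 2) := by
      rw [D1_DS ha (lt_trans hw hlt), hsq, DS_zero, ← hhs _ (hw'.trans hltr)]
      exact tsum_congr fun m => by simp [E1, ampCoeff]
    rw [h1] at hd
    refine (congr_arg (-(1 / (2 * w)) * ·) hd.deriv).trans ?_
    field_simp
  · rw [solvesSingularAt_div_iff (han p hp) hne]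
    refine solvesRegularAt_comp_foldCoord (hana p hp) ?_
    have hM8 : ∀ i, ‖f i‖ * (r / 8) ^ i ≤ M := fun i => le_trans (by gcongr; linarith) (hM i)
    have hz : ‖(foldCoord p).2‖ < r := (norm_snd_le _).trans_lt (lt_trans hp hltr)
    rw [← hFs _ hz]
    refine airy_DS hr8 ha hM8 (lt_of_lt_of_eq hp ?_)
    ring

theorem IsAmplitudeOn.isAmplitude {F h : ℂ → ℂ} {Ψ : ℂ × ℂ → ℂ} {P : Set (ℂ × ℂ)}
    (H : IsAmplitudeOn F h Ψ P) (hP : P ∈ 𝓝 0) : IsAmplitude F h Ψ := by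
  have hs : ∀ᶠ w in 𝓝 (0 : ℂ), (w ^ 2, w) ∈ P :=
    (Continuous.tendsto' (f := fun w : ℂ => (w ^ 2, w)) (by fun_prop) 0 0 (by simp)).eventually hP
  refine ⟨H.analyticAt 0 (mem_of_mem_nhds hP), hs.mono H.eq_one, ?_,
    Filter.mem_of_superset hP H.solves⟩
  filter_upwards [nhdsWithin_le_nhds hs, self_mem_nhdsWithin] with w hw hw0
  exact H.deriv_eq w hw0 hw

theorem exists_amplitude {F h : ℂ → ℂ} (hF : AnalyticAt ℂ F 0) (hh : AnalyticAt ℂ h 0) :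
    ∃ Ψ : ℂ × ℂ → ℂ, (∃ r > 0, IsAmplitudeOn F h Ψ {p | ‖foldCoord p‖ < r}) ∧
      (Differentiable ℂ F → Differentiable ℂ h → IsAmplitudeOn F h Ψ univ) := by
  refine ⟨DS (ampCoeff (fun i => (i.factorial : ℂ)⁻¹ * iteratedDeriv i F 0)
    fun i => (i.factorial : ℂ)⁻¹ * iteratedDeriv i h 0) ∘ foldCoord, ?_, fun hF' hh' => ?_⟩
  · obtain ⟨R, hR, hFR⟩ := exists_taylorOn_of_analyticAt hF
    obtain ⟨R', hR', hhR⟩ := exists_taylorOn_of_analyticAt hh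
    obtain ⟨r, hr, hrR⟩ := exists_between (lt_min hR hR')
    exact ⟨r / 32, by positivity, isAmplitudeOn_of_taylorOn hr
      (hFR r hr (hrR.trans_le (min_le_left _ _))) (hhR r hr (hrR.trans_le (min_le_right _ _)))⟩
  -- The coefficients do not involve the radius, so one and the same series is an amplitude on
  -- arbitrarily large sets.
  · have key : ∀ p : ℂ × ℂ, ∃ r > 0, p ∈ {p | ‖foldCoord p‖ < r / 32} ∧ IsAmplitudeOn F h
        (DS (ampCoeff (fun i => (i.factorial : ℂ)⁻¹ * iteratedDeriv i F 0)
          fun i => (i.factorial : ℂ)⁻¹ * iteratedDeriv i h 0) ∘ foldCoord)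
        {p | ‖foldCoord p‖ < r / 32} := fun p => by
      have hr : 0 < 32 * (‖foldCoord p‖ + 1) := by positivity
      refine ⟨_, hr, ?_, isAmplitudeOn_of_taylorOn hr
        (taylorOn_of_differentiableOn hr (lt_add_one _) hF'.differentiableOn)
        (taylorOn_of_differentiableOn hr (lt_add_one _) hh'.differentiableOn)⟩
      change ‖foldCoord p‖ < _
      linarith
    constructor
    · intro p _
      obtain ⟨r, -, hp, H⟩ := key p
      exact H.analyticAt p hp
    · intro w _
      obtain ⟨r, -, hp, H⟩ := key (w ^ 2, w)
      exact H.eq_one w hp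
    · intro w hw _
      obtain ⟨r, -, hp, H⟩ := key (w ^ 2, w)
      exact H.deriv_eq w hw hp
    · intro p _ hne
      obtain ⟨r, -, hp, H⟩ := key p
      exact H.solves p hp hne

/-! ### Continuation to the universal covering and singular support -/

/-- By uniqueness of path lifting, any lift with the right starting point computes the monodromy. -/
theorem monodromy_mk_val {E X : Type*} [TopologicalSpace E] [TopologicalSpace X] {p : E → X}
    (cov : IsCoveringMap p) {x y : X} (δ : Path x y) (e : p ⁻¹' {x}) (Γ : C(unitInterval, E))
    (h : ∀ t, p (Γ t) = δ t) (h0 : Γ 0 = e) :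
    (cov.monodromy (Path.Homotopic.Quotient.mk δ) e : E) = Γ 1 := by
  have : Γ = cov.liftPath δ e (δ.source.trans e.2.symm) :=
    (cov.eq_liftPath_iff' _).2 ⟨funext h, h0⟩
  rw [this]
  rfl

/-- Over an evenly covered neighbourhood each sheet is the image of a section. A single `N` serves
all points of the fibre, as regularity requires of all branches at once. -/
theorem exists_sections {y : ℂ × ℂ} (hy : y ∉ cuspCurve) :
    ∃ N, IsOpen N ∧ y ∈ N ∧ N ⊆ cuspCurveᶜ ∧ ∀ e, SMap e ∈ N →
      ∃ g : ℂ × ℂ → ℂ × ℂ, AnalyticOnNhd ℂ g N ∧ (∀ x ∈ N, SMap (g x) = x) ∧ g (SMap e) = e := by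
  obtain ⟨-, U, hyU, hU, -, H, hH⟩ := isCoveringMapOn_SMap y hy
  refine ⟨U ∩ cuspCurveᶜ, hU.inter isClosed_cuspCurve.isOpen_compl, ⟨hyU, hy⟩, inter_subset_right,
    fun e he => ?_⟩
  classical
  let i := (H ⟨e, he.1⟩).2
  let g : ℂ × ℂ → ℂ × ℂ := fun x => if hx : x ∈ U then (H.symm (⟨x, hx⟩, i) : ℂ × ℂ) else 0
  have hgU : ∀ x (hx : x ∈ U), g x = (H.symm (⟨x, hx⟩, i) : ℂ × ℂ) := fun x hx => dif_pos hx
  have hS : ∀ x ∈ U, SMap (g x) = x := fun x hx => by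
    rw [hgU x hx, ← hH, H.apply_symm_apply]
  have hcont : ContinuousOn g U := by
    rw [continuousOn_iff_continuous_domRestrict]
    have : U.domRestrict g = fun x : U => (H.symm (x, i) : ℂ × ℂ) := funext fun x => hgU x x.2
    rw [this]
    exact continuous_subtype_val.comp (H.symm.continuous.comp (by fun_prop))
  refine ⟨g, fun x hx => ?_, fun x hx => hS x hx.1, ?_⟩
  · refine analyticAt_of_section (hcont.continuousAt (hU.mem_nhds hx.1))
      (ne_sq_of_SMap_notMem ?_) (Filter.mem_of_superset (hU.mem_nhds hx.1) hS)
    rw [hS x hx.1]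
    exact hx.2
  · rw [hgU _ he.1]
    have : ((⟨SMap e, he.1⟩ : U), i) = H ⟨e, he.1⟩ := Prod.ext (Subtype.ext (hH ⟨e, he.1⟩).symm) rfl
    rw [this, H.symm_apply_apply]

variable {Ω : Set (ℂ × ℂ)}

theorem isCoveringMap_restrict (Ω : Set (ℂ × ℂ)) :
    IsCoveringMap ((Ω \ cuspCurve).restrictPreimage SMap) :=
  (isCoveringMapOn_SMap.mono fun _ h => h.2).isCoveringMap_restrictPreimage

/-- The quotient `Ψ / (z - ẑ²)`. -/
def quot (Ψ : ℂ × ℂ → ℂ) (p : ℂ × ℂ) : ℂ := Ψ p / (p.1 - p.2 ^ 2)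

/-- The continuation of a branch of `Ψ / (z - ẑ²)` to the universal covering. -/
def branch (Ψ : ℂ × ℂ → ℂ) {x₀ : (Ω \ cuspCurve : Set (ℂ × ℂ))}
    (e₀ : (Ω \ cuspCurve).restrictPreimage SMap ⁻¹' {x₀})
    (x : UniversalCover (Ω \ cuspCurve) x₀) : ℂ :=
  quot Ψ ((isCoveringMap_restrict Ω).monodromy x.2 e₀).1.1

theorem SMap_fiber {y : (Ω \ cuspCurve : Set (ℂ × ℂ))}
    (e : (Ω \ cuspCurve).restrictPreimage SMap ⁻¹' {y}) : SMap e.1.1 = y :=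
  congr_arg Subtype.val e.2

theorem monodromy_eq_section {x y : (Ω \ cuspCurve : Set (ℂ × ℂ))} (δ : Path x y)
    (e : (Ω \ cuspCurve).restrictPreimage SMap ⁻¹' {x}) {N : Set (ℂ × ℂ)} {g : ℂ × ℂ → ℂ × ℂ}
    (hg : ContinuousOn g N) (hS : ∀ x ∈ N, SMap (g x) = x) (hδ : ∀ t, (δ t : ℂ × ℂ) ∈ N)
    (he : g x = e.1.1) :
    ((isCoveringMap_restrict Ω).monodromy (Path.Homotopic.Quotient.mk δ) e).1.1 = g y := by
  have hmem : ∀ t, g (δ t) ∈ SMap ⁻¹' (Ω \ cuspCurve) := fun t => by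
    rw [mem_preimage, hS _ (hδ t)]
    exact (δ t).2
  let Γ : C(unitInterval, SMap ⁻¹' (Ω \ cuspCurve)) :=
    ⟨fun t => ⟨g (δ t), hmem t⟩,
      (hg.comp_continuous (continuous_subtype_val.comp δ.continuous) hδ).subtype_mk hmem⟩
  have h0 : Γ 0 = e := Subtype.ext
    ((congr_arg (fun y : (Ω \ cuspCurve : Set (ℂ × ℂ)) => g y) δ.source).trans he)
  have h1 := monodromy_mk_val (isCoveringMap_restrict Ω) δ e Γ
    (fun t => Subtype.ext (hS _ (hδ t))) h0
  exact (congr_arg Subtype.val h1).trans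
    (congr_arg (fun y : (Ω \ cuspCurve : Set (ℂ × ℂ)) => g y) δ.target)

variable {F h : ℂ → ℂ} {Ψ : ℂ × ℂ → ℂ}

theorem IsAmplitudeOn.analyticAt_quot_comp (H : IsAmplitudeOn F h Ψ (SMap ⁻¹' Ω))
    {g : ℂ × ℂ → ℂ × ℂ} {y : ℂ × ℂ} (hy : y ∈ Ω \ cuspCurve) (hg : AnalyticAt ℂ g y)
    (hS : SMap (g y) = y) : AnalyticAt ℂ (quot Ψ ∘ g) y := by
  have hq : (g y).1 ≠ (g y).2 ^ 2 := ne_sq_of_SMap_notMem (by rw [hS]; exact hy.2)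
  refine AnalyticAt.comp ?_ hg
  exact (H.analyticAt _ (by rw [mem_preimage, hS]; exact hy.1)).div
    (analyticAt_fst.sub (analyticAt_snd.pow 2)) (sub_ne_zero.2 hq)

/-- A local section is also a local left inverse: `g ∘ SMap` is the identity near `g y`. So `quot Ψ`
is the pullback of `quot Ψ ∘ g`, and the singular equation transfers. -/
theorem IsAmplitudeOn.solvesAt_quot_comp (H : IsAmplitudeOn F h Ψ (SMap ⁻¹' Ω))
    {g : ℂ × ℂ → ℂ × ℂ} {y : ℂ × ℂ} (hy : y ∈ Ω \ cuspCurve) (hg : AnalyticAt ℂ g y)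
    (hS : ∀ᶠ x in 𝓝 y, SMap (g x) = x) : SolvesAt F (quot Ψ ∘ g) y := by
  have hSy := hS.self_of_nhds
  have hq : (g y).1 ≠ (g y).2 ^ 2 := ne_sq_of_SMap_notMem (by rw [hSy]; exact hy.2)
  have ha := H.analyticAt_quot_comp hy hg hSy
  have htend : Tendsto SMap (𝓝 (g y)) (𝓝 y) := continuous_SMap.tendsto' _ _ hSy
  have hid : (fun x => g (SMap x)) =ᶠ[𝓝 (g y)] fun x => x := by
    refine eventuallyEq_of_section ?_ continuousAt_id ?_ (htend.eventually hS) ?_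
    · exact ContinuousAt.comp (f := SMap) (g := g) (by rw [hSy]; exact hg.continuousAt)
        continuous_SMap.continuousAt
    · rwa [hSy]
    · rw [hSy]
  have := (solvesAt_SMap_iff (F := F) (Φ := quot Ψ ∘ g) (Θ := quot Ψ) (p := g y)
    (by rwa [hSy]) hq (hid.mono fun x hx => by simp only [Function.comp_apply, hx])).2
    (H.solves _ (by rw [mem_preimage, hSy]; exact hy.1) hq)
  rwa [hSy] at this

theorem IsAmplitudeOn.hasGermAt_branch (H : IsAmplitudeOn F h Ψ (SMap ⁻¹' Ω))
    {x₀ : (Ω \ cuspCurve : Set (ℂ × ℂ))} (e₀ : (Ω \ cuspCurve).restrictPreimage SMap ⁻¹' {x₀})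
    (x : UniversalCover (Ω \ cuspCurve) x₀) {N : Set (ℂ × ℂ)} {g : ℂ × ℂ → ℂ × ℂ}
    (hN : N ∈ 𝓝 (x.1 : ℂ × ℂ)) (hg : AnalyticOnNhd ℂ g N) (hS : ∀ x ∈ N, SMap (g x) = x)
    (he : g x.1 = ((isCoveringMap_restrict Ω).monodromy x.2 e₀).1.1) :
    HasGermAt (branch Ψ e₀) x (quot Ψ ∘ g) := by
  refine ⟨H.analyticAt_quot_comp x.1.2 (hg _ (mem_of_mem_nhds hN)) (hS _ (mem_of_mem_nhds hN)),
    N, hN, fun y δ hδ => ?_⟩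
  change quot Ψ _ = quot Ψ _
  rw [IsCoveringMap.monodromy_trans_apply, monodromy_eq_section δ _ hg.continuousOn hS hδ he]

/-- Inside a ball contained in `D` and in both neighbourhoods, every point is reached by a path,
along which both functions equal `G`. Claims about arbitrary germs thus reduce to those given by
sections. -/
theorem HasGermAt.eventuallyEq {D : Set (ℂ × ℂ)} (hD : IsOpen D) {x₀ : D}
    {G : UniversalCover D x₀ → ℂ} {x : UniversalCover D x₀} {k k' : ℂ × ℂ → ℂ}
    (hk : HasGermAt G x k) (hk' : HasGermAt G x k') : k =ᶠ[𝓝 (x.1 : ℂ × ℂ)] k' := by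
  obtain ⟨-, N, hN, h⟩ := hk
  obtain ⟨-, N', hN', h'⟩ := hk'
  obtain ⟨ε, hε, hb⟩ := Metric.mem_nhds_iff.1
    (inter_mem (inter_mem hN hN') (hD.mem_nhds x.1.2))
  filter_upwards [Metric.ball_mem_nhds _ hε] with y hy
  have hxb := Metric.mem_ball_self (x := (x.1 : ℂ × ℂ)) hε
  have hpc := (convex_ball (x.1 : ℂ × ℂ) ε).isPathConnected ⟨_, hxb⟩
  obtain ⟨γ, hγ⟩ := hpc.joinedIn _ hxb _ hy
  let δ : Path x.1 ⟨y, (hb hy).2⟩ :=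
    { toFun := fun t => ⟨γ t, (hb (hγ t)).2⟩
      continuous_toFun := γ.continuous.subtype_mk _
      source' := Subtype.ext γ.source
      target' := Subtype.ext γ.target }
  exact (h _ δ fun t => (hb (hγ t)).1.1).symm.trans (h' _ δ fun t => (hb (hγ t)).1.2)

theorem exists_section_at {y : (Ω \ cuspCurve : Set (ℂ × ℂ))}
    (e : (Ω \ cuspCurve).restrictPreimage SMap ⁻¹' {y}) :
    ∃ N ∈ 𝓝 (y : ℂ × ℂ), ∃ g : ℂ × ℂ → ℂ × ℂ, AnalyticOnNhd ℂ g N ∧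
      (∀ x ∈ N, SMap (g x) = x) ∧ g y = e.1.1 := by
  obtain ⟨N, hNo, hyN, -, hN⟩ := exists_sections y.2.2
  obtain ⟨g, hg, hS, hge⟩ := hN e.1.1 (by rwa [SMap_fiber])
  rw [SMap_fiber] at hge
  exact ⟨N, hNo.mem_nhds hyN, g, hg, hS, hge⟩

theorem IsAmplitudeOn.isHolomorphic_branch (H : IsAmplitudeOn F h Ψ (SMap ⁻¹' Ω))
    {x₀ : (Ω \ cuspCurve : Set (ℂ × ℂ))} (e₀ : (Ω \ cuspCurve).restrictPreimage SMap ⁻¹' {x₀}) :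
    IsHolomorphic (branch Ψ e₀) := fun x => by
  obtain ⟨N, hN, g, hg, hS, hge⟩ := exists_section_at ((isCoveringMap_restrict Ω).monodromy x.2 e₀)
  exact ⟨_, H.hasGermAt_branch e₀ x hN hg hS hge⟩

theorem IsAmplitudeOn.solvesAt_branch (H : IsAmplitudeOn F h Ψ (SMap ⁻¹' Ω)) (hΩ : IsOpen Ω)
    {x₀ : (Ω \ cuspCurve : Set (ℂ × ℂ))} (e₀ : (Ω \ cuspCurve).restrictPreimage SMap ⁻¹' {x₀})
    (x : UniversalCover (Ω \ cuspCurve) x₀) (k : ℂ × ℂ → ℂ)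
    (hk : HasGermAt (branch Ψ e₀) x k) : SolvesAt F k x.1 := by
  obtain ⟨N, hN, g, hg, hS, hge⟩ := exists_section_at ((isCoveringMap_restrict Ω).monodromy x.2 e₀)
  exact (H.solvesAt_quot_comp x.1.2 (hg _ (mem_of_mem_nhds hN))
    (Filter.mem_of_superset hN hS)).congr
    ((H.hasGermAt_branch e₀ x hN hg hS hge).eventuallyEq (hΩ.sdiff isClosed_cuspCurve) hk)

theorem IsAmplitudeOn.isRegularAt_branch (H : IsAmplitudeOn F h Ψ (SMap ⁻¹' Ω)) (hΩ : IsOpen Ω)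
    {x₀ : (Ω \ cuspCurve : Set (ℂ × ℂ))} (e₀ : (Ω \ cuspCurve).restrictPreimage SMap ⁻¹' {x₀})
    {c : ℂ × ℂ} (hc : c ∈ Ω \ cuspCurve) : IsRegularAt (branch Ψ e₀) c := by
  obtain ⟨N, hNo, hcN, hNC, hN⟩ := exists_sections hc.2
  refine ⟨N ∩ Ω, (hNo.inter hΩ).mem_nhds ⟨hcN, hc.1⟩, fun x hx => ?_⟩
  obtain ⟨g, hg, hS, hge⟩ := hN ((isCoveringMap_restrict Ω).monodromy x.2 e₀).1.1
    (by rw [SMap_fiber]; exact hx.1)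
  rw [SMap_fiber] at hge
  exact ⟨quot Ψ ∘ g, fun y hy => H.analyticAt_quot_comp ⟨hy.2, hNC hy.1⟩ (hg y hy.1) (hS y hy.1),
    H.hasGermAt_branch e₀ x (hNo.mem_nhds hx.1) hg hS hge⟩

theorem exists_cusp_param {c : ℂ × ℂ} (hc : c ∈ cuspCurve) : ∃ s : ℂ, SMap (s ^ 2, s) = c := by
  obtain ⟨z, ξ⟩ := c
  have hc' : 9 * ξ ^ 2 = 4 * z ^ 3 := hc
  obtain ⟨s, hs⟩ := IsAlgClosed.exists_pow_nat_eq z two_pos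
  subst hs
  have : (ξ - 2 / 3 * s ^ 3) * (ξ + 2 / 3 * s ^ 3) = 0 := by linear_combination hc' / 9
  rcases mul_eq_zero.1 this with h | h
  · exact ⟨s, Prod.ext rfl (by simp only [SMap, S]; linear_combination -h)⟩
  · exact ⟨-s, Prod.ext (by simp [SMap]) (by simp only [SMap, S]; linear_combination -h)⟩

/-- Continue the branch to the sheet near `(s², s)`, where `Ψ/q` has a pole since `Ψ = 1` there. A
holomorphic extension `k` on a full neighbourhood of the point of the curve would contradict this by
the identity theorem. -/
theorem IsAmplitudeOn.not_isRegularAt_branch (H : IsAmplitudeOn F h Ψ (SMap ⁻¹' Ω))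
    (hΩ : IsOpen Ω) (hE : IsPathConnected (SMap ⁻¹' (Ω \ cuspCurve)))
    {x₀ : (Ω \ cuspCurve : Set (ℂ × ℂ))} (e₀ : (Ω \ cuspCurve).restrictPreimage SMap ⁻¹' {x₀})
    {c : ℂ × ℂ} (hc : c ∈ cuspCurve) (hcΩ : c ∈ Ω) : ¬ IsRegularAt (branch Ψ e₀) c := by
  rintro ⟨N, hN, hreg⟩
  obtain ⟨s, rfl⟩ := exists_cusp_param hc
  obtain ⟨ε, hε, hball⟩ := Metric.mem_nhds_iff.1 (continuous_SMap.continuousAt.preimage_mem_nhds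
    (inter_mem (interior_mem_nhds.2 hN) (hΩ.mem_nhds hcΩ)))
  obtain ⟨e₁, he₁b, he₁⟩ : ∃ e₁ ∈ Metric.ball (s ^ 2, s) ε, SMap e₁ ∉ cuspCurve := by
    have h1 : ∀ᶠ t in 𝓝[≠] (0 : ℂ), (s ^ 2 + t, s) ∈ Metric.ball (s ^ 2, s) ε :=
      nhdsWithin_le_nhds ((Continuous.tendsto' (f := fun t : ℂ => (s ^ 2 + t, s)) (by fun_prop)
        0 (s ^ 2, s) (by simp)).eventually (Metric.ball_mem_nhds _ hε))
    -- For the point `(s² + t, s)`, this value of `t` is the one with `4z = ẑ²`; the component `z =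
    -- ẑ²` is `t = 0`.
    have h2 : ∀ᶠ t in 𝓝[≠] (0 : ℂ), t ≠ -(3 / 4) * s ^ 2 := by
      by_cases hs : -(3 / 4) * s ^ 2 = 0
      · rw [hs]
        exact self_mem_nhdsWithin
      · exact nhdsWithin_le_nhds (continuousAt_id.eventually_ne (Ne.symm hs))
    obtain ⟨t, ht1, ht2, ht0⟩ := (h1.and (h2.and self_mem_nhdsWithin)).exists
    refine ⟨_, ht1, fun hmem => ?_⟩
    rcases SMap_mem_cuspCurve_iff.1 hmem with h | h
    · exact ht0 (by simpa using h)
    · exact ht2 (by linear_combination h / 4)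
  have he₁D : e₁ ∈ SMap ⁻¹' (Ω \ cuspCurve) := ⟨(hball he₁b).2, he₁⟩
  obtain ⟨Γ⟩ := (hE.joinedIn _ e₀.1.2 _ he₁D).joined_subtype
  -- A path upstairs from `e₀` to `e₁`, projected down: its class has monodromy taking `e₀` to `e₁`.
  let x : UniversalCover (Ω \ cuspCurve) x₀ := ⟨⟨SMap e₁, he₁D⟩, Path.Homotopic.Quotient.mk
    ((Γ.map (isCoveringMap_restrict Ω).continuous).cast e₀.2.symm rfl)⟩
  have hx : ((isCoveringMap_restrict Ω).monodromy x.2 e₀).1.1 = e₁ := by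
    rw [monodromy_mk_val _ _ e₀ Γ.toContinuousMap (fun t => rfl) Γ.source]
    exact congr_arg Subtype.val Γ.target
  obtain ⟨k, hk, hkG⟩ := hreg x (interior_subset (hball he₁b).1)
  obtain ⟨N', hN', g, hg, hS, hge⟩ :=
    exists_section_at ((isCoveringMap_restrict Ω).monodromy x.2 e₀)
  have hkg := hkG.eventuallyEq (hΩ.sdiff isClosed_cuspCurve)
    (H.hasGermAt_branch e₀ x hN' hg hS hge)
  rw [hx] at hge
  have hx1 : (x.1 : ℂ × ℂ) = SMap e₁ := rfl
  rw [hx1] at hkg hge hN'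
  have htend : Tendsto SMap (𝓝 e₁) (𝓝 (SMap e₁)) := continuous_SMap.tendsto _
  have hid : (fun p => g (SMap p)) =ᶠ[𝓝 e₁] fun p => p := by
    refine eventuallyEq_of_section ?_ continuousAt_id ?_
      ((htend.eventually hN').mono fun p hp => hS _ hp) hge
    · exact ContinuousAt.comp (f := SMap) (g := g)
        (hg _ (mem_of_mem_nhds hN')).continuousAt continuous_SMap.continuousAt
    · rw [hge]
      exact ne_sq_of_SMap_notMem he₁
  -- `T` vanishes near `e₁`, hence on the whole ball; at its centre `T = -Ψ = -1`.
  let T : ℂ × ℂ → ℂ := fun p => k (SMap p) * (p.1 - p.2 ^ 2) - Ψ p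
  have hT : AnalyticOnNhd ℂ T (Metric.ball (s ^ 2, s) ε) := fun p hp =>
    (((hk _ (interior_subset (hball hp).1)).comp (analyticAt_SMap p)).mul
      (analyticAt_fst.sub (analyticAt_snd.pow 2))).sub (H.analyticAt p (hball hp).2)
  have hne : ∀ᶠ p : ℂ × ℂ in 𝓝 e₁, p.1 - p.2 ^ 2 ≠ 0 :=
    ContinuousAt.eventually_ne (by fun_prop) (sub_ne_zero.2 (ne_sq_of_SMap_notMem he₁))
  have hT0 : T =ᶠ[𝓝 e₁] 0 := by
    filter_upwards [htend.eventually hkg, hid, hne] with p h1 h2 h3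
    simp only [T, h1, Function.comp_apply, h2, quot, Pi.zero_apply]
    rw [div_mul_cancel₀ _ h3, sub_self]
  have hT1 := hT.eqOn_zero_of_preconnected_of_eventuallyEq_zero
    (convex_ball _ ε).isPreconnected he₁b hT0 (Metric.mem_ball_self hε)
  simp [T, H.eq_one s hcΩ] at hT1

variable {M : Major} {ζ : ℂ × ℂ → ℂ}

theorem Major.IsDetermination.section (hζ : M.IsDetermination Ψ ζ) :
    ContinuousOn (fun p : ℂ × ℂ => (p.1, ζ p)) M.dom ∧
      (∀ p ∈ M.dom, SMap (p.1, ζ p) = p) ∧ ∀ p ∈ M.dom, M.fn p = quot Ψ (p.1, ζ p) :=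
  ⟨continuousOn_fst.prodMk hζ.continuousOn, fun p hp => Prod.ext rfl (hζ.S_eq p hp), hζ.fn_eq⟩

theorem Major.isOpen_dom (M : Major) : IsOpen M.dom := by
  obtain ⟨θ, -, -, h, -⟩ := M.sectorial
  exact h

theorem Major.nonempty_dom (M : Major) : M.dom.Nonempty := by
  obtain ⟨θ, -, -, -, h, -⟩ := M.sectorial
  exact h.nonempty

theorem IsAmplitudeOn.solvesAt_major (H : IsAmplitudeOn F h Ψ (SMap ⁻¹' Ω))
    (hM : M.dom ⊆ Ω \ cuspCurve) (hζ : M.IsDetermination Ψ ζ) {p : ℂ × ℂ} (hp : p ∈ M.dom) :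
    SolvesAt F M.fn p := by
  obtain ⟨hc, hS, hfn⟩ := hζ.section
  have hS' : ∀ᶠ x in 𝓝 p, SMap (x.1, ζ x) = x :=
    Filter.mem_of_superset (M.isOpen_dom.mem_nhds hp) hS
  refine (H.solvesAt_quot_comp (hM hp) (analyticAt_of_section
    (hc.continuousAt (M.isOpen_dom.mem_nhds hp)) (ne_sq_of_SMap_notMem ?_) hS') hS').congr ?_
  · rw [hS p hp]
    exact (hM hp).2
  · exact Filter.mem_of_superset (M.isOpen_dom.mem_nhds hp) fun x hx => (hfn x hx).symm

theorem IsAmplitudeOn.continuesAsSolution (H : IsAmplitudeOn F h Ψ (SMap ⁻¹' Ω))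
    (hΩ : IsOpen Ω) (hE : IsPathConnected (SMap ⁻¹' (Ω \ cuspCurve)))
    (hM : M.dom ⊆ Ω \ cuspCurve) (hζ : M.IsDetermination Ψ ζ) : M.ContinuesAsSolution F Ω := by
  intro x₀ hx₀
  obtain ⟨hc, hS, hfn⟩ := hζ.section
  let e₀ : (Ω \ cuspCurve).restrictPreimage SMap ⁻¹' {x₀} :=
    ⟨⟨(x₀.1.1, ζ x₀), by rw [mem_preimage, hS _ hx₀]; exact x₀.2⟩, Subtype.ext (hS _ hx₀)⟩
  refine ⟨branch Ψ e₀, ⟨hM, hx₀, H.isHolomorphic_branch e₀, fun y δ hδ => ?_⟩,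
    H.solvesAt_branch hΩ e₀, ?_⟩
  · have hy : (y : ℂ × ℂ) ∈ M.dom := by simpa using hδ 1
    rw [hfn y hy]
    exact congr_arg (quot Ψ) (monodromy_eq_section δ e₀ hc hS hδ rfl)
  · ext c
    refine ⟨fun hc => ⟨?_, hc.1⟩, fun hc => ⟨hc.2, H.not_isRegularAt_branch hΩ hE e₀ hc.1 hc.2⟩⟩
    by_contra hcC
    exact hc.2 (H.isRegularAt_branch hΩ e₀ ⟨hc.1, hcC⟩)

theorem Major.ContinuesAsSolution.extendsTo (hM : M.dom ⊆ Ω \ cuspCurve)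
    (h : M.ContinuesAsSolution F Ω) : M.ExtendsTo (Ω \ cuspCurve) := by
  obtain ⟨x, hx⟩ := M.nonempty_dom
  obtain ⟨G, hG, -⟩ := h ⟨x, hM hx⟩ hx
  exact ⟨_, G, hG⟩

/-! ### Endless continuability in `ξ` -/

/-- For fixed `z` the exceptional set consists of the roots of `9ξ² = 4z³` and does not depend on
`L`. A path avoiding it lifts through the covering, and sections along the lift provide the germs.
-/
theorem IsAmplitudeOn.isResurgent (H : IsAmplitudeOn F h Ψ univ)
    (hM : M.dom ⊆ univ \ cuspCurve) (hζ : M.IsDetermination Ψ ζ) : M.IsResurgent := by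
  refine .of_forall fun z ξ₀ hξ₀ L _ => ⟨{ξ | 9 * ξ ^ 2 = 4 * z ^ 3}, ?_, fun γ hγ0 _ hγ => ?_⟩
  · obtain ⟨s, hs⟩ := IsAlgClosed.exists_pow_nat_eq z two_pos
    refine (Set.toFinite {2 / 3 * s ^ 3, -(2 / 3) * s ^ 3}).subset fun ξ hξ => ?_
    subst hs
    have hξ' : 9 * ξ ^ 2 = 4 * (s ^ 2) ^ 3 := hξ
    have : (ξ - 2 / 3 * s ^ 3) * (ξ - -(2 / 3) * s ^ 3) = 0 := by linear_combination hξ' / 9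
    rcases mul_eq_zero.1 this with h | h
    · exact Or.inl (sub_eq_zero.1 h)
    · exact Or.inr (sub_eq_zero.1 h)
  have H' : IsAmplitudeOn F h Ψ (SMap ⁻¹' univ) := by rwa [preimage_univ]
  obtain ⟨hc, hS, hfn⟩ := hζ.section
  -- The avoidance hypothesis excludes `t = 0`, where membership in the domain of `M` is used
  -- instead.
  have hγD : ∀ t, (z, γ t) ∈ (univ \ cuspCurve : Set (ℂ × ℂ)) := fun t => by
    rcases eq_or_lt_of_le (unitInterval.nonneg' (t := t)) with h | h
    · rw [← h, hγ0]
      exact hM hξ₀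
    · exact ⟨mem_univ _, hγ t h⟩
  let γD : C(unitInterval, (univ \ cuspCurve : Set (ℂ × ℂ))) :=
    ⟨fun t => ⟨(z, γ t), hγD t⟩, by fun_prop⟩
  obtain ⟨Γ, hΓ, hΓ0⟩ := (isCoveringMap_restrict univ).exists_path_lifts γD
    ⟨(z, ζ (z, ξ₀)), by rw [mem_preimage, hS _ hξ₀]; exact hM hξ₀⟩
    (Subtype.ext (by
      change (z, γ 0) = SMap _
      rw [hS _ hξ₀, hγ0]))
  have hΓS : ∀ t, SMap (Γ t).1 = (z, γ t) := fun t => congr_arg Subtype.val (congr_fun hΓ t)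
  have hsec : ∀ t, ∃ N ∈ 𝓝 (z, γ t), ∃ g : ℂ × ℂ → ℂ × ℂ, AnalyticOnNhd ℂ g N ∧
      (∀ x ∈ N, SMap (g x) = x) ∧ g (z, γ t) = (Γ t).1 := fun t =>
    exists_section_at (y := ⟨(z, γ t), hγD t⟩) ⟨Γ t, Subtype.ext (hΓS t)⟩
  choose N hN g hg hgS hge using hsec
  have hslice : ∀ ξ : ℂ, Tendsto (fun x : ℂ => (z, x)) (𝓝 ξ) (𝓝 (z, ξ)) := fun ξ =>
    (by fun_prop : Continuous fun x : ℂ => (z, x)).tendsto ξ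
  have hΓq : ∀ t, (Γ t).1.1 ≠ (Γ t).1.2 ^ 2 := fun t =>
    ne_sq_of_SMap_notMem (by rw [hΓS]; exact (hγD t).2)
  refine ⟨fun t ξ => quot Ψ (g t (z, ξ)), fun t => ?_, ?_, fun t => ?_⟩
  · have h1 : AnalyticAt ℂ (quot Ψ ∘ g t) (z, γ t) := H'.analyticAt_quot_comp (hγD t)
      (hg t _ (mem_of_mem_nhds (hN t))) (hgS t _ (mem_of_mem_nhds (hN t)))
    exact h1.comp (f := fun ξ : ℂ => (z, ξ)) (analyticAt_const.prod analyticAt_id)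
  · have h0 : (z, γ 0) ∈ M.dom := by rwa [hγ0]
    have h1 : g 0 =ᶠ[𝓝 (z, γ 0)] fun p => (p.1, ζ p) := by
      refine eventuallyEq_of_section (hg 0 _ (mem_of_mem_nhds (hN 0))).continuousAt
        (hc.continuousAt (M.isOpen_dom.mem_nhds h0)) (by rw [hge]; exact hΓq 0) ?_ ?_
      · filter_upwards [hN 0, M.isOpen_dom.mem_nhds h0] with x hx hx'
        rw [hgS 0 x hx, hS x hx']
      · rw [hge, hΓ0, hγ0]
    filter_upwards [(hslice _).eventually h1,
      (hslice _).eventually (M.isOpen_dom.mem_nhds h0)] with ξ h2 h3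
    rw [h2, hfn _ h3]
  · have hγt : Tendsto (fun s => (z, γ s)) (𝓝 t) (𝓝 (z, γ t)) :=
      (by fun_prop : Continuous fun s => (z, γ s)).tendsto t
    have h1 : (fun s => g t (z, γ s)) =ᶠ[𝓝 t] fun s => (Γ s).1 := by
      refine eventuallyEq_of_section ?_ (by fun_prop) (by rw [hge]; exact hΓq t) ?_ (hge t)
      · exact ContinuousAt.comp (f := fun s => (z, γ s)) (g := g t)
          (hg t _ (mem_of_mem_nhds (hN t))).continuousAt hγt
      · filter_upwards [hγt.eventually (hN t)] with s hs
        rw [hgS t _ hs, hΓS]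
    filter_upwards [h1, hγt.eventually (eventually_mem_nhds_iff.2 (hN t))] with s h2 h3
    -- Both sections pass through the same point `Γ s` of the lift.
    have h4 : g s =ᶠ[𝓝 (z, γ s)] g t := by
      refine eventuallyEq_of_section (hg s _ (mem_of_mem_nhds (hN s))).continuousAt
        (hg t _ (mem_of_mem_nhds h3)).continuousAt (by rw [hge]; exact hΓq s) ?_ ?_
      · filter_upwards [hN s, h3] with x hx hx'
        rw [hgS s x hx, hgS t x hx']
      · rw [hge, h2]
    filter_upwards [(hslice _).eventually h4] with ξ h5
    rw [h5]

/-! ### Connectedness of the preimage of the complement -/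

/-- The complex line through `A` and `B` meets the preimage of the curve in finitely many
parameters, so the real segment can be bent within that line to the arc `s + iσ s(1-s)` with small
generic `σ`. -/
theorem joinedIn_ball_compl_cusp {A B : ℂ × ℂ} {η : ℝ} (hA : ‖A‖ < η) (hB : ‖B‖ < η)
    (hAc : SMap A ∉ cuspCurve) (hBc : SMap B ∉ cuspCurve) :
    JoinedIn {p | ‖p‖ < η ∧ SMap p ∉ cuspCurve} A B := by
  set μ := max ‖A‖ ‖B‖ with hμ
  have hμη : μ < η := max_lt hA hB
  -- A deviation below `ε ‖B - A‖ < η - μ` keeps the arc in the ball.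
  set ε := (η - μ) / (‖B - A‖ + 1) with hε
  have hε0 : 0 < ε := div_pos (sub_pos.2 hμη) (by positivity)
  have hεB : ε * ‖B - A‖ < η - μ := by
    rw [hε, div_mul_eq_mul_div, div_lt_iff₀ (by positivity)]
    nlinarith [sub_pos.2 hμη]
  let az : Polynomial ℂ := Polynomial.C A.1 + Polynomial.X * Polynomial.C (B.1 - A.1)
  let aw : Polynomial ℂ := Polynomial.C A.2 + Polynomial.X * Polynomial.C (B.2 - A.2)
  let P : Polynomial ℂ := (az - aw ^ 2) * (4 * az - aw ^ 2)
  have hP : ∀ t : ℂ, P.eval t = 0 ↔ SMap (A + t • (B - A)) ∈ cuspCurve := fun t => by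
    rw [SMap_mem_cuspCurve_iff]
    simp [P, az, aw, sub_eq_zero]
  have hP0 : P ≠ 0 := fun h0 => hAc (by
    have := (hP 0).1 (by rw [h0, Polynomial.eval_zero])
    simpa using this)
  -- A root of `P` whose real part is neither `0` nor `1` lies on the arc for a single value of `σ`,
  -- namely the listed quotient.
  obtain ⟨σ, hσ, hσb⟩ := (Ioo_infinite hε0).exists_notMem_finset
    (P.roots.toFinset.image fun t : ℂ => t.im / (t.re * (1 - t.re)))
  let τ : ℝ → ℂ := fun s => ⟨s, σ * (s * (1 - s))⟩
  have hτ : Continuous τ := by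
    have : τ = fun s : ℝ => (s : ℂ) + ((σ * (s * (1 - s)) : ℝ) : ℂ) * Complex.I := by
      funext s
      apply Complex.ext <;> simp [τ]
    rw [this]
    fun_prop
  let f : ℝ → ℂ × ℂ := fun s => A + τ s • (B - A)
  have hf : Continuous f := continuous_const.add (hτ.smul continuous_const)
  have h0 : f 0 = A := by
    have : τ 0 = 0 := Complex.ext rfl (by simp [τ])
    simp [f, this]
  have h1 : f 1 = B := by
    have : τ 1 = 1 := Complex.ext rfl (by simp [τ])
    simp [f, this]
  have hpc := ((convex_Icc (0 : ℝ) 1).isPathConnected ⟨0, by simp⟩).image hf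
  have hj := hpc.joinedIn (f 0) ⟨0, by simp, rfl⟩ (f 1) ⟨1, by simp, rfl⟩
  rw [h0, h1] at hj
  refine hj.mono ?_
  rintro _ ⟨s, hs, rfl⟩
  constructor
  · have hs1 : 0 ≤ 1 - s := sub_nonneg.2 hs.2
    have e : f s = ((1 - s) • A + s • B) + ((σ * (s * (1 - s)) : ℝ) * Complex.I) • (B - A) := by
      have : τ s = (s : ℂ) + ((σ * (s * (1 - s)) : ℝ) : ℂ) * Complex.I := by
        apply Complex.ext <;> simp [τ]
      simp only [f, this]
      ext <;> simp <;> ring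
    change ‖f s‖ < η
    rw [e]
    have b1 : ‖(1 - s) • A + s • B‖ ≤ μ := by
      refine (norm_add_le _ _).trans ?_
      rw [norm_smul, norm_smul, Real.norm_of_nonneg hs1, Real.norm_of_nonneg hs.1]
      calc (1 - s) * ‖A‖ + s * ‖B‖ ≤ (1 - s) * μ + s * μ :=
            add_le_add (mul_le_mul_of_nonneg_left (le_max_left _ _) hs1)
              (mul_le_mul_of_nonneg_left (le_max_right _ _) hs.1)
        _ = μ := by ring
    have b2 : ‖((σ * (s * (1 - s)) : ℝ) * Complex.I) • (B - A)‖ ≤ ε * ‖B - A‖ := by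
      rw [norm_smul, norm_mul, Complex.norm_I, mul_one, Complex.norm_real,
        Real.norm_of_nonneg (mul_nonneg hσ.1.le (mul_nonneg hs.1 hs1))]
      refine mul_le_mul_of_nonneg_right ?_ (norm_nonneg _)
      have : s * (1 - s) ≤ 1 := by nlinarith [hs.1, hs.2]
      calc σ * (s * (1 - s)) ≤ σ * 1 := mul_le_mul_of_nonneg_left this hσ.1.le
        _ ≤ ε := by rw [mul_one]; exact hσ.2.le
    linarith [norm_add_le ((1 - s) • A + s • B) (((σ * (s * (1 - s)) : ℝ) * Complex.I) • (B - A))]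
  · intro hmem
    rcases eq_or_lt_of_le hs.1 with h | h
    · rw [← h, h0] at hmem
      exact hAc hmem
    rcases eq_or_lt_of_le hs.2 with h' | h'
    · rw [h', h1] at hmem
      exact hBc hmem
    refine hσb (Finset.mem_image.2 ⟨τ s, ?_, ?_⟩)
    · rw [Multiset.mem_toFinset, Polynomial.mem_roots hP0]
      exact (hP _).2 hmem
    · have : s * (1 - s) ≠ 0 := (mul_pos h (sub_pos.2 h')).ne'
      simp only [τ]
      field_simp

/-- With weights `2, 1, 3` for `z, ẑ, ξ`, scaling commutes with `SMap` and preserves both components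
over the curve. It moves any point into a small ball, where bent segments join points. -/
theorem isPathConnected_preimage_SMap {Ω : Set (ℂ × ℂ)} (hΩ : Ω ∈ 𝓝 0)
    (hscale : ∀ t : ℝ, 0 < t → t ≤ 1 → ∀ p ∈ Ω, ((t : ℂ) ^ 2 * p.1, (t : ℂ) ^ 3 * p.2) ∈ Ω) :
    IsPathConnected (SMap ⁻¹' (Ω \ cuspCurve)) := by
  have hS0 : SMap 0 = 0 := by simp [SMap, S]
  obtain ⟨η, hη, hball⟩ := Metric.mem_nhds_iff.1
    ((continuous_SMap.tendsto' 0 0 hS0).eventually hΩ)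
  let sc : ℂ × ℂ → ℝ → ℂ × ℂ := fun p t => ((t : ℂ) ^ 2 * p.1, (t : ℂ) * p.2)
  have hsc : ∀ p, Continuous (sc p) := fun p => by
    simp only [sc]
    fun_prop
  have hsc1 : ∀ p, sc p 1 = p := fun p => by simp [sc]
  have hscE : ∀ p ∈ SMap ⁻¹' (Ω \ cuspCurve), ∀ t, 0 < t → t ≤ 1 →
      sc p t ∈ SMap ⁻¹' (Ω \ cuspCurve) := fun p hp t ht0 ht1 => by
    have ht : (t : ℂ) ≠ 0 := by exact_mod_cast ht0.ne'
    constructor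
    · have := hscale t ht0 ht1 _ hp.1
      convert this using 1
      simp only [SMap, S, sc]
      ext
      · rfl
      · simp only
        ring
    · intro hmem
      refine hp.2 (SMap_mem_cuspCurve_iff.2 ?_)
      rcases SMap_mem_cuspCurve_iff.1 hmem with h | h
      · refine Or.inl (mul_left_cancel₀ (pow_ne_zero 2 ht) ?_)
        simp only [sc] at h
        linear_combination h
      · refine Or.inr (mul_left_cancel₀ (pow_ne_zero 2 ht) ?_)
        simp only [sc] at h
        linear_combination h
  have hsmall : ∀ p ∈ SMap ⁻¹' (Ω \ cuspCurve), ∃ q, ‖q‖ < η ∧ SMap q ∉ cuspCurve ∧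
      JoinedIn (SMap ⁻¹' (Ω \ cuspCurve)) p q := fun p hp => by
    have h1 : ∀ᶠ t in 𝓝[>] (0 : ℝ), sc p t ∈ Metric.ball 0 η :=
      nhdsWithin_le_nhds (((hsc p).tendsto' 0 0 (by simp [sc])).eventually
        (Metric.ball_mem_nhds _ hη))
    obtain ⟨t, ht, ht0, ht1⟩ := (h1.and (Ioo_mem_nhdsGT (zero_lt_one (α := ℝ)))).exists
    refine ⟨sc p t, mem_ball_zero_iff.1 ht, (hscE p hp t ht0 ht1.le).2, ?_⟩
    have hpc := ((convex_Icc t 1).isPathConnected ⟨1, ht1.le, le_rfl⟩).image (hsc p)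
    have hj := hpc.joinedIn (sc p 1) ⟨1, ⟨ht1.le, le_rfl⟩, rfl⟩ (sc p t) ⟨t, ⟨le_rfl, ht1.le⟩, rfl⟩
    rw [hsc1] at hj
    refine hj.mono ?_
    rintro _ ⟨u, hu, rfl⟩
    exact hscE p hp u (ht0.trans_le hu.1) hu.2
  rw [isPathConnected_iff]
  constructor
  · have h1 : ∀ᶠ t : ℝ in 𝓝[>] (0 : ℝ), ((t : ℂ), (0 : ℂ)) ∈ Metric.ball (0 : ℂ × ℂ) η :=
      nhdsWithin_le_nhds ((Continuous.tendsto' (f := fun t : ℝ => ((t : ℂ), (0 : ℂ)))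
        (by fun_prop) 0 0 (by simp)).eventually (Metric.ball_mem_nhds _ hη))
    obtain ⟨t, ht, ht0⟩ := (h1.and self_mem_nhdsWithin).exists
    have ht0' : (t : ℂ) ≠ 0 := by exact_mod_cast (mem_Ioi.1 ht0).ne'
    refine ⟨_, hball ht, fun hmem => ?_⟩
    rcases SMap_mem_cuspCurve_iff.1 hmem with h | h
    · exact ht0' (by simpa using h)
    · exact ht0' (by simpa using h)
  · intro p hp q hq
    obtain ⟨p', hp', hpc, hpj⟩ := hsmall p hp
    obtain ⟨q', hq', hqc, hqj⟩ := hsmall q hq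
    refine hpj.trans (((joinedIn_ball_compl_cusp hp' hq' hpc hqc).mono ?_).trans hqj.symm)
    exact fun x hx => ⟨hball (mem_ball_zero_iff.2 hx.1), hx.2⟩

/-! ### Determinations on sectorial neighbourhoods -/

/-- The uniformization `(s, τ) ↦ (τ e^{2s/3}, - e^s)` of a sectorial neighbourhood. -/
def sectorMap (p : ℂ × ℂ) : ℂ × ℂ := (p.2 * Complex.exp (2 / 3 * p.1), -Complex.exp p.1)

/-- The inverse of `sectorMap`. -/
def sectorInv (p : ℂ × ℂ) : ℂ × ℂ :=
  (Complex.log (-p.2), p.1 * Complex.exp (-(2 / 3 * Complex.log (-p.2))))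

/-- The convex domain of `sectorMap`. -/
def strip (ρ θ : ℝ) : Set (ℂ × ℂ) := (Iio ρ ×ℂ Ioo (-θ) θ) ×ˢ Metric.ball 0 1

/-- A sectorial neighbourhood, on which `|z|³ < |ξ|²`. -/
def sectorNhd (ρ θ : ℝ) : Set (ℂ × ℂ) :=
  {p | -p.2 ∈ Complex.slitPlane} ∩ sectorInv ⁻¹' strip ρ θ

theorem convex_strip (ρ θ : ℝ) : Convex ℝ (strip ρ θ) :=
  (((convex_Iio ρ).linear_preimage Complex.reLm).inter
    ((convex_Ioo (-θ) θ).linear_preimage Complex.imLm)).prod (convex_ball 0 1)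

theorem isOpen_strip (ρ θ : ℝ) : IsOpen (strip ρ θ) :=
  (isOpen_Iio.reProdIm isOpen_Ioo).prod Metric.isOpen_ball

theorem mem_strip {ρ θ : ℝ} {p : ℂ × ℂ} :
    p ∈ strip ρ θ ↔ (p.1.re < ρ ∧ |p.1.im| < θ) ∧ ‖p.2‖ < 1 := by
  rw [strip, mem_prod, Complex.mem_reProdIm, mem_ball_zero_iff, abs_lt]
  rfl

theorem continuous_sectorMap : Continuous sectorMap := by
  unfold sectorMap
  fun_prop

theorem sectorMap_sectorInv {p : ℂ × ℂ} (hp : -p.2 ≠ 0) : sectorMap (sectorInv p) = p := by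
  unfold sectorMap sectorInv
  ext
  · simp only
    rw [mul_assoc, ← Complex.exp_add, neg_add_cancel, Complex.exp_zero, mul_one]
  · simp only
    rw [Complex.exp_log hp, neg_neg]

theorem sectorInv_sectorMap {ρ θ : ℝ} (hθ : θ ≤ Real.pi) {p : ℂ × ℂ} (hp : p ∈ strip ρ θ) :
    sectorInv (sectorMap p) = p ∧ sectorMap p ∈ sectorNhd ρ θ := by
  have h := mem_strip.1 hp
  have him := abs_lt.1 (h.1.2.trans_le hθ)
  have hlog : Complex.log (Complex.exp p.1) = p.1 := Complex.log_exp him.1 him.2.le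
  have e : sectorInv (sectorMap p) = p := by
    unfold sectorMap sectorInv
    ext
    · simp only [neg_neg, hlog]
    · simp only [neg_neg, hlog]
      rw [mul_assoc, ← Complex.exp_add, add_neg_cancel, Complex.exp_zero, mul_one]
  refine ⟨e, ?_, ?_⟩
  · change - -Complex.exp p.1 ∈ Complex.slitPlane
    rw [neg_neg, Complex.mem_slitPlane_iff_arg]
    refine ⟨?_, Complex.exp_ne_zero _⟩
    rw [← Complex.log_im, hlog]
    exact him.2.ne
  · rwa [mem_preimage, e]

theorem continuousOn_sectorInv :
    ContinuousOn sectorInv {p : ℂ × ℂ | -p.2 ∈ Complex.slitPlane} := by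
  have hlog : ContinuousOn (fun p : ℂ × ℂ => Complex.log (-p.2))
      {p : ℂ × ℂ | -p.2 ∈ Complex.slitPlane} :=
    ContinuousOn.clog (by fun_prop) fun p hp => hp
  exact hlog.prodMk (continuousOn_fst.mul (hlog.const_mul _).neg.cexp)

theorem isOpen_sectorNhd (ρ θ : ℝ) : IsOpen (sectorNhd ρ θ) :=
  continuousOn_sectorInv.isOpen_inter_preimage
    (Complex.isOpen_slitPlane.preimage (by fun_prop)) (isOpen_strip ρ θ)

theorem sectorMap_sectorInv_of_mem {ρ θ : ℝ} {p : ℂ × ℂ} (hp : p ∈ sectorNhd ρ θ) :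
    sectorMap (sectorInv p) = p :=
  sectorMap_sectorInv (Complex.slitPlane_ne_zero hp.1)

theorem isSectorialNhdOfAngle_sectorNhd {ρ θ : ℝ} (hθ0 : 0 < θ) (hθ : θ ≤ Real.pi) :
    IsSectorialNhdOfAngle θ (sectorNhd ρ θ) := by
  refine ⟨isOpen_sectorNhd ρ θ, ?_, Real.exp ρ, Real.exp_pos ρ, ?_⟩
  · have hne : (strip ρ θ).Nonempty :=
      ⟨(((ρ - 1 : ℝ) : ℂ), 0), mem_strip.2 ⟨⟨by simp, by simpa using hθ0⟩, by simp⟩⟩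
    have : sectorNhd ρ θ = sectorMap '' strip ρ θ := by
      ext p
      refine ⟨fun hp => ⟨_, hp.2, sectorMap_sectorInv_of_mem hp⟩, ?_⟩
      rintro ⟨q, hq, rfl⟩
      exact (sectorInv_sectorMap hθ hq).2
    rw [this]
    exact (((convex_strip ρ θ).isPathConnected hne).image continuous_sectorMap).isConnected
  · ext ξ
    have h1 : (0, ξ) ∈ sectorNhd ρ θ ↔ -ξ ∈ Complex.slitPlane ∧
        Real.log ‖ξ‖ < ρ ∧ |(-ξ).arg| < θ := by
      simp [sectorNhd, mem_strip, sectorInv, Complex.log_re, Complex.log_im]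
    change (0, ξ) ∈ sectorNhd ρ θ ↔ _
    rw [h1]
    constructor
    · rintro ⟨h2, h3, h4⟩
      have hpos : 0 < ‖ξ‖ := norm_pos_iff.2 (neg_ne_zero.1 (Complex.slitPlane_ne_zero h2))
      exact ⟨hpos, (Real.log_lt_iff_lt_exp hpos).1 h3, h4⟩
    · rintro ⟨h2, h3, h4⟩
      refine ⟨Complex.mem_slitPlane_iff_arg.2 ⟨fun h => ?_, neg_ne_zero.2 (norm_pos_iff.1 h2)⟩,
        (Real.log_lt_iff_lt_exp h2).2 h3, h4⟩
      rw [h, abs_of_pos Real.pi_pos] at h4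
      exact absurd hθ (not_le.2 h4)

/-- In these coordinates the curve reads `9 = 4τ³`, which is impossible for `|τ| < 1`. -/
theorem sectorMap_notMem_cuspCurve {ρ θ : ℝ} {p : ℂ × ℂ} (hp : p ∈ strip ρ θ) :
    sectorMap p ∉ cuspCurve := fun hmem => by
  have h : 9 * (-Complex.exp p.1) ^ 2 = 4 * (p.2 * Complex.exp (2 / 3 * p.1)) ^ 3 := hmem
  have e3 : Complex.exp (2 / 3 * p.1) ^ 3 = Complex.exp p.1 ^ 2 := by
    rw [← Complex.exp_nat_mul, ← Complex.exp_nat_mul]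
    congr 1
    push_cast
    ring
  rw [neg_sq, mul_pow, e3, ← mul_assoc] at h
  have h2 : (9 : ℂ) = 4 * p.2 ^ 3 := mul_right_cancel₀ (pow_ne_zero 2 (Complex.exp_ne_zero _)) h
  have h3 := congr_arg norm h2
  rw [norm_mul, norm_pow, Complex.norm_ofNat, Complex.norm_ofNat] at h3
  have h4 : ‖p.2‖ ^ 3 ≤ 1 := pow_le_one₀ (norm_nonneg _) (mem_strip.1 hp).2.le
  linarith

theorem exists_sectorMap_mem {Ω : Set (ℂ × ℂ)} (hΩ : Ω ∈ 𝓝 0) :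
    ∃ ρ : ℝ, ∀ θ, ∀ p ∈ strip ρ θ, sectorMap p ∈ Ω := by
  obtain ⟨η, hη, hb⟩ := Metric.mem_nhds_iff.1 hΩ
  -- The two bounds on `Re s` ensure `e^{Re s} < η` for `ξ` and `e^{2 Re s / 3} < η` for `z`.
  refine ⟨min (Real.log η) (3 / 2 * Real.log η), fun θ p hp => hb ?_⟩
  have h := mem_strip.1 hp
  have h1 := lt_min_iff.1 h.1.1
  rw [mem_ball_zero_iff, norm_lt_iff_pair]
  constructor
  · change ‖p.2 * Complex.exp (2 / 3 * p.1)‖ < η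
    have hre : (2 / 3 * p.1).re = 2 / 3 * p.1.re := by
      have : (2 / 3 : ℂ) = ((2 / 3 : ℝ) : ℂ) := by norm_num
      rw [this, Complex.re_ofReal_mul]
    rw [norm_mul, Complex.norm_exp, hre]
    have h2 : Real.exp (2 / 3 * p.1.re) < η := by
      rw [← Real.lt_log_iff_exp_lt hη]
      linarith [h1.2]
    calc ‖p.2‖ * Real.exp (2 / 3 * p.1.re) ≤ 1 * Real.exp (2 / 3 * p.1.re) :=
          mul_le_mul_of_nonneg_right h.2.le (Real.exp_pos _).le
      _ < η := by rwa [one_mul]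
  · change ‖-Complex.exp p.1‖ < η
    rw [norm_neg, Complex.norm_exp, ← Real.lt_log_iff_exp_lt hη]
    exact h1.1

/-- The strip is convex, so `sectorMap` lifts through the covering from any prescribed point of a
fibre. Composing the lift with `sectorInv` gives the section, and its second component is `ζ`. -/
theorem IsAmplitudeOn.hasDeterminations {F h : ℂ → ℂ} {Ψ : ℂ × ℂ → ℂ} {Ω : Set (ℂ × ℂ)}
    (H : IsAmplitudeOn F h Ψ (SMap ⁻¹' Ω)) (hΩ : Ω ∈ 𝓝 0) : HasDeterminations Ψ Ω := by
  intro θ hθ1 hθ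
  have hθ0 : 0 < θ := lt_trans (by positivity) hθ1
  obtain ⟨ρ, hρ⟩ := exists_sectorMap_mem hΩ
  have hsec := isSectorialNhdOfAngle_sectorNhd (ρ := ρ) hθ0 hθ
  have hsub : sectorNhd ρ θ ⊆ Ω \ cuspCurve := fun p hp => by
    rw [← sectorMap_sectorInv_of_mem hp]
    exact ⟨hρ θ _ hp.2, sectorMap_notMem_cuspCurve hp.2⟩
  refine ⟨sectorNhd ρ θ, hsec, hsub, fun z w hzw => ?_⟩
  have hne : (strip ρ θ).Nonempty := ⟨_, hzw.2⟩
  have : ContractibleSpace (strip ρ θ) := (convex_strip ρ θ).contractibleSpace hne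
  have : LocallyPathConnectedSpace (strip ρ θ) := (isOpen_strip ρ θ).locallyPathConnectedSpace
  let f : C(strip ρ θ, ℂ × ℂ) := ⟨fun p => sectorMap p, continuous_sectorMap.comp
    continuous_subtype_val⟩
  obtain ⟨L, ⟨hL0, hL⟩, -⟩ := isCoveringMapOn_SMap.existsUnique_continuousMap_lifts f
    (a₀ := ⟨_, hzw.2⟩) (e₀ := (z, w)) (sectorMap_sectorInv_of_mem hzw).symm
    (fun p => sectorMap_notMem_cuspCurve p.2)
  classical
  let g : ℂ × ℂ → ℂ × ℂ := fun p => if hp : p ∈ sectorNhd ρ θ then L ⟨sectorInv p, hp.2⟩ else 0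
  have hgW : ∀ p (hp : p ∈ sectorNhd ρ θ), g p = L ⟨sectorInv p, hp.2⟩ := fun p hp => dif_pos hp
  have hS : ∀ p ∈ sectorNhd ρ θ, SMap (g p) = p := fun p hp => by
    rw [hgW p hp]
    exact (congr_fun hL _).trans (sectorMap_sectorInv_of_mem hp)
  have hg1 : ∀ p ∈ sectorNhd ρ θ, g p = (p.1, (g p).2) := fun p hp =>
    Prod.ext (congr_arg Prod.fst (hS p hp) : (SMap (g p)).1 = p.1) rfl
  have hcont : ContinuousOn g (sectorNhd ρ θ) := by
    rw [continuousOn_iff_continuous_domRestrict]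
    have : (sectorNhd ρ θ).domRestrict g = fun p : sectorNhd ρ θ => L ⟨sectorInv p, p.2.2⟩ :=
      funext fun p => hgW p p.2
    rw [this]
    exact L.continuous.comp ((continuousOn_sectorInv.comp_continuous continuous_subtype_val
      fun p => p.2.1).subtype_mk _)
  have hopen := isOpen_sectorNhd ρ θ
  refine ⟨⟨sectorNhd ρ θ, ⟨θ, hθ1, hθ, hsec⟩, quot Ψ ∘ g, fun p hp => ?_⟩, fun p => (g p).2, rfl,
    ⟨hcont.snd, fun p hp => ?_, fun p hp => ?_⟩, ?_⟩
  · refine H.analyticAt_quot_comp (hsub hp) (analyticAt_of_section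
      (hcont.continuousAt (hopen.mem_nhds hp)) (ne_sq_of_SMap_notMem ?_)
      (Filter.mem_of_superset (hopen.mem_nhds hp) hS)) (hS p hp)
    rw [hS p hp]
    exact (hsub hp).2
  · have := hS p hp
    rw [hg1 p hp] at this
    exact congr_arg Prod.snd this
  · simp only [Function.comp_apply, quot]
    rw [hg1 p hp]
  · simp only [hgW _ hzw]
    exact congr_arg Prod.snd hL0

/-! ### Choice of the bidisc and conclusion -/

/-- If `|ẑ| ≥ t`, then `|ẑ|³ ≤ 3|z||ẑ| + 3|ξ|` would be less than `(2/3)|ẑ|³`. It confines all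
preimages of a small bidisc to the domain of `Ψ`. -/
theorem norm_lt_of_SMap {z w : ℂ} {t : ℝ} (ht : 0 < t) (hz : ‖z‖ < t ^ 2 / 9)
    (hξ : ‖S z w‖ < t ^ 3 / 9) : ‖w‖ < t := by
  by_contra! hw
  have h1 : w ^ 3 = 3 * z * w - 3 * S z w := by
    unfold S
    ring
  have h2 : ‖w‖ ^ 3 ≤ 3 * ‖z‖ * ‖w‖ + 3 * ‖S z w‖ := by
    rw [← norm_pow, h1]
    refine (norm_sub_le _ _).trans ?_
    simp only [norm_mul, Complex.norm_ofNat]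
    exact le_rfl
  have hw0 : 0 < ‖w‖ := ht.trans_le hw
  have h3 : ‖z‖ * ‖w‖ ≤ t ^ 2 / 9 * ‖w‖ := mul_le_mul_of_nonneg_right hz.le hw0.le
  have h4 : t ^ 2 * t ≤ t ^ 2 * ‖w‖ := mul_le_mul_of_nonneg_left hw (by positivity)
  have h5 : t ^ 2 * ‖w‖ ≤ ‖w‖ ^ 2 * ‖w‖ :=
    mul_le_mul_of_nonneg_right (pow_le_pow_left₀ ht.le hw 2) hw0.le
  have h6 : 0 < t ^ 3 := by positivity
  have h7 : t ^ 2 * t = t ^ 3 := by ring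
  have h8 : ‖w‖ ^ 2 * ‖w‖ = ‖w‖ ^ 3 := by ring
  nlinarith

theorem IsAmplitudeOn.mono {F h : ℂ → ℂ} {Ψ : ℂ × ℂ → ℂ} {P Q : Set (ℂ × ℂ)}
    (H : IsAmplitudeOn F h Ψ P) (hQ : Q ⊆ P) : IsAmplitudeOn F h Ψ Q :=
  ⟨fun p hp => H.analyticAt p (hQ hp), fun w hw => H.eq_one w (hQ hw),
    fun w hw0 hw => H.deriv_eq w hw0 (hQ hw), fun p hp => H.solves p (hQ hp)⟩

end

end AiryConfluent

theorem mainTheorem9 (F h : ℂ → ℂ) (hF : AnalyticAt ℂ F 0) (hh : AnalyticAt ℂ h 0) :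
    ∃ Ψ : ℂ × ℂ → ℂ, IsAmplitude F h Ψ ∧ (∀ Ψ', IsAmplitude F h Ψ' → Ψ' =ᶠ[𝓝 0] Ψ) ∧
      (∃ U V : Set ℂ, IsOpen U ∧ IsOpen V ∧ 0 ∈ U ∧ 0 ∈ V ∧
        HasDeterminations Ψ (U ×ˢ V) ∧
        ∀ (M : Major) (ζ : ℂ × ℂ → ℂ), M.dom ⊆ (U ×ˢ V) \ cuspCurve →
          M.IsDetermination Ψ ζ →
            (∀ p ∈ M.dom, SolvesAt F M.fn p) ∧
            M.microfunction.IsConfluent ∧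
            M.ContinuesAsSolution F (U ×ˢ V)) ∧
      (Differentiable ℂ F → Differentiable ℂ h →
        Differentiable ℂ Ψ ∧
        HasDeterminations Ψ univ ∧
        ∀ (M : Major) (ζ : ℂ × ℂ → ℂ), M.dom ⊆ univ \ cuspCurve →
          M.IsDetermination Ψ ζ →
            (∀ p ∈ M.dom, SolvesAt F M.fn p) ∧
            M.microfunction.IsConfluentResurgent ∧
            M.IsResurgent ∧
            M.ContinuesAsSolution F univ) := by
  obtain ⟨Ψ, ⟨r, hr, H⟩, Hent⟩ := exists_amplitude hF hh
  have hamp : IsAmplitude F h Ψ := H.isAmplitude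
    ((continuous_foldCoord.norm.tendsto' 0 0 (by simp [foldCoord])).eventually (gt_mem_nhds hr))
  refine ⟨Ψ, hamp, fun Ψ' H' => hamp.eventuallyEq hF H', ?_, fun hF' hh' => ?_⟩
  -- Then `|z - ẑ²| < t²/9 + t² ≤ (10/9) t ≤ (5/9) r`, so the preimage of the bidisc lies where `Ψ`
  -- is an amplitude.
  · set t := min 1 (r / 2) with ht
    have ht0 : 0 < t := lt_min one_pos (half_pos hr)
    have ht1 : t ≤ 1 := min_le_left _ _
    have htr : t ≤ r / 2 := min_le_right _ _
    have hU : (0 : ℝ) < t ^ 2 / 9 := by positivity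
    have hV : (0 : ℝ) < t ^ 3 / 9 := by positivity
    have HΩ : IsAmplitudeOn F h Ψ
        (SMap ⁻¹' (Metric.ball (0 : ℂ) (t ^ 2 / 9) ×ˢ Metric.ball (0 : ℂ) (t ^ 3 / 9))) := by
      refine H.mono fun p hp => ?_
      have hz : ‖p.1‖ < t ^ 2 / 9 := mem_ball_zero_iff.1 hp.1
      have hw : ‖p.2‖ < t := norm_lt_of_SMap ht0 hz (mem_ball_zero_iff.1 hp.2)
      have h1 : ‖p.2 ^ 2‖ ≤ t ^ 2 := by
        rw [norm_pow]
        exact pow_le_pow_left₀ (norm_nonneg _) hw.le 2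
      have h2 : t ^ 2 ≤ t := by nlinarith
      refine norm_lt_iff_pair.2 ⟨(norm_sub_le p.1 (p.2 ^ 2)).trans_lt ?_, ?_⟩
      · linarith
      · change ‖p.1‖ < r
        linarith
    have hΩo : IsOpen (Metric.ball (0 : ℂ) (t ^ 2 / 9) ×ˢ Metric.ball (0 : ℂ) (t ^ 3 / 9)) :=
      Metric.isOpen_ball.prod Metric.isOpen_ball
    have hΩ0 : Metric.ball (0 : ℂ) (t ^ 2 / 9) ×ˢ Metric.ball (0 : ℂ) (t ^ 3 / 9)
        ∈ 𝓝 (0 : ℂ × ℂ) :=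
      hΩo.mem_nhds ⟨Metric.mem_ball_self hU, Metric.mem_ball_self hV⟩
    -- A bidisc centred at the origin is stable under the weighted scaling.
    have hE := isPathConnected_preimage_SMap hΩ0 fun u hu0 hu1 p hp => by
      have hu : ∀ (k : ℕ) (x : ℂ), ‖(u : ℂ) ^ k * x‖ ≤ ‖x‖ := fun k x => by
        rw [norm_mul, norm_pow, Complex.norm_real, Real.norm_of_nonneg hu0.le]
        exact mul_le_of_le_one_left (norm_nonneg _) (pow_le_one₀ hu0.le hu1)
      exact ⟨mem_ball_zero_iff.2 ((hu 2 _).trans_lt (mem_ball_zero_iff.1 hp.1)),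
        mem_ball_zero_iff.2 ((hu 3 _).trans_lt (mem_ball_zero_iff.1 hp.2))⟩
    refine ⟨_, _, Metric.isOpen_ball, Metric.isOpen_ball, Metric.mem_ball_self hU,
      Metric.mem_ball_self hV, HΩ.hasDeterminations hΩ0, fun M ζ hM hζ => ?_⟩
    have hcont := HΩ.continuesAsSolution hΩo hE hM hζ
    exact ⟨fun p hp => HΩ.solvesAt_major hM hζ hp, ⟨M, rfl, _, _, Metric.isOpen_ball,
      Metric.isOpen_ball, Metric.mem_ball_self hU, Metric.mem_ball_self hV,
      hcont.extendsTo hM⟩, hcont⟩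
  · have Hu := Hent hF' hh'
    have HΩ : IsAmplitudeOn F h Ψ (SMap ⁻¹' univ) := by rwa [preimage_univ]
    have hE := isPathConnected_preimage_SMap (Ω := univ) univ_mem
      fun _ _ _ _ _ => mem_univ _
    refine ⟨fun p => (Hu.analyticAt p (mem_univ p)).differentiableAt,
      HΩ.hasDeterminations univ_mem, fun M ζ hM hζ => ?_⟩
    have hcont := HΩ.continuesAsSolution isOpen_univ hE hM hζ
    have hres := Hu.isResurgent hM hζ
    exact ⟨fun p hp => HΩ.solvesAt_major hM hζ hp,
      ⟨⟨M, rfl, hres⟩, M, rfl, hcont.extendsTo hM⟩, hres, hcont⟩
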